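/- Let $M$ be a complex manifold of complex dimension $n\ge 1$ (Hausdorff, second countable, not necessarily compact) and let $\Omega$ be a nowhere vanishing holomorphic $(n,0)$-form on $M$. For a Hermitian metric with fundamental form $\omega=i\,g_{j\bar k}\,dz^j\wedge d\bar z^k$ let $\langle\alpha,\beta\rangle_\omega$ be the standard pointwise Hermitian product of complex forms, $\|\Omega\|_\omega^2=\langle\Omega,\Omega\rangle_\omega$, and $$(\alpha,\beta)=\int_M\langle\alpha,\beta\rangle_\omega\; i^{n^2}\,\Omega\wedge\overline\Omega .$$ Let $\partial^\dagger_{\omega,\Omega}$ be the operator conjugated to $\partial$ with respect to this product: for a smooth $(k+1)$-form $\beta$, $\partial^\dagger_{\omega,\Omega}\beta$ is the unique smooth $k$-form with $(\partial\alpha,\beta)=(\alpha,\partial^\dagger_{\omega,\Omega}\beta)$ for all smooth compactly supported $k$-forms $\alpha$ (it exists). Then: (1) A Hermitian metric $\omega$ is conformally balanced, i.e. $d(\|\Omega\|_\omega^2\,\omega^{n-1})=0$, if and only if $\partial^\dagger_{\omega,\Omega}\omega=0$. (2) Let $n\ge 2$, let $J\subset\mathbb R$ be a nondegenerate interval, and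 let $\omega(t)$, $t\in J$, be a family of Hermitian metrics on $M$, smooth in $t$ and the point jointly, such that $\omega(t_0)$ is conformally balanced for some $t_0\in J$. Then $\omega(t)$ solves the Type IIB flow $$\partial_t\big(\|\Omega\|_\omega^2\,\omega^{n-1}\big)=i\,\partial\bar\partial\big(\|\Omega\|_\omega^2\,\omega^{n-2}\big),\qquad t\in J,$$ if and only if $$\partial_t\omega=-\tfrac1{n-1}\,\partial^\dagger_{\omega,\Omega}\,\partial\omega ,\qquad t\in J;$$ equivalently, if and only if the family $\tilde\omega(s)=\omega((n-1)s)$ with rescaled time solves the Laplacian-type flow $\partial_s\tilde\omega=-\partial^\dagger_{\tilde\omega,\Omega}\,\partial\tilde\omega$ for all $s$ with $(n-1)s\in J$. -/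

import Mathlib

open MeasureTheory Set
open scoped Manifold ContDiff

noncomputable section

namespace TypeIIB

/-- The model space `ℂⁿ`. -/
abbrev Cn (n : ℕ) : Type := EuclideanSpace ℂ (Fin n)

/-- Complex-valued alternating `k`-forms on the real vector space underlying `ℂⁿ`, i.e.
`Λᵏ(T*M) ⊗ ℂ` at a point of a complex `n`-manifold. -/
abbrev Alt (n k : ℕ) : Type := Cn n [⋀^Fin k]→L[ℝ] ℂ

/-! ### Linear algebra of forms at a point -/

section Pointwise

variable {n : ℕ}

/-- Multiplication by `i` as a real linear map, the complex structure `J`. -/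
def mulI (n : ℕ) : Cn n →L[ℝ] Cn n := Complex.I • ContinuousLinearMap.id ℝ (Cn n)

/-- The complex conjugate of a form. -/
def conjAlt {k : ℕ} (α : Alt n k) : Alt n k :=
  (Complex.conjCLE.toContinuousLinearMap).compContinuousAlternatingMap α

/-- The product `(v₁, …, v_{k+l}) ↦ α(v₁, …, v_k) β(v_{k+1}, …, v_{k+l})`. -/
def mulForms {k l : ℕ} (α : Alt n k) (β : Alt n l) :
    ContinuousMultilinearMap ℝ (fun _ : Fin (k + l) => Cn n) ℂ where
  toFun v := α (fun i => v (Fin.castAdd l i)) * β (fun j => v (Fin.natAdd k j))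
  map_update_add' {inst} v i x y := by
    have : inst = instDecidableEqFin (k + l) := Subsingleton.elim _ _
    subst this
    refine Fin.addCases (fun i => ?_) (fun j => ?_) i
    · have h1 : ∀ z, (fun a : Fin k => Function.update v (Fin.castAdd l i) z (Fin.castAdd l a))
          = Function.update (fun a : Fin k => v (Fin.castAdd l a)) i z := by
        intro z; ext1 a
        by_cases h : a = i
        · subst h; simp
        · rw [Function.update_of_ne h, Function.update_of_ne]
          intro h'; exact h (Fin.castAdd_injective k l h')
      have h2 : ∀ z, (fun b : Fin l => Function.update v (Fin.castAdd l i) z (Fin.natAdd k b))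
          = fun b : Fin l => v (Fin.natAdd k b) := by
        intro z; ext1 b
        rw [Function.update_of_ne]
        intro h'; have := congrArg Fin.val h'; simp at this; omega
      simp only [h1, h2, ContinuousAlternatingMap.map_update_add, add_mul]
    · have h1 : ∀ z, (fun b : Fin l => Function.update v (Fin.natAdd k j) z (Fin.natAdd k b))
          = Function.update (fun b : Fin l => v (Fin.natAdd k b)) j z := by
        intro z; ext1 a
        by_cases h : a = j
        · subst h; simp
        · rw [Function.update_of_ne h, Function.update_of_ne]
          intro h'; exact h (Fin.natAdd_injective l k h')
      have h2 : ∀ z, (fun a : Fin k => Function.update v (Fin.natAdd k j) z (Fin.castAdd l a))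
          = fun a : Fin k => v (Fin.castAdd l a) := by
        intro z; ext1 b
        rw [Function.update_of_ne]
        intro h'; have := congrArg Fin.val h'; simp at this; omega
      simp only [h1, h2, ContinuousAlternatingMap.map_update_add, mul_add]
  map_update_smul' {inst} v i c x := by
    have : inst = instDecidableEqFin (k + l) := Subsingleton.elim _ _
    subst this
    refine Fin.addCases (fun i => ?_) (fun j => ?_) i
    · have h1 : ∀ z, (fun a : Fin k => Function.update v (Fin.castAdd l i) z (Fin.castAdd l a))
          = Function.update (fun a : Fin k => v (Fin.castAdd l a)) i z := by
        intro z; ext1 a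
        by_cases h : a = i
        · subst h; simp
        · rw [Function.update_of_ne h, Function.update_of_ne]
          intro h'; exact h (Fin.castAdd_injective k l h')
      have h2 : ∀ z, (fun b : Fin l => Function.update v (Fin.castAdd l i) z (Fin.natAdd k b))
          = fun b : Fin l => v (Fin.natAdd k b) := by
        intro z; ext1 b
        rw [Function.update_of_ne]
        intro h'; have := congrArg Fin.val h'; simp at this; omega
      simp only [h1, h2, ContinuousAlternatingMap.map_update_smul, smul_mul_assoc]
    · have h1 : ∀ z, (fun b : Fin l => Function.update v (Fin.natAdd k j) z (Fin.natAdd k b))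
          = Function.update (fun b : Fin l => v (Fin.natAdd k b)) j z := by
        intro z; ext1 a
        by_cases h : a = j
        · subst h; simp
        · rw [Function.update_of_ne h, Function.update_of_ne]
          intro h'; exact h (Fin.natAdd_injective l k h')
      have h2 : ∀ z, (fun a : Fin k => Function.update v (Fin.natAdd k j) z (Fin.castAdd l a))
          = fun a : Fin k => v (Fin.castAdd l a) := by
        intro z; ext1 b
        rw [Function.update_of_ne]
        intro h'; have := congrArg Fin.val h'; simp at this; omega
      simp only [h1, h2, ContinuousAlternatingMap.map_update_smul, mul_smul_comm]
  cont := by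
    refine Continuous.mul ?_ ?_
    · exact α.cont.comp (continuous_pi fun i => continuous_apply _)
    · exact β.cont.comp (continuous_pi fun i => continuous_apply _)

/-- The wedge product
`(α ∧ β)(v) = 1/(k! l!) ∑_σ sgn(σ) α(v_{σ(1)}, …, v_{σ(k)}) β(v_{σ(k+1)}, …, v_{σ(k+l)})`. -/
def wedge {k l : ℕ} (α : Alt n k) (β : Alt n l) : Alt n (k + l) :=
  ((k.factorial : ℝ) * (l.factorial : ℝ))⁻¹ • (mulForms α β).alternatization

/-- The powers `wᵏ = w ∧ ⋯ ∧ w` of a `2`-form. -/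
def wedgePow (w : Alt n 2) : (k : ℕ) → Alt n (2 * k)
  | 0 =>
    haveI : IsEmpty (Fin (2 * 0)) := (inferInstance : IsEmpty (Fin 0))
    ContinuousAlternatingMap.constOfIsEmpty ℝ (Cn n) (Fin (2 * 0)) (1 : ℂ)
  | k + 1 => wedge (wedgePow w k) w

/-- The real basis `e₁, …, eₙ, i e₁, …, i eₙ` of `ℂⁿ`. -/
def realBasis (n : ℕ) : Fin (n + n) → Cn n :=
  Fin.append (fun j => EuclideanSpace.single j (1 : ℂ)) (fun j => EuclideanSpace.single j Complex.I)

/-- The matrix `g_{ab} = g(b_a, b_b)`, in the real basis `b`, of the Riemannian metric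
`g(v, w) = ω(v, J w)` associated with a Hermitian form `ω`. For
`ω = i g_{j k̄} dzʲ ∧ dz̄ᵏ` its sesquilinear extension satisfies `⟨dzʲ, dzᵏ⟩ = g^{j k̄}`. -/
def gram (w : Alt n 2) : Matrix (Fin (n + n)) (Fin (n + n)) ℝ :=
  Matrix.of fun a b => (w ![realBasis n a, mulI n (realBasis n b)]).re

/-- The pointwise Hermitian product of complex `k`-forms,
`⟨α, β⟩_ω = 1/k! g^{a₁b₁} ⋯ g^{a_kb_k} α_{a₁…a_k} conj(β_{b₁…b_k})`. -/
def hermInner {k : ℕ} (w : Alt n 2) (α β : Alt n k) : ℂ :=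
  ((k.factorial : ℂ))⁻¹ * ∑ a : Fin k → Fin (n + n), ∑ b : Fin k → Fin (n + n),
    ((∏ i, (gram w)⁻¹ (a i) (b i) : ℝ) : ℂ) * α (fun i => realBasis n (a i)) *
      (starRingEnd ℂ) (β (fun i => realBasis n (b i)))

/-- `‖Ω‖²_ω` for an `(n,0)`-form `Ω`. -/
def normSq (w : Alt n 2) (Θ : Alt n n) : ℝ := (hermInner w Θ Θ).re

/-- The complex linear part `v ↦ ½ (L v - i L(i v))` of a real linear map. -/
def linPart {k : ℕ} (L : Cn n →L[ℝ] Alt n k) : Cn n →L[ℝ] Alt n k :=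
  (2⁻¹ : ℂ) • (L - Complex.I • L.comp (mulI n))

/-- The complex antilinear part `v ↦ ½ (L v + i L(i v))` of a real linear map. -/
def antilinPart {k : ℕ} (L : Cn n →L[ℝ] Alt n k) : Cn n →L[ℝ] Alt n k :=
  (2⁻¹ : ℂ) • (L + Complex.I • L.comp (mulI n))

end Pointwise

/-! ### Differential forms on a complex manifold -/

section Forms

variable {n : ℕ} {M : Type*} [TopologicalSpace M] [ChartedSpace (Cn n) M]

/-- The representative of a field of `k`-forms in the chart at `x₀`, that is, its pullback under
the inverse chart. As for Mathlib's `TangentSpace`, the value `α x` is expressed through the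
identification of the tangent space at `x` with `ℂⁿ` given by the preferred chart at `x`. -/
def rep {k : ℕ} (x₀ : M) (α : M → Alt n k) (y : Cn n) : Alt n k :=
  (α ((chartAt (Cn n) x₀).symm y)).compContinuousLinearMap
    (fderiv ℝ (fun z => chartAt (Cn n) ((chartAt (Cn n) x₀).symm y)
      ((chartAt (Cn n) x₀).symm z)) y)

/-- Smooth complex-valued differential `k`-forms. -/
def SmoothForm {k : ℕ} (α : M → Alt n k) : Prop :=
  ∀ x₀ : M, ContDiffOn ℝ ∞ (rep x₀ α) (chartAt (Cn n) x₀).target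

/-- Families of differential `k`-forms that are smooth in the time `t ∈ J` and the point,
jointly. -/
def SmoothFamily {k : ℕ} (J : Set ℝ) (α : ℝ → M → Alt n k) : Prop :=
  ∀ x₀ : M, ContDiffOn ℝ ∞ (fun p : ℝ × Cn n => rep x₀ (α p.1) p.2)
    (J ×ˢ (chartAt (Cn n) x₀).target)

/-- The exterior derivative `d`. -/
def extD {k : ℕ} (α : M → Alt n k) (x : M) : Alt n (k + 1) :=
  extDeriv (rep x α) (chartAt (Cn n) x x)

/-- The operator `∂`, given in holomorphic coordinates by `∂α = ∑ⱼ dzʲ ∧ ∂α/∂zʲ`. -/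
def del {k : ℕ} (α : M → Alt n k) (x : M) : Alt n (k + 1) :=
  ContinuousAlternatingMap.alternatizeUncurryFin
    (linPart (fderiv ℝ (rep x α) (chartAt (Cn n) x x)))

/-- The operator `∂̄`, given in holomorphic coordinates by `∂̄α = ∑ⱼ dz̄ʲ ∧ ∂α/∂z̄ʲ`. -/
def delBar {k : ℕ} (α : M → Alt n k) (x : M) : Alt n (k + 1) :=
  ContinuousAlternatingMap.alternatizeUncurryFin
    (antilinPart (fderiv ℝ (rep x α) (chartAt (Cn n) x x)))

/-- `w` is the fundamental form `ω = i g_{j k̄} dzʲ ∧ dz̄ᵏ` of a smooth Hermitian metric: a smooth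
real positive `(1,1)`-form. -/
structure IsHermitianMetric (w : M → Alt n 2) : Prop where
  smooth : SmoothForm w
  real : ∀ x, conjAlt (w x) = w x
  type_one_one : ∀ x u v, w x ![mulI n u, mulI n v] = w x ![u, v]
  pos : ∀ x v, v ≠ 0 → 0 < (w x ![v, mulI n v]).re

/-- `Θ` is a nowhere vanishing holomorphic `(n,0)`-form. -/
structure IsHolomorphicVolumeForm (Θ : M → Alt n n) : Prop where
  smooth : SmoothForm Θ
  type_n_zero : ∀ x v i, Θ x (Function.update v i (mulI n (v i))) = Complex.I * Θ x v
  holomorphic : ∀ x, delBar Θ x = 0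
  ne_zero : ∀ x, Θ x ≠ 0

/-! ### The weighted `L²` product and the adjoint of `∂` -/

/-- The volume form `i^{n²} Ω ∧ Ω̄`. -/
def volForm (Θ : M → Alt n n) (x : M) : Alt n (n + n) :=
  Complex.I ^ (n ^ 2) • wedge (Θ x) (conjAlt (Θ x))

variable [MeasurableSpace M]

/-- The measure on `M` defined by the volume form `i^{n²} Ω ∧ Ω̄`: it is glued from the measures
that the volume form defines in the charts (they agree on overlaps, so that the least upper bound
is the measure that restricts to each of them). -/
def volMeasure (Θ : M → Alt n n) : Measure M :=
  ⨆ x₀ : M, Measure.map (chartAt (Cn n) x₀).symm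
    ((volume.restrict (chartAt (Cn n) x₀).target).withDensity
      fun y => ENNReal.ofReal ‖rep x₀ (volForm Θ) y (realBasis n)‖)

/-- The scalar product `(α, β) = ∫_M ⟨α, β⟩_ω i^{n²} Ω ∧ Ω̄`. -/
def L2 {k : ℕ} (w : M → Alt n 2) (Θ : M → Alt n n) (α β : M → Alt n k) : ℂ :=
  ∫ x, hermInner (w x) (α x) (β x) ∂(volMeasure Θ)

/-- `γ` is the image of `β` under the operator conjugated to `∂`: `(∂α, β) = (α, γ)` for all
smooth compactly supported `α`. -/
def IsDelAdjoint {k : ℕ} (w : M → Alt n 2) (Θ : M → Alt n n)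
    (β : M → Alt n (k + 1)) (γ : M → Alt n k) : Prop :=
  ∀ α : M → Alt n k, SmoothForm α → HasCompactSupport α → L2 w Θ (del α) β = L2 w Θ α γ

open Classical in
/-- The operator `∂†_{ω,Ω}` conjugated to `∂` with respect to the scalar product `L2`. -/
def delDagger {k : ℕ} (w : M → Alt n 2) (Θ : M → Alt n n) (β : M → Alt n (k + 1)) :
    M → Alt n k :=
  if h : ∃ γ : M → Alt n k, SmoothForm γ ∧ IsDelAdjoint w Θ β γ then h.choose else 0

end Forms

/-! ### The conformally balanced condition and the flows -/

section Flow

variable {n : ℕ} {M : Type*} [TopologicalSpace M] [ChartedSpace (Cn n) M]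

/-- The form `‖Ω‖²_ω ωᵏ`. -/
def weightedPow (w : M → Alt n 2) (Θ : M → Alt n n) (k : ℕ) (x : M) : Alt n (2 * k) :=
  normSq (w x) (Θ x) • wedgePow (w x) k

/-- The conformally balanced condition `d(‖Ω‖²_ω ωⁿ⁻¹) = 0`. -/
def ConformallyBalanced (w : M → Alt n 2) (Θ : M → Alt n n) : Prop :=
  ∀ x, extD (weightedPow w Θ (n - 1)) x = 0

/-- The Type IIB flow equation `∂_t(‖Ω‖²_ω ωⁿ⁻¹) = i ∂∂̄(‖Ω‖²_ω ωⁿ⁻²)` on the time interval `J`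
(an identity of `2(n-1)`-forms, evaluated on tangent vectors). -/
def TypeIIBFlow (hn : 2 ≤ n) (J : Set ℝ) (w : ℝ → M → Alt n 2) (Θ : M → Alt n n) : Prop :=
  ∀ t ∈ J, ∀ x : M, ∀ v : Fin (2 * (n - 1)) → Cn n,
    HasDerivWithinAt (fun s => weightedPow (w s) Θ (n - 1) x v)
      (Complex.I * del (delBar (weightedPow (w t) Θ (n - 2))) x
        (fun a => v (Fin.cast (by omega) a))) J t

/-- The flow equation `∂_t ω = -c ∂†_{ω,Ω} ∂ω` on the time interval `J`. -/
def LaplacianFlow [MeasurableSpace M] (c : ℝ) (J : Set ℝ) (w : ℝ → M → Alt n 2)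
    (Θ : M → Alt n n) : Prop :=
  ∀ t ∈ J, ∀ x : M,
    HasDerivWithinAt (fun s => w s x) (-(c • delDagger (w t) Θ (del (w t)) x)) J t

end Flow

end TypeIIB

end

/-! Everything is computed in holomorphic charts, where the volume form `i^{n²} Ω ∧ Ω̄` has a density
`ρ` with respect to Lebesgue measure and the metric is given by the matrix `g_{j k̄}`.

The adjoint of `∂`. For a constant form `A`, integration by parts (`integral_wirt_eq_zero`,
`hermInner_coordDel`) gives the local formula `ρ ⟨A, ∂†β⟩ = - ∑ₗ ∂/∂zˡ (ρ ⟨dzˡ ∧ A, β⟩)`. The right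
side determines `∂†β` because the product is nondegenerate. Two local solutions agree on the
overlap of their charts since they have the same products with all test forms (`eqOn_of_L2_eq`), so
they define a global form, and a partition of unity shows that it satisfies the adjunction formula
for all test forms (`isDelAdjoint_adjointForm`). This gives the formula for `delDagger` in charts,
`hermInner_rep_delDagger`, from which all that follows is derived.

Powers of `ω`. Exterior multiplications by the forms `dzʲ ∧ dz̄ᵏ` commute, and a product of them
changes sign when two of the `dz̄` are exchanged (`SwapRel`). In the commutative algebra that they
generate, `dzʲ ∧ dz̄ᵏ ∧ ωⁿ⁻¹` is the cofactor of `g_{j k̄}` times a fixed top form, and products of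
two of them with `ωⁿ⁻²` give the `2 × 2` minors of `g⁻¹` times `det g`. Since `‖Ω‖²_ω det g` is a
constant multiple of `ρ`, the coefficients of `‖Ω‖²_ω ωⁿ⁻¹` are constant multiples of `ρ g^{k̄ j}`
(`IsHermitianForm.xyOp_smul_wedgePow`) and those of `‖Ω‖²_ω ωⁿ⁻²` of
`ρ (g^{m̄ l} g^{k̄ j} - g^{m̄ j} g^{k̄ l})` (`IsHermitianForm.xyOp_xyOp_smul_wedgePow`).

Balanced metrics. Both `d(‖Ω‖²_ω ωⁿ⁻¹) = 0` and `∂†ω = 0` say that `∑ₗ ∂/∂zˡ (ρ g^{k̄ l}) = 0` for all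
`k` (`extDeriv_rep_weightedPow_eq_zero_iff`, `rep_delDagger_self_eq_zero_iff`).

The flows. Each of them is an evolution equation `ρ ∂_t g^{k̄ j} = 1/(n-1) ∑ₗ ∂/∂zˡ S_{klj}`
(`typeIIBFlow_iff`, `laplacianFlow_iff`), with fluxes `S` that differ for the two flows but are both
antisymmetric in `l` and `j`. Antisymmetry makes the divergence of the right side vanish, so
`∑ⱼ ∂/∂zʲ (ρ g^{k̄ j})` is constant in time (`divergence_eq_zero_of_evolution`): a solution of either
flow that is balanced at one time is balanced at all times. For balanced metrics the two fluxes are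
equal (`typeIIBFlux_eq_laplacianFlux`), hence so are the flows.
-/

noncomputable section

namespace TypeIIB

/-! ### Exterior multiplication by one-forms -/

section ExteriorMultiplication

variable {n k l : ℕ}

/-- Complex-valued real-linear functionals on `ℂⁿ`, i.e. complex one-forms at a point. -/
abbrev CoVec (n : ℕ) : Type := Cn n →L[ℝ] ℂ

/-- The vectors `e₁, …, eₙ, i e₁, …, i eₙ` as a basis of the real vector space `ℂⁿ`. -/
def stdRealBasis (n : ℕ) : Module.Basis (Fin (n + n)) ℝ (Cn n) :=
  basisOfLinearIndependentOfCardEqFinrank' (realBasis n) (by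
    rw [Fintype.linearIndependent_iff]
    intro g hg
    have key : ∀ j : Fin n, (g (Fin.castAdd n j) : ℂ) + g (Fin.natAdd n j) * Complex.I = 0 := by
      intro j
      have h := congrArg (fun v : Cn n => v j) hg
      simp only [Fin.sum_univ_add, realBasis, Fin.append_left, Fin.append_right] at h
      simpa [Pi.single_apply, -Fin.natAdd_eq_addNat] using h
    intro i
    refine Fin.addCases (fun j => ?_) (fun j => ?_) i
    · simpa using congrArg Complex.re (key j)
    · simpa using congrArg Complex.im (key j)) (by
    rw [← Module.finrank_mul_finrank ℝ ℂ (Cn n)]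
    simp [two_mul])

@[simp]
lemma stdRealBasis_apply (a : Fin (n + n)) : stdRealBasis n a = realBasis n a := by
  simp [stdRealBasis]

lemma ext_realBasis {α β : Alt n k}
    (h : ∀ a : Fin k → Fin (n + n), α (fun i => realBasis n (a i)) = β (fun i => realBasis n (a i))) :
    α = β := by
  have : α.toMultilinearMap = β.toMultilinearMap :=
    Module.Basis.ext_multilinear (fun _ => stdRealBasis n) (fun a => by simpa using h a)
  ext v
  exact congrArg (fun m : MultilinearMap ℝ (fun _ : Fin k => Cn n) ℂ => m v) this

instance finiteDimensional_complex_alt : FiniteDimensional ℂ (Alt n k) := by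
  let f : Alt n k →ₗ[ℂ] ((Fin k → Fin (n + n)) → ℂ) :=
    { toFun := fun α a => α (fun i => realBasis n (a i))
      map_add' := fun _ _ => rfl
      map_smul' := fun _ _ => rfl }
  exact FiniteDimensional.of_injective f fun α β h => ext_realBasis fun a => congrFun h a

lemma alt_smul_zero (c : ℂ) : c • (0 : Alt n k) = 0 := smul_zero (M := ℂ) (A := Alt n k) c

lemma alt_zero_apply (v : Fin k → Cn n) : (0 : Alt n k) v = 0 := rfl

/-- Left exterior multiplication `β ↦ φ ∧ β` by a one-form. -/
def extMul (φ : CoVec n) : Alt n k →ₗ[ℂ] Alt n (k + 1) where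
  toFun β := ContinuousAlternatingMap.alternatizeUncurryFin (φ.smulRight β)
  map_add' β γ := by
    rw [← ContinuousAlternatingMap.alternatizeUncurryFin_add]
    congr 1
    ext u v
    simp
  map_smul' c β := by
    rw [RingHom.id_apply, ← ContinuousAlternatingMap.alternatizeUncurryFin_smul]
    congr 1
    ext u v
    simp [mul_left_comm]

lemma extMul_def (φ : CoVec n) (β : Alt n k) :
    extMul φ β = ContinuousAlternatingMap.alternatizeUncurryFin (φ.smulRight β) := rfl

lemma extMul_apply (φ : CoVec n) (β : Alt n k) (v : Fin (k + 1) → Cn n) :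
    extMul φ β v = ∑ i : Fin (k + 1), (-1) ^ (i : ℕ) * (φ (v i) * β (fun j => v (i.succAbove j))) := by
  simp [extMul_def, ContinuousAlternatingMap.alternatizeUncurryFin_apply]
  rfl

lemma extMul_add_left (φ ψ : CoVec n) (β : Alt n k) :
    extMul (φ + ψ) β = extMul φ β + extMul ψ β := by
  ext v
  simp [extMul_apply, add_mul, mul_add, Finset.sum_add_distrib]

lemma extMul_smul_left (c : ℂ) (φ : CoVec n) (β : Alt n k) :
    extMul (c • φ) β = c • extMul φ β := by
  ext v
  simp [extMul_apply, Finset.mul_sum, mul_left_comm, mul_assoc]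

lemma extMul_anticomm (φ ψ : CoVec n) (β : Alt n k) :
    extMul φ (extMul ψ β) = -extMul ψ (extMul φ β) := by
  have hcomp : ∀ φ ψ : CoVec n, extMul φ (extMul ψ β) =
      ContinuousAlternatingMap.alternatizeUncurryFin
        (ContinuousAlternatingMap.alternatizeUncurryFinCLM ℝ (Cn n) ℂ ∘L
          LinearMap.toContinuousLinearMap
            { toFun := fun u => φ u • ψ.smulRight β
              map_add' := fun u v => by ext; simp [add_mul]
              map_smul' := fun c u => by ext; simp [mul_assoc] }) := by
    intro φ ψ
    rw [extMul_def]
    congr 1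
    ext1 u
    simp [extMul_def]
  rw [eq_neg_iff_add_eq_zero, hcomp, hcomp, ← ContinuousAlternatingMap.alternatizeUncurryFin_add,
    ← ContinuousLinearMap.comp_add]
  refine ContinuousAlternatingMap.alternatizeUncurryFin_alternatizeUncurryFinCLM_comp_of_symmetric
    fun x y => ?_
  ext v
  simp
  ring

lemma extMul_self (φ : CoVec n) (β : Alt n k) : extMul φ (extMul φ β) = 0 := by
  have h := extMul_anticomm φ φ β
  rwa [eq_neg_iff_add_eq_zero, ← two_smul ℂ, smul_eq_zero_iff_right two_ne_zero] at h

/-- A form of less than top degree is determined by its exterior products with one-forms: with a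
basis `b` and its dual basis `φ`, one has `∑ₐ ι_{bₐ}(φₐ ∧ β) = (2n - k) β`. -/
lemma eq_zero_of_extMul_eq_zero (hk : k < n + n) (β : Alt n k)
    (h : ∀ φ : CoVec n, extMul φ β = 0) : β = 0 := by
  let φ : Fin (n + n) → CoVec n := fun a =>
    Complex.ofRealCLM.comp ((stdRealBasis n).coord a).toContinuousLinearMap
  ext v
  have hv : ∀ u : Cn n, ∑ a, φ a u • realBasis n a = u := fun u => by
    have := (stdRealBasis n).sum_repr u
    simpa [φ] using this
  have hsum : ∑ a, extMul (φ a) β (Fin.cons (realBasis n a) v) = (((n + n : ℕ) : ℂ) - k) * β v := by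
    simp only [extMul_apply, Fin.sum_univ_succ, Finset.sum_add_distrib]
    have h1 : ∑ a, (-1 : ℂ) ^ ((0 : Fin (k + 1)) : ℕ) * (φ a ((Fin.cons (realBasis n a) v :
        Fin (k + 1) → Cn n) 0) * β fun j => (Fin.cons (realBasis n a) v : Fin (k + 1) → Cn n)
          ((0 : Fin (k + 1)).succAbove j)) = ((n + n : ℕ) : ℂ) * β v := by
      have : ∀ a, φ a (realBasis n a) = 1 := fun a => by
        have := (stdRealBasis n).repr_self_apply a a
        rw [stdRealBasis_apply] at this
        simp [φ, this]
      simp [this]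
    have h2 : ∑ a, ∑ i : Fin k, (-1 : ℂ) ^ (i.succ : ℕ) * (φ a ((Fin.cons (realBasis n a) v :
        Fin (k + 1) → Cn n) i.succ) * β fun j => (Fin.cons (realBasis n a) v : Fin (k + 1) → Cn n)
          (i.succ.succAbove j)) = -(k : ℂ) * β v := by
      rw [Finset.sum_comm]
      have : ∀ i : Fin k, ∑ a, (-1 : ℂ) ^ (i.succ : ℕ) * (φ a ((Fin.cons (realBasis n a) v :
        Fin (k + 1) → Cn n) i.succ) * β fun j => (Fin.cons (realBasis n a) v : Fin (k + 1) → Cn n)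
          (i.succ.succAbove j)) = -β v := by
        intro i
        obtain ⟨m, rfl⟩ : ∃ m, k = m + 1 := ⟨k - 1, by have := i.2; omega⟩
        have e1 : ∀ u : Cn n, (fun j => (Fin.cons u v : Fin (m + 1 + 1) → Cn n)
            (i.succ.succAbove j)) = Matrix.vecCons u (i.removeNth v) := by
          intro u
          funext j
          refine Fin.cases ?_ (fun j => ?_) j <;> simp [Fin.removeNth_apply]
        simp only [e1, Fin.cons_succ]
        have e2 : ∑ a, φ a (v i) * β (Matrix.vecCons (realBasis n a) (i.removeNth v))
            = β (Matrix.vecCons (v i) (i.removeNth v)) := by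
          have e3 : ∀ u, β (Matrix.vecCons u (i.removeNth v)) = β.curryLeft u (i.removeNth v) :=
            fun u => rfl
          simp only [e3]
          conv_rhs => rw [← hv (v i)]
          rw [map_sum, ContinuousAlternatingMap.sum_apply]
          refine Finset.sum_congr rfl fun a _ => ?_
          have : (φ a (v i)) • realBasis n a = ((stdRealBasis n).coord a (v i)) • realBasis n a := by
            simp [φ]
          rw [this, map_smul]
          simp [φ]
        rw [← Finset.mul_sum, e2]
        have e4 := β.neg_one_pow_smul_map_insertNth i (v i) (i.removeNth v)
        rw [Fin.insertNth_self_removeNth] at e4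
        rw [← e4, Fin.val_succ, pow_succ]
        simp only [zsmul_eq_mul]
        push_cast
        have e5 : (-1 : ℂ) ^ (i : ℕ) * (-1) ^ (i : ℕ) = 1 := by
          rw [← pow_add, Even.neg_one_pow ⟨_, rfl⟩]
        linear_combination (-β v) * e5
      rw [Finset.sum_congr rfl fun i _ => this i]
      simp
    rw [h1, h2]
    ring
  simp only [h, alt_zero_apply, Finset.sum_const_zero] at hsum
  have hne : (((n + n : ℕ) : ℂ) - k) ≠ 0 := by
    rw [sub_ne_zero]
    exact_mod_cast hk.ne'
  simpa using (mul_eq_zero.1 hsum.symm).resolve_left hne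

end ExteriorMultiplication

/-! ### Products of one-forms -/

section Words

variable {n k l : ℕ}

/-- The exterior product `φ₀ ∧ ⋯ ∧ φ_{k-1}` of one-forms. -/
def extWord : (k : ℕ) → (Fin k → CoVec n) → Alt n k
  | 0, _ => ContinuousAlternatingMap.constOfIsEmpty ℝ (Cn n) (Fin 0) (1 : ℂ)
  | k + 1, φ => extMul (φ 0) (extWord k fun i => φ i.succ)

lemma extWord_apply (φ : Fin k → CoVec n) (v : Fin k → Cn n) :
    extWord k φ v = (Matrix.of fun i j => φ i (v j)).det := by
  induction k with
  | zero => simp [extWord]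
  | succ k ih =>
    rw [extWord, extMul_apply, Matrix.det_succ_row_zero]
    refine Finset.sum_congr rfl fun i _ => ?_
    rw [ih, mul_assoc]
    rfl

/-- The complex coframe `dz¹, …, dzⁿ, dz̄¹, …, dz̄ⁿ`. -/
def coframe : Fin n ⊕ Fin n → CoVec n
  | .inl j => (EuclideanSpace.proj j : Cn n →L[ℂ] ℂ).restrictScalars ℝ
  | .inr j => Complex.conjCLE.toContinuousLinearMap.comp
      ((EuclideanSpace.proj j : Cn n →L[ℂ] ℂ).restrictScalars ℝ)

@[simp] lemma coframe_inl (j : Fin n) (v : Cn n) : coframe (.inl j) v = v j := rfl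

@[simp] lemma coframe_inr (j : Fin n) (v : Cn n) :
    coframe (.inr j) v = (starRingEnd ℂ) (v j) := rfl

/-- A real-linear map on `ℂⁿ` is the sum of its `dzʲ` and `dz̄ʲ` components. -/
lemma apply_eq_sum_coframe {V : Type*} [AddCommGroup V] [Module ℂ V] [Module ℝ V]
    [IsScalarTower ℝ ℂ V] [TopologicalSpace V]
    (L : Cn n →L[ℝ] V) (v : Cn n) :
    L v = ∑ j, coframe (.inl j) v • ((2⁻¹ : ℂ) • (L (EuclideanSpace.single j 1)
        - Complex.I • L (EuclideanSpace.single j Complex.I)))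
      + ∑ j, coframe (.inr j) v • ((2⁻¹ : ℂ) • (L (EuclideanSpace.single j 1)
        + Complex.I • L (EuclideanSpace.single j Complex.I))) := by
  have hv : v = ∑ j, ((v j).re • EuclideanSpace.single j (1 : ℂ)
      + (v j).im • EuclideanSpace.single j Complex.I) := by
    ext i
    simp only [WithLp.ofLp_sum, Finset.sum_apply, PiLp.add_apply, PiLp.smul_apply,
      PiLp.single_apply, Complex.real_smul]
    rw [Finset.sum_eq_single i (fun j _ hj => by simp [hj.symm]) (by simp)]
    simp [Complex.re_add_im]
  conv_lhs => rw [hv]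
  rw [map_sum, ← Finset.sum_add_distrib]
  refine Finset.sum_congr rfl fun j _ => ?_
  rw [map_add, map_smul, map_smul, coframe_inl, coframe_inr]
  have h1 : ((v j).re : ℂ) = 2⁻¹ * (v j + (starRingEnd ℂ) (v j)) := by
    rw [Complex.add_conj]; push_cast; ring
  have h2 : ((v j).im : ℂ) = 2⁻¹ * (-Complex.I * v j + Complex.I * (starRingEnd ℂ) (v j)) := by
    have := Complex.sub_conj (v j)
    have hI := Complex.I_mul_I
    push_cast at this
    linear_combination (-(2⁻¹ : ℂ) * Complex.I) * (-this) + (v j).im * hI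
  rw [RCLike.real_smul_eq_coe_smul (K := ℂ), RCLike.real_smul_eq_coe_smul (K := ℂ)]
  simp only [Complex.coe_algebraMap]
  rw [h1, h2]
  module

lemma coVec_eq_sum_coframe (φ : CoVec n) : ∃ a : Fin n ⊕ Fin n → ℂ, φ = ∑ c, a c • coframe c := by
  refine ⟨Sum.elim (fun j => (2⁻¹ : ℂ) • (φ (EuclideanSpace.single j 1)
        - Complex.I • φ (EuclideanSpace.single j Complex.I)))
      (fun j => (2⁻¹ : ℂ) • (φ (EuclideanSpace.single j 1)
        + Complex.I • φ (EuclideanSpace.single j Complex.I))), ?_⟩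
  ext v
  rw [apply_eq_sum_coframe φ v]
  simp [mul_comm]

lemma extMul_sum_smul_left {ι : Type*} (s : Finset ι) (a : ι → ℂ) (φ : ι → CoVec n) (β : Alt n k) :
    extMul (∑ c ∈ s, a c • φ c) β = ∑ c ∈ s, a c • extMul (φ c) β := by
  classical
  induction s using Finset.induction_on with
  | empty => ext v; simp [extMul_apply]
  | insert c s hc ih => rw [Finset.sum_insert hc, extMul_add_left, extMul_smul_left, ih,
      Finset.sum_insert hc]

/-- A form of less than top degree whose exterior products with the coframe vanish is zero. -/
lemma eq_zero_of_extMul_coframe_eq_zero (hk : k < n + n) (β : Alt n k)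
    (h : ∀ c, extMul (coframe c) β = 0) : β = 0 := by
  refine eq_zero_of_extMul_eq_zero hk β fun φ => ?_
  obtain ⟨a, rfl⟩ := coVec_eq_sum_coframe φ
  rw [extMul_sum_smul_left]
  exact Finset.sum_eq_zero fun c _ => by rw [h, alt_smul_zero]

/-- The products of coframe elements span the space of all forms. -/
lemma span_extWord_coframe (k : ℕ) :
    Submodule.span ℂ (Set.range fun e : Fin k → Fin n ⊕ Fin n =>
      extWord k fun i => coframe (e i)) = ⊤ := by
  induction k with
  | zero =>
    rw [eq_top_iff]
    intro α _
    have : α = α 0 • extWord 0 (fun i : Fin 0 => coframe ((Fin.elim0 : Fin 0 → Fin n ⊕ Fin n) i)) := by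
      ext v
      rw [ContinuousAlternatingMap.smul_apply, Subsingleton.elim v 0]
      simp [extWord]
    rw [this]
    exact Submodule.smul_mem _ _ (Submodule.subset_span ⟨Fin.elim0, rfl⟩)
  | succ k ih =>
    have hmul : ∀ (φ : CoVec n) (β : Alt n k), extMul φ β ∈
        Submodule.span ℂ (Set.range fun e : Fin (k + 1) → Fin n ⊕ Fin n =>
          extWord (k + 1) fun i => coframe (e i)) := by
      intro φ β
      obtain ⟨a, rfl⟩ := coVec_eq_sum_coframe φ
      rw [extMul_sum_smul_left]
      refine Submodule.sum_mem _ fun c _ => Submodule.smul_mem _ _ ?_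
      have hβ : β ∈ Submodule.span ℂ (Set.range fun e : Fin k → Fin n ⊕ Fin n =>
          extWord k fun i => coframe (e i)) := by rw [ih]; trivial
      refine Submodule.span_induction ?_ ?_ ?_ ?_ hβ
      · rintro _ ⟨e, rfl⟩
        exact Submodule.subset_span ⟨Fin.cons c e, by simp [extWord]⟩
      · rw [map_zero]; exact Submodule.zero_mem _
      · intro x y _ _ hx hy
        rw [map_add]; exact Submodule.add_mem _ hx hy
      · intro r x _ hx
        rw [map_smul]; exact Submodule.smul_mem _ _ hx
    rw [eq_top_iff]
    intro α _
    have hα : α = ((k + 1 : ℂ))⁻¹ • ∑ a, extMul (Complex.ofRealCLM.comp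
        ((stdRealBasis n).coord a).toContinuousLinearMap) (α.curryLeft (realBasis n a)) := by
      rw [eq_inv_smul_iff₀ (by exact_mod_cast Nat.succ_ne_zero k)]
      have h1 := ContinuousAlternatingMap.alternatizeUncurryFin_curryLeft (𝕜 := ℝ) α
      have h2 : α.curryLeft = ∑ a, ContinuousLinearMap.smulRight (Complex.ofRealCLM.comp
          ((stdRealBasis n).coord a).toContinuousLinearMap) (α.curryLeft (realBasis n a)) := by
        ext1 u
        conv_lhs => rw [← (stdRealBasis n).sum_repr u]
        rw [map_sum, _root_.sum_apply]
        refine Finset.sum_congr rfl fun a _ => ?_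
        rw [map_smul, stdRealBasis_apply]
        ext v
        simp
      rw [h2, ← ContinuousAlternatingMap.alternatizeUncurryFinCLM_apply, map_sum] at h1
      simp only [extMul_def]
      have h3 : (↑k + 1 : ℂ) • α = (k + 1) • α := by
        rw [← Nat.cast_smul_eq_nsmul ℂ]; push_cast; rfl
      rw [h3, ← h1]
      rfl
    rw [hα]
    exact Submodule.smul_mem _ _ (Submodule.sum_mem _ fun a _ => hmul _ _)

end Words

/-! ### The wedge product -/

section Wedge

variable {n k l : ℕ}

/-- The alternating sum `∑_σ sgn(σ) F(v ∘ σ)`. -/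
def altSum {E : Type*} (N : ℕ) (F : (Fin N → E) → ℂ) (v : Fin N → E) : ℂ :=
  ∑ σ : Equiv.Perm (Fin N), ((Equiv.Perm.sign σ : ℤ) : ℂ) * F (v ∘ σ)

lemma altSum_comp_perm {E : Type*} {N : ℕ} (F : (Fin N → E) → ℂ) (v : Fin N → E)
    (π : Equiv.Perm (Fin N)) :
    altSum N (fun u => F (u ∘ π)) v = ((Equiv.Perm.sign π : ℤ) : ℂ) * altSum N F v := by
  rw [altSum, altSum, Finset.mul_sum]
  refine Fintype.sum_equiv (Equiv.mulRight π) _ _ fun σ => ?_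
  rw [Equiv.coe_mulRight, Equiv.Perm.sign_mul, ← mul_assoc]
  congr 1
  have : ((Equiv.Perm.sign π : ℤ) : ℂ) * ((Equiv.Perm.sign π : ℤ) : ℂ) = 1 := by
    rw [← Int.cast_mul, Int.units_coe_mul_self, Int.cast_one]
  push_cast
  linear_combination (-((Equiv.Perm.sign σ : ℤ) : ℂ)) * this

/-- Laplace expansion of an alternating sum along the first slot. -/
lemma altSum_cons {E : Type*} {N : ℕ} (f : E → ℂ) (m : (Fin N → E) → ℂ) (v : Fin (N + 1) → E) :
    altSum (N + 1) (fun u => f (u 0) * m fun j => u j.succ) v =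
      ∑ i : Fin (N + 1), (-1) ^ (i : ℕ) * (f (v i) * altSum N m fun j => v (i.succAbove j)) := by
  let g : Fin (N + 1) × Equiv.Perm (Fin N) → Equiv.Perm (Fin (N + 1)) := fun p =>
    (Fin.cycleRange p.1).symm * Equiv.Perm.decomposeFin.symm (0, p.2)
  have g0 : ∀ p, g p 0 = p.1 := fun p => by
    simp [g, Equiv.Perm.mul_apply]
  have gs : ∀ p j, g p j.succ = p.1.succAbove (p.2 j) := fun p j => by
    simp [g, Equiv.Perm.mul_apply]
  have hg : Function.Bijective g := by
    rw [Fintype.bijective_iff_injective_and_card]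
    constructor
    · intro p q h
      have h0 : p.1 = q.1 := by rw [← g0 p, ← g0 q, h]
      refine Prod.ext h0 (Equiv.ext fun j => ?_)
      have := gs p j
      rw [h, gs q j, h0] at this
      exact (Fin.succAbove_right_injective this).symm
    · simp [Fintype.card_prod, Fintype.card_perm, Nat.factorial_succ]
  have hsign : ∀ p, ((Equiv.Perm.sign (g p) : ℤ) : ℂ)
      = (-1) ^ (p.1 : ℕ) * ((Equiv.Perm.sign p.2 : ℤ) : ℂ) := fun p => by
    simp [g, Fin.sign_cycleRange]
  rw [altSum, ← hg.sum_comp, Fintype.sum_prod_type]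
  refine Finset.sum_congr rfl fun i _ => ?_
  rw [altSum, Finset.mul_sum, Finset.mul_sum]
  refine Finset.sum_congr rfl fun τ _ => ?_
  rw [hsign]
  simp only [Function.comp_def, g0, gs]
  ring

lemma wedge_apply (α : Alt n k) (β : Alt n l) (v : Fin (k + l) → Cn n) :
    wedge α β v = ((k.factorial : ℂ) * l.factorial)⁻¹ * altSum (k + l)
      (fun u => α (fun i => u (Fin.castAdd l i)) * β (fun j => u (Fin.natAdd k j))) v := by
  rw [wedge, ContinuousAlternatingMap.smul_apply,
    ContinuousMultilinearMap.alternatization_apply_apply, Complex.real_smul]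
  push_cast
  congr 1
  refine Finset.sum_congr rfl fun σ _ => ?_
  rw [Units.smul_def, zsmul_eq_mul]
  rfl

/-- The wedge product is compatible with left multiplication by one-forms,
`(φ ∧ α) ∧ β = φ ∧ (α ∧ β)`. -/
lemma wedge_extMul_apply (φ : CoVec n) (α : Alt n k) (β : Alt n l) (h : k + 1 + l = k + l + 1)
    (v : Fin (k + l + 1) → Cn n) :
    wedge (extMul φ α) β (fun i => v (Fin.cast h i)) = extMul φ (wedge α β) v := by
  rw [wedge_apply, extMul_apply]
  let F : (Fin (k + l + 1) → Cn n) → ℂ := fun u =>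
    φ (u 0) * (α (fun i => u (Fin.castAdd l i).succ) * β (fun j => u (Fin.natAdd k j).succ))
  let I : Fin (k + 1) → Fin (k + l + 1) := fun i => Fin.cast h (Fin.castAdd l i)
  have hI1 : ∀ (i : Fin (k + 1)) (j : Fin k),
      Fin.cast h (Fin.castAdd l (i.succAbove j)) = (I i).succAbove (Fin.castAdd l j) := by
    intro i j
    ext
    simp only [I, Fin.succAbove, Fin.lt_def, Fin.val_cast, Fin.val_castAdd, Fin.val_castSucc]
    split_ifs <;> simp
  have hI2 : ∀ (i : Fin (k + 1)) (j : Fin l),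
      Fin.cast h (Fin.natAdd (k + 1) j) = (I i).succAbove (Fin.natAdd k j) := by
    intro i j
    ext
    have := i.2
    simp only [I, Fin.succAbove, Fin.lt_def, Fin.val_cast, Fin.val_castAdd, Fin.val_castSucc,
      Fin.val_natAdd]
    split_ifs
    · omega
    · simp; omega
  have h1 : altSum (k + 1 + l) (fun u => extMul φ α (fun i => u (Fin.castAdd l i)) *
      β (fun j => u (Fin.natAdd (k + 1) j))) (fun i => v (Fin.cast h i))
      = (k + 1 : ℂ) * altSum (k + l + 1) F v := by
    have e1 : altSum (k + 1 + l) (fun u => extMul φ α (fun i => u (Fin.castAdd l i)) *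
        β (fun j => u (Fin.natAdd (k + 1) j))) (fun i => v (Fin.cast h i))
        = altSum (k + l + 1) (fun u => ∑ i : Fin (k + 1), (-1) ^ (i : ℕ) *
            F (u ∘ (Fin.cycleRange (I i)).symm)) v := by
      rw [altSum, altSum]
      refine Fintype.sum_equiv (finCongr h).permCongr _ _ fun σ => ?_
      rw [Equiv.Perm.sign_permCongr]
      congr 1
      rw [extMul_apply, Finset.sum_mul]
      refine Finset.sum_congr rfl fun i _ => ?_
      have hσ : ∀ j, v (Fin.cast h (σ j)) = v ((finCongr h).permCongr σ (Fin.cast h j)) := by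
        intro j
        simp [Equiv.permCongr_apply]
      simp only [F, Function.comp_apply, Fin.cycleRange_symm_zero, Fin.cycleRange_symm_succ, hσ,
        hI1, hI2 i]
      ring
    rw [e1]
    have e2 : altSum (k + l + 1) (fun u => ∑ i : Fin (k + 1), (-1) ^ (i : ℕ) *
            F (u ∘ (Fin.cycleRange (I i)).symm)) v
        = ∑ i : Fin (k + 1), (-1) ^ (i : ℕ) *
            altSum (k + l + 1) (fun u => F (u ∘ (Fin.cycleRange (I i)).symm)) v := by
      simp only [altSum, Finset.mul_sum]
      rw [Finset.sum_comm]
      refine Finset.sum_congr rfl fun i _ => Finset.sum_congr rfl fun σ _ => by ring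
    rw [e2, Finset.sum_congr rfl fun i _ => by
      rw [altSum_comp_perm, Equiv.Perm.sign_symm, Fin.sign_cycleRange]]
    have e3 : ∀ i : Fin (k + 1), (-1 : ℂ) ^ (i : ℕ) * ((((-1 : ℤˣ) ^ ((I i : Fin _) : ℕ) : ℤˣ) : ℤ) *
        altSum (k + l + 1) F v) = altSum (k + l + 1) F v := by
      intro i
      push_cast
      have : ((I i : Fin _) : ℕ) = i := rfl
      rw [this, ← mul_assoc, ← pow_add, Even.neg_one_pow ⟨_, rfl⟩, one_mul]
    rw [Finset.sum_congr rfl fun i _ => e3 i]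
    simp
  rw [h1, altSum_cons φ (fun u => α (fun i => u (Fin.castAdd l i)) * β (fun j => u (Fin.natAdd k j)))]
  simp only [wedge_apply, Nat.factorial_succ, Finset.mul_sum]
  refine Finset.sum_congr rfl fun i _ => ?_
  have hk : (k + 1 : ℂ) ≠ 0 := by exact_mod_cast Nat.succ_ne_zero k
  have hk' : (k.factorial : ℂ) ≠ 0 := by exact_mod_cast k.factorial_ne_zero
  have hl' : (l.factorial : ℂ) ≠ 0 := by exact_mod_cast l.factorial_ne_zero
  push_cast
  field_simp

lemma wedge_const_left (β : Alt n l) (h : 0 + l = l) (v : Fin l → Cn n) :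
    wedge (ContinuousAlternatingMap.constOfIsEmpty ℝ (Cn n) (Fin 0) (1 : ℂ)) β
      (fun i => v (Fin.cast h i)) = β v := by
  have hl' : (l.factorial : ℂ) ≠ 0 := by exact_mod_cast l.factorial_ne_zero
  rw [wedge_apply, altSum]
  have : ∀ σ : Equiv.Perm (Fin (0 + l)), ((Equiv.Perm.sign σ : ℤ) : ℂ) *
      ((ContinuousAlternatingMap.constOfIsEmpty ℝ (Cn n) (Fin 0) (1 : ℂ)) (fun i =>
        ((fun i => v (Fin.cast h i)) ∘ σ) (Fin.castAdd l i)) *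
      β (fun j => ((fun i => v (Fin.cast h i)) ∘ σ) (Fin.natAdd 0 j))) = β v := by
    intro σ
    have hs := β.toAlternatingMap.map_perm v ((finCongr h).permCongr σ)
    rw [Equiv.Perm.sign_permCongr] at hs
    have e : (fun j => ((fun i => v (Fin.cast h i)) ∘ σ) (Fin.natAdd 0 j))
        = v ∘ (finCongr h).permCongr σ := by
      funext j
      simp only [Function.comp_apply, Equiv.permCongr_apply]
      congr 3
      ext; simp
    have hs' : β (v ∘ (finCongr h).permCongr σ) = ((Equiv.Perm.sign σ : ℤ) : ℂ) * β v := by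
      rw [Units.smul_def, zsmul_eq_mul] at hs
      exact hs
    rw [e, hs', ContinuousAlternatingMap.constOfIsEmpty_apply, one_mul, ← mul_assoc,
      ← Int.cast_mul, Int.units_coe_mul_self, Int.cast_one, one_mul]
  rw [Finset.sum_congr rfl fun σ _ => this σ]
  simp [Fintype.card_perm]
  field_simp

end Wedge

/-! ### Powers of `(1,1)`-elements in a commutative algebra -/

section SquareZero

variable {ι A : Type*} [CommRing A]

lemma add_pow_succ_of_mul_self_eq_zero (a s : A) (ha : a * a = 0) (m : ℕ) :
    (a + s) ^ (m + 1) = s ^ (m + 1) + (m + 1) * a * s ^ m := by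
  induction m with
  | zero => simp; ring
  | succ m ih =>
    rw [pow_succ, ih]
    push_cast
    linear_combination ((m : A) + 1) * s ^ m * ha

lemma sum_pow_eq_zero_of_card_lt [DecidableEq ι] (u : ι → A) (hu : ∀ i, u i * u i = 0)
    (S : Finset ι) (m : ℕ) (hm : S.card < m) : (∑ i ∈ S, u i) ^ m = 0 := by
  induction S using Finset.induction_on generalizing m with
  | empty => simp at hm; simp [hm.ne']
  | insert a S ha ih =>
    rw [Finset.card_insert_of_notMem ha] at hm
    obtain ⟨m, rfl⟩ : ∃ p, m = p + 1 := ⟨m - 1, by omega⟩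
    rw [Finset.sum_insert ha, add_pow_succ_of_mul_self_eq_zero _ _ (hu a), ih (m + 1) (by omega),
      ih m (by omega)]
    simp

lemma sum_pow_card [DecidableEq ι] (u : ι → A) (hu : ∀ i, u i * u i = 0) (S : Finset ι) :
    (∑ i ∈ S, u i) ^ S.card = (S.card.factorial : A) * ∏ i ∈ S, u i := by
  induction S using Finset.induction_on with
  | empty => simp
  | insert a S ha ih =>
    rw [Finset.card_insert_of_notMem ha, Finset.sum_insert ha, Finset.prod_insert ha,
      add_pow_succ_of_mul_self_eq_zero _ _ (hu a), ih,
      sum_pow_eq_zero_of_card_lt u hu S _ (Nat.lt_succ_self _), Nat.factorial_succ]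
    push_cast
    ring

/-- If `z` annihilates the summands with index in `T`, these can be dropped from `z (∑ vᵢ)ᵐ`. -/
lemma mul_sum_pow_eq_of_annihilates {R : Type*} [Ring R] [Fintype ι] [DecidableEq ι] (v : ι → R)
    (hv : ∀ i j, v i * v j = v j * v i) (z : R) (T : Finset ι) (hz : ∀ i ∈ T, z * v i = 0) (m : ℕ) :
    z * (∑ i, v i) ^ m = z * (∑ i ∈ Tᶜ, v i) ^ m := by
  have hcomm : Commute (∑ i, v i) (∑ i ∈ Tᶜ, v i) :=
    Commute.sum_left _ _ _ fun i _ => Commute.sum_right _ _ _ fun j _ => hv i j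
  have hsplit : z * ∑ i, v i = z * ∑ i ∈ Tᶜ, v i := by
    rw [← Finset.sum_add_sum_compl T v, mul_add, Finset.mul_sum, Finset.sum_eq_zero hz, zero_add]
  induction m with
  | zero => simp
  | succ m ih =>
    rw [pow_succ', ← mul_assoc, hsplit, mul_assoc, ← (hcomm.pow_left m).eq, ← mul_assoc, ih,
      mul_assoc, ← pow_succ]

end SquareZero

section SwapFamily

variable {n : ℕ} {A : Type*} [CommRing A] [Algebra ℂ A]

/-- The relation `u_{jk} u_{lm} = -u_{jm} u_{lk}` satisfied by products `u_{jk} = x_j y_k` of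
anticommuting elements. -/
def SwapRel (u : Fin n → Fin n → A) : Prop :=
  ∀ j k l m, u j k * u l m = -(u j m * u l k)

variable {u : Fin n → Fin n → A}

lemma eq_zero_of_eq_neg_self {a : A} (h : a = -a) : a = 0 := by
  have h2 : (2 : ℂ) • a = 0 := by rw [two_smul]; exact eq_neg_iff_add_eq_zero.1 h
  have h3 := congrArg (fun b => (2⁻¹ : ℂ) • b) h2
  simpa [smul_smul] using h3

lemma SwapRel.mul_same_right (hu : SwapRel u) (j k l : Fin n) : u j k * u l k = 0 :=
  eq_zero_of_eq_neg_self (hu j k l k)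

lemma SwapRel.mul_same_left (hu : SwapRel u) (j k m : Fin n) : u j k * u j m = 0 :=
  eq_zero_of_eq_neg_self (by conv_lhs => rw [hu, mul_comm])

lemma SwapRel.mul_self (hu : SwapRel u) (i : Fin n) : u i i * u i i = 0 :=
  hu.mul_same_right i i i

lemma mul_prod_eq_zero {ι A : Type*} [DecidableEq ι] [CommRing A] {S : Finset ι} {i : ι}
    (hi : i ∈ S) {z : A} (f : ι → A) (h : z * f i = 0) : z * ∏ a ∈ S, f a = 0 := by
  rw [← Finset.mul_prod_erase S f hi, ← mul_assoc, h, zero_mul]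

/-- Diagonal case of the powers of a `(1,1)`-element: in `u_{jp} (∑ᵢ uᵢᵢ)ⁿ⁻¹` only products that
use every row and every column once survive. -/
lemma SwapRel.mul_sum_pow_pred (hu : SwapRel u) (j p : Fin n) :
    u j p * (∑ i, u i i) ^ (n - 1)
      = if j = p then ((n - 1).factorial : A) * ∏ i, u i i else 0 := by
  rw [mul_sum_pow_eq_of_annihilates (fun i => u i i) (fun i j => mul_comm _ _) _ {j} (by
    simp only [Finset.mem_singleton]; rintro i rfl; exact hu.mul_same_left _ _ _)]
  have hc : ({j}ᶜ : Finset (Fin n)).card = n - 1 := by simp [Finset.card_compl]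
  rw [← hc, sum_pow_card _ hu.mul_self]
  split_ifs with h
  · subst h
    rw [← Finset.mul_prod_erase Finset.univ (fun i => u i i) (Finset.mem_univ j),
      ← Finset.compl_singleton]
    ring
  · rw [mul_left_comm, mul_prod_eq_zero (i := p) (by simp [Ne.symm h]) (fun i => u i i) (hu.mul_same_right _ _ _),
      mul_zero]

/-- Diagonal case for two factors: the remaining rows and columns are the complements of `{l, j}`
and `{p, q}`, so `{l, j} = {p, q}`, and the two orders differ by a sign. -/
lemma SwapRel.mul_mul_sum_pow (hu : SwapRel u) (l p j q : Fin n) :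
    u l p * u j q * (∑ i, u i i) ^ (n - 2)
      = ((n - 2).factorial : A) *
        ((if l = p then 1 else 0) * (if j = q then 1 else 0)
          - (if l = q then 1 else 0) * (if j = p then 1 else 0)) * ∏ i, u i i := by
  by_cases hlj : l = j
  · subst hlj
    rw [hu.mul_same_left]
    ring
  by_cases hpq : p = q
  · subst hpq
    rw [hu.mul_same_right]
    ring
  have hl : u l p * u j q * u l l = 0 := by
    rw [mul_right_comm, hu.mul_same_left, zero_mul]
  have hj : u l p * u j q * u j j = 0 := by
    rw [mul_assoc, hu.mul_same_left, mul_zero]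
  have hp : u l p * u j q * u p p = 0 := by
    rw [mul_right_comm, hu.mul_same_right, zero_mul]
  have hq : u l p * u j q * u q q = 0 := by
    rw [mul_assoc, hu.mul_same_right, mul_zero]
  rw [mul_sum_pow_eq_of_annihilates (fun i => u i i) (fun i j => mul_comm _ _) _ {l, j} (by
    simp only [Finset.mem_insert, Finset.mem_singleton]
    rintro i (rfl | rfl) <;> assumption)]
  have hc : ({l, j}ᶜ : Finset (Fin n)).card = n - 2 := by
    rw [Finset.card_compl, Finset.card_pair hlj, Fintype.card_fin]
  have hprod : ∏ i, u i i = u l l * u j j * ∏ i ∈ ({l, j}ᶜ : Finset (Fin n)), u i i := by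
    rw [← Finset.prod_mul_prod_compl {l, j}, Finset.prod_pair hlj]
  rw [← hc, sum_pow_card _ hu.mul_self, mul_left_comm, hprod]
  by_cases hpm : p ∈ ({l, j}ᶜ : Finset (Fin n))
  · rw [mul_prod_eq_zero hpm (fun i => u i i) hp]
    simp only [Finset.mem_compl, Finset.mem_insert, Finset.mem_singleton, not_or] at hpm
    simp [Ne.symm hpm.1, Ne.symm hpm.2]
  by_cases hqm : q ∈ ({l, j}ᶜ : Finset (Fin n))
  · rw [mul_prod_eq_zero hqm (fun i => u i i) hq]
    simp only [Finset.mem_compl, Finset.mem_insert, Finset.mem_singleton, not_or] at hqm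
    simp [Ne.symm hqm.1, Ne.symm hqm.2]
  simp only [Finset.mem_compl, Finset.mem_insert, Finset.mem_singleton, not_not] at hpm hqm
  rcases hpm with rfl | rfl
  · rcases hqm with rfl | rfl
    · exact absurd rfl hpq
    · simp only [if_true, if_neg hpq]
      ring
  · rcases hqm with rfl | rfl
    · rw [hu]
      simp only [if_true, if_neg hlj, if_neg hpq]
      ring
    · exact absurd rfl hpq

/-- The family obtained from `u_{jq}` by the change of frame `θ_p = ∑_q a_{pq} y_q`. -/
def changeFrame (a : Matrix (Fin n) (Fin n) ℂ) (u : Fin n → Fin n → A) (j p : Fin n) : A :=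
  ∑ q, a p q • u j q

lemma SwapRel.changeFrame (hu : SwapRel u) (a : Matrix (Fin n) (Fin n) ℂ) :
    SwapRel (changeFrame a u) := by
  intro j k l m
  simp only [TypeIIB.changeFrame, Finset.sum_mul_sum]
  rw [Finset.sum_comm, ← Finset.sum_neg_distrib]
  refine Finset.sum_congr rfl fun q _ => ?_
  rw [← Finset.sum_neg_distrib]
  refine Finset.sum_congr rfl fun r _ => ?_
  rw [smul_mul_smul_comm, smul_mul_smul_comm, hu, smul_neg, mul_comm (a k r)]

/-- A change of frame multiplies the top product by the determinant, since the product is an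
alternating function of the rows of `a`. -/
lemma SwapRel.prod_changeFrame (hu : SwapRel u) (a : Matrix (Fin n) (Fin n) ℂ) :
    ∏ p, TypeIIB.changeFrame a u p p = a.det • ∏ p, u p p := by
  let f : (Fin n → ℂ) [⋀^Fin n]→ₗ[ℂ] A :=
    { (MultilinearMap.mkPiAlgebra ℂ (Fin n) A).compLinearMap
        (fun p => Fintype.linearCombination ℂ (u p)) with
      map_eq_zero_of_eq' := by
        intro a i j hij hne
        have h0 : (∑ q, a i q • u i q) * (∑ q, a j q • u j q) = 0 := by
          refine eq_zero_of_eq_neg_self ?_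
          rw [← hij]
          conv_lhs => rw [Finset.sum_mul_sum, Finset.sum_comm]
          rw [Finset.sum_mul_sum, ← Finset.sum_neg_distrib]
          refine Finset.sum_congr rfl fun q _ => ?_
          rw [← Finset.sum_neg_distrib]
          refine Finset.sum_congr rfl fun r _ => ?_
          rw [smul_mul_smul_comm, smul_mul_smul_comm, hu, smul_neg, mul_comm (a i q)]
        change ∏ p, Fintype.linearCombination ℂ (u p) (a p) = 0
        simp only [Fintype.linearCombination_apply]
        rw [← Finset.mul_prod_erase _ _ (Finset.mem_univ i)]
        exact mul_prod_eq_zero (i := j) (by simp [hne.symm]) _ h0 }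
  have hf : ∀ a : Fin n → Fin n → ℂ, f a = ∏ p, ∑ q, a p q • u p q := fun a => by
    change ∏ p, Fintype.linearCombination ℂ (u p) (a p) = _
    simp only [Fintype.linearCombination_apply]
  let g : (Fin n → ℂ) [⋀^Fin n]→ₗ[ℂ] A :=
    (LinearMap.toSpanSingleton ℂ A (∏ p, u p p)).compAlternatingMap Matrix.detRowAlternating
  have hfg : f = g := by
    refine Module.Basis.ext_alternating (Pi.basisFun ℂ (Fin n)) fun v hv => ?_
    obtain ⟨σ, rfl⟩ : ∃ σ : Equiv.Perm (Fin n), v = σ :=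
      ⟨Equiv.ofBijective v (Finite.injective_iff_bijective.1 hv), rfl⟩
    have h := f.map_perm (Pi.basisFun ℂ (Fin n)) σ
    have h' := g.map_perm (Pi.basisFun ℂ (Fin n)) σ
    have hone : f (Pi.basisFun ℂ (Fin n)) = g (Pi.basisFun ℂ (Fin n)) := by
      have hdet : Matrix.detRowAlternating (Pi.basisFun ℂ (Fin n)) = (1 : ℂ) := by
        rw [← Pi.basisFun_det, Module.Basis.det_self]
      simp [hf, g, hdet, Pi.single_apply, ite_smul]
    change f (⇑(Pi.basisFun ℂ (Fin n)) ∘ σ) = g (⇑(Pi.basisFun ℂ (Fin n)) ∘ σ)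
    rw [h, h', hone]
  calc ∏ p, TypeIIB.changeFrame a u p p = f (fun p => a p) := (hf _).symm
    _ = g (fun p => a p) := by rw [hfg]
    _ = a.det • ∏ p, u p p := rfl

lemma eq_sum_changeFrame (a b : Matrix (Fin n) (Fin n) ℂ) (hab : b * a = 1) (j k : Fin n) :
    u j k = ∑ p, b k p • changeFrame a u j p := by
  simp only [changeFrame, Finset.smul_sum, smul_smul]
  rw [Finset.sum_comm]
  have : ∀ q, ∑ p, (b k p * a p q) • u j q = (1 : Matrix (Fin n) (Fin n) ℂ) k q • u j q := by
    intro q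
    rw [← hab, Matrix.mul_apply, Finset.sum_smul]
  rw [Finset.sum_congr rfl fun q _ => this q]
  simp [Matrix.one_apply]

/-- The `(1,1)`-element `∑ a_{pq} u_{pq}`. -/
def oneOne (a : Matrix (Fin n) (Fin n) ℂ) (u : Fin n → Fin n → A) : A :=
  ∑ p, changeFrame a u p p

/-- `u_{jk} σ^{n-1} = (n-1)! (a⁻¹)_{kj} det a ∏ u_{pp}` for `σ = ∑ a_{pq} u_{pq}`. -/
lemma SwapRel.mul_oneOne_pow (hu : SwapRel u) {a b : Matrix (Fin n) (Fin n) ℂ} (hab : b * a = 1)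
    (j k : Fin n) : u j k * oneOne a u ^ (n - 1)
      = (((n - 1).factorial : ℂ) * b k j * a.det) • ∏ p, u p p := by
  conv_lhs => rw [eq_sum_changeFrame (u := u) a b hab j k]
  rw [Finset.sum_mul, oneOne]
  simp only [smul_mul_assoc, (hu.changeFrame a).mul_sum_pow_pred, smul_ite, smul_zero]
  rw [Finset.sum_ite_eq, if_pos (Finset.mem_univ _), hu.prod_changeFrame]
  simp only [Algebra.smul_def, map_mul, map_natCast]
  ring

/-- `u_{lm} u_{jk} σ^{n-2} = (n-2)! (b_{ml} b_{kj} - b_{mj} b_{kl}) det a ∏ u_{pp}` for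
`σ = ∑ a_{pq} u_{pq}` and `b = a⁻¹`. -/
lemma SwapRel.mul_mul_oneOne_pow (hu : SwapRel u) {a b : Matrix (Fin n) (Fin n) ℂ}
    (hab : b * a = 1) (l m j k : Fin n) : u l m * u j k * oneOne a u ^ (n - 2)
      = (((n - 2).factorial : ℂ) * (b m l * b k j - b m j * b k l) * a.det) • ∏ p, u p p := by
  conv_lhs => rw [eq_sum_changeFrame (u := u) a b hab j k, eq_sum_changeFrame (u := u) a b hab l m]
  rw [Finset.sum_mul_sum, Finset.sum_mul, oneOne]
  have h : ∀ p, (∑ q, b m p • TypeIIB.changeFrame a u l p * b k q • TypeIIB.changeFrame a u j q) *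
      (∑ p, TypeIIB.changeFrame a u p p) ^ (n - 2)
      = ∑ q, ((((n - 2).factorial : ℂ) * a.det * (b m p * b k q)) *
        ((if l = p then 1 else 0) * (if j = q then 1 else 0)
          - (if l = q then 1 else 0) * (if j = p then 1 else 0))) • ∏ p, u p p := by
    intro p
    rw [Finset.sum_mul]
    refine Finset.sum_congr rfl fun q _ => ?_
    rw [smul_mul_smul_comm, smul_mul_assoc, (hu.changeFrame a).mul_mul_sum_pow, hu.prod_changeFrame]
    simp only [Algebra.smul_def, map_mul, map_sub, map_natCast, apply_ite (algebraMap ℂ A), map_one,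
      map_zero]
    ring
  rw [Finset.sum_congr rfl fun p _ => h p]
  simp only [← Finset.sum_smul]
  congr 1
  simp only [mul_sub, Finset.sum_sub_distrib]
  simp [Finset.sum_ite_eq]
  ring

end SwapFamily

/-! ### Powers of `(1,1)`-forms -/

section Operators

variable {n k l : ℕ}

/-- Forms of all degrees at a point. -/
def FormSpace (n : ℕ) : Type := ∀ k, Alt n k

instance : AddCommGroup (FormSpace n) := inferInstanceAs (AddCommGroup (∀ k, Alt n k))

instance : Module ℂ (FormSpace n) := inferInstanceAs (Module ℂ (∀ k, Alt n k))

/-- A form of degree `k`, as an element of the space of forms of all degrees. -/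
def incl (n k : ℕ) : Alt n k →ₗ[ℂ] FormSpace n := LinearMap.single ℂ (Alt n) k

lemma incl_injective : Function.Injective (incl n k) := Pi.single_injective (M := Alt n) k

/-- Left exterior multiplication by a one-form, on forms of all degrees. -/
def extOp (φ : CoVec n) : Module.End ℂ (FormSpace n) where
  toFun b
    | 0 => 0
    | k + 1 => extMul φ (b k)
  map_add' a b := by
    funext k
    cases k with
    | zero => exact (add_zero (M := Alt n 0) 0).symm
    | succ k => exact map_add _ _ _
  map_smul' c b := by
    funext k
    cases k with
    | zero => exact (alt_smul_zero c).symm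
    | succ k => exact map_smul (extMul φ) c (b k)

lemma extOp_incl (φ : CoVec n) (β : Alt n k) :
    extOp φ (incl n k β) = incl n (k + 1) (extMul φ β) := by
  funext m
  cases m with
  | zero =>
    change (0 : Alt n 0) = Pi.single (k + 1) (extMul φ β) 0
    rw [Pi.single_eq_of_ne (by omega)]
  | succ m =>
    change extMul φ (Pi.single k β m) = Pi.single (k + 1) (extMul φ β) (m + 1)
    by_cases h : m = k
    · subst h
      rw [Pi.single_eq_same, Pi.single_eq_same]
    · rw [Pi.single_eq_of_ne h, Pi.single_eq_of_ne (by omega), map_zero]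

lemma extOp_anticomm (φ ψ : CoVec n) : extOp φ * extOp ψ = -(extOp ψ * extOp φ) := by
  refine LinearMap.ext fun b => funext fun k => ?_
  match k with
  | 0 => exact (neg_zero (G := Alt n 0)).symm
  | 1 =>
    change extMul φ (0 : Alt n 0) = -(extMul ψ (0 : Alt n 0))
    rw [map_zero, map_zero]
    exact (neg_zero (G := Alt n 1)).symm
  | k + 2 => exact extMul_anticomm φ ψ (b k)

lemma extOp_mul_self (φ : CoVec n) : extOp φ * extOp φ = 0 := by
  refine LinearMap.ext fun b => funext fun k => ?_
  match k with
  | 0 => rfl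
  | 1 => exact map_zero (extMul φ)
  | k + 2 => exact extMul_self φ (b k)

/-- Even products of one-forms are central among exterior multiplications. -/
lemma extOp_mul_extOp_comm (φ ψ χ : CoVec n) :
    extOp χ * (extOp φ * extOp ψ) = extOp φ * extOp ψ * extOp χ := by
  rw [← mul_assoc, extOp_anticomm χ φ, neg_mul, mul_assoc, extOp_anticomm χ ψ, mul_neg, neg_neg,
    mul_assoc]

lemma incl_eq_incl {m : ℕ} (h : k = m) {α : Alt n k} {β : Alt n m}
    (hαβ : ∀ v : Fin m → Cn n, α (fun i => v (Fin.cast h i)) = β v) : incl n k α = incl n m β := by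
  subst h
  congr 1
  ext v
  exact hαβ v

lemma eq_of_incl_eq_incl {m : ℕ} (h : k = m) {α : Alt n k} {β : Alt n m}
    (hαβ : incl n k α = incl n m β) (v : Fin m → Cn n) : α (fun i => v (Fin.cast h i)) = β v := by
  subst h
  rw [incl_injective hαβ]
  rfl

/-- The zero-form `1`. -/
def unitForm (n : ℕ) : FormSpace n :=
  incl n 0 (ContinuousAlternatingMap.constOfIsEmpty ℝ (Cn n) (Fin 0) (1 : ℂ))

/-- The product of the exterior multiplications by `φ₀, …, φ_{k-1}`. -/
def wordOp (φ : Fin k → CoVec n) : Module.End ℂ (FormSpace n) :=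
  (List.ofFn fun i => extOp (φ i)).prod

lemma wordOp_succ (φ : Fin (k + 1) → CoVec n) :
    wordOp φ = extOp (φ 0) * wordOp fun i => φ i.succ := by
  simp [wordOp, List.ofFn_succ]

lemma incl_extWord (φ : Fin k → CoVec n) : incl n k (extWord k φ) = wordOp φ (unitForm n) := by
  induction k with
  | zero => simp [wordOp, extWord, unitForm]
  | succ k ih => rw [extWord, ← extOp_incl, ih, wordOp_succ]; rfl

lemma incl_wedge_extWord (φ : Fin k → CoVec n) (β : Alt n l) :
    incl n (k + l) (wedge (extWord k φ) β) = wordOp φ (incl n l β) := by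
  induction k with
  | zero =>
    simp only [wordOp, List.ofFn_zero, List.prod_nil]
    exact incl_eq_incl (Nat.zero_add l) fun v => wedge_const_left β _ v
  | succ k ih =>
    rw [wordOp_succ, Module.End.mul_apply, ← ih, extOp_incl]
    exact incl_eq_incl (by omega) fun v => wedge_extMul_apply _ _ β _ v

lemma wedge_add_left (α α' : Alt n k) (β : Alt n l) :
    wedge (α + α') β = wedge α β + wedge α' β := by
  ext v
  simp [wedge_apply, altSum, add_mul, mul_add, Finset.sum_add_distrib]

lemma wedge_smul_left (c : ℂ) (α : Alt n k) (β : Alt n l) :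
    wedge (c • α) β = c • wedge α β := by
  ext v
  simp [wedge_apply, altSum, Finset.mul_sum]
  refine Finset.sum_congr rfl fun σ _ => by ring

lemma wedge_smul_right (c : ℂ) (α : Alt n k) (β : Alt n l) :
    wedge α (c • β) = c • wedge α β := by
  ext v
  simp [wedge_apply, altSum, Finset.mul_sum]
  refine Finset.sum_congr rfl fun σ _ => by ring

/-- The products `x_j y_k` of exterior multiplications by `dzʲ` and `dz̄ᵏ`. -/
def xyOp (n : ℕ) (j k : Fin n) : Module.End ℂ (FormSpace n) :=
  extOp (coframe (.inl j)) * extOp (coframe (.inr k))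

/-- Exterior multiplication by the form `∑ a_{pq} dzᵖ ∧ dz̄^q`. -/
def oneOneOp (a : Matrix (Fin n) (Fin n) ℂ) : Module.End ℂ (FormSpace n) :=
  ∑ p, ∑ q, a p q • xyOp n p q

/-- The form `∑ a_{pq} dzᵖ ∧ dz̄^q`. -/
def oneOneForm (a : Matrix (Fin n) (Fin n) ℂ) : Alt n 2 :=
  ∑ p, ∑ q, a p q • extWord 2 ![coframe (.inl p), coframe (.inr q)]

lemma xyOp_unitForm (j k : Fin n) :
    xyOp n j k (unitForm n) = incl n 2 (extWord 2 ![coframe (.inl j), coframe (.inr k)]) := by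
  rw [incl_extWord, wordOp_succ, wordOp_succ]
  simp [xyOp, wordOp]

lemma incl_oneOneForm (a : Matrix (Fin n) (Fin n) ℂ) :
    incl n 2 (oneOneForm a) = oneOneOp a (unitForm n) := by
  simp only [oneOneForm, oneOneOp, map_sum, map_smul, LinearMap.sum_apply, LinearMap.smul_apply,
    xyOp_unitForm]

lemma xyOp_comm_extOp (j k : Fin n) (χ : CoVec n) :
    extOp χ * xyOp n j k = xyOp n j k * extOp χ := extOp_mul_extOp_comm _ _ _

lemma oneOneOp_comm_extOp (a : Matrix (Fin n) (Fin n) ℂ) (χ : CoVec n) :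
    extOp χ * oneOneOp a = oneOneOp a * extOp χ := by
  simp only [oneOneOp, Finset.mul_sum, Finset.sum_mul, mul_smul_comm, smul_mul_assoc,
    xyOp_comm_extOp]

lemma oneOneOp_comm_wordOp (a : Matrix (Fin n) (Fin n) ℂ) (φ : Fin k → CoVec n) :
    wordOp φ * oneOneOp a = oneOneOp a * wordOp φ := by
  induction k with
  | zero => simp [wordOp]
  | succ k ih => rw [wordOp_succ, mul_assoc, ih, ← mul_assoc, oneOneOp_comm_extOp, mul_assoc]

lemma incl_wedge_oneOneForm (a : Matrix (Fin n) (Fin n) ℂ) (α : Alt n k) :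
    incl n (k + 2) (wedge α (oneOneForm a)) = oneOneOp a (incl n k α) := by
  have hα : α ∈ Submodule.span ℂ (Set.range fun e : Fin k → Fin n ⊕ Fin n =>
      extWord k fun i => coframe (e i)) := by rw [span_extWord_coframe]; trivial
  refine Submodule.span_induction ?_ ?_ ?_ ?_ hα
  · rintro _ ⟨e, rfl⟩
    rw [incl_wedge_extWord, incl_oneOneForm, incl_extWord, ← Module.End.mul_apply,
      oneOneOp_comm_wordOp]
    rfl
  · have : wedge (0 : Alt n k) (oneOneForm a) = 0 := by
      ext v; simp [wedge_apply, altSum, alt_zero_apply]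
    rw [this, map_zero, map_zero, map_zero]
  · intro x y _ _ hx hy
    rw [wedge_add_left, map_add, map_add, map_add, hx, hy]
  · intro c x _ hx
    rw [wedge_smul_left, map_smul, map_smul, map_smul, hx]

/-- `wᵏ` for `w = ∑ a_{pq} dzᵖ ∧ dz̄^q`, through the operator of multiplication by `w`. -/
lemma incl_wedgePow (a : Matrix (Fin n) (Fin n) ℂ) (k : ℕ) :
    incl n (2 * k) (wedgePow (oneOneForm a) k) = (oneOneOp a ^ k) (unitForm n) := by
  induction k with
  | zero => rfl
  | succ k ih =>
    have := incl_wedge_oneOneForm a (wedgePow (oneOneForm a) k)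
    rw [ih, ← Module.End.mul_apply, ← pow_succ'] at this
    exact this

/-- The commutative algebra generated by the operators `x_j y_k`. -/
abbrev xyAlg (n : ℕ) : Subalgebra ℂ (Module.End ℂ (FormSpace n)) :=
  Algebra.adjoin ℂ (Set.range fun p : Fin n × Fin n => xyOp n p.1 p.2)

lemma xyOp_comm_xyOp (j k l m : Fin n) : xyOp n j k * xyOp n l m = xyOp n l m * xyOp n j k := by
  conv_lhs => rw [xyOp]
  rw [mul_assoc, xyOp_comm_extOp, ← mul_assoc, xyOp_comm_extOp, mul_assoc]
  rfl

instance : IsMulCommutative (xyAlg n) :=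
  Algebra.isMulCommutative_adjoin ℂ (by
    rintro _ ⟨p, rfl⟩ _ ⟨q, rfl⟩
    exact xyOp_comm_xyOp _ _ _ _)

instance : CommRing (xyAlg n) :=
  { (inferInstance : Ring (xyAlg n)) with mul_comm := mul_comm' }

/-- The generators of the algebra `xyAlg`. -/
def xyGen (n : ℕ) (j k : Fin n) : xyAlg n := ⟨xyOp n j k, Algebra.subset_adjoin ⟨(j, k), rfl⟩⟩

lemma swapRel_xyGen : SwapRel (xyGen n) := by
  intro j k l m
  apply Subtype.ext
  change xyOp n j k * xyOp n l m = -(xyOp n j m * xyOp n l k)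
  have h : ∀ j k l m, xyOp n j k * xyOp n l m = -(extOp (coframe (.inl j)) *
      extOp (coframe (.inl l)) * (extOp (coframe (.inr k)) * extOp (coframe (.inr m)))) := by
    intro j k l m
    rw [xyOp, xyOp, mul_assoc, ← mul_assoc (extOp (coframe (.inr k))),
      extOp_anticomm (coframe (.inr k))]
    noncomm_ring
  rw [h, h, extOp_anticomm (coframe (.inr k))]
  noncomm_ring

end Operators

/-! ### Forms of top degree -/

section TopForms

variable {n k l : ℕ}

/-- The coefficients of the complex frame `∂/∂zʲ`, `∂/∂z̄ʲ` in the real basis. -/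
def frameCoeff : Matrix (Fin n ⊕ Fin n) (Fin (n + n)) ℂ := Matrix.of fun c => match c with
  | .inl j => Fin.append (Pi.single j 2⁻¹) (Pi.single j (-(2⁻¹ * Complex.I)))
  | .inr j => Fin.append (Pi.single j 2⁻¹) (Pi.single j (2⁻¹ * Complex.I))

/-- The values of the complex coframe on the real basis. -/
def coframeMatrix : Matrix (Fin (n + n)) (Fin n ⊕ Fin n) ℂ :=
  Matrix.of fun a c => coframe c (realBasis n a)

lemma frameCoeff_mul_coframeMatrix : frameCoeff (n := n) * coframeMatrix (n := n) = 1 := by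
  ext c d
  rw [Matrix.mul_apply, Fin.sum_univ_add]
  have hI := Complex.I_mul_I
  rcases c with j | j <;> rcases d with k | k <;>
    simp only [frameCoeff, coframeMatrix, Matrix.of_apply, realBasis, Fin.append_left,
      Fin.append_right, coframe_inl, coframe_inr, PiLp.single_apply, Pi.single_apply, ite_mul,
      zero_mul, Finset.sum_ite_eq', Finset.mem_univ, if_true, Matrix.one_apply, Sum.inl.injEq,
      Sum.inr.injEq, reduceCtorEq, if_false] <;>
    by_cases h : k = j <;> simp [h, eq_comm] <;>
    first
    | linear_combination (-2⁻¹ : ℂ) * hI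
    | linear_combination (2⁻¹ : ℂ) * hI
    | (intro h'; exact absurd h'.symm h)

lemma coframeMatrix_mul_frameCoeff : coframeMatrix (n := n) * frameCoeff (n := n) = 1 :=
  (Matrix.mul_eq_one_comm_of_card_eq _ _ _ (by simp)).1 frameCoeff_mul_coframeMatrix

lemma extWord_coframe_equiv_ne_zero (e : Fin (n + n) ≃ Fin n ⊕ Fin n) :
    extWord (n + n) (fun i => coframe (e i)) (realBasis n) ≠ 0 := by
  rw [extWord_apply]
  have h : (Matrix.of fun i j => coframe (e i) (realBasis n j))
      = (coframeMatrix.submatrix id e).transpose := rfl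
  rw [h, Matrix.det_transpose]
  intro h0
  have h1 := congrArg Matrix.det (show coframeMatrix.submatrix id e *
    (frameCoeff (n := n)).submatrix e id = 1 by
      rw [Matrix.submatrix_mul_equiv, coframeMatrix_mul_frameCoeff]
      simp)
  rw [Matrix.det_mul, h0, zero_mul, Matrix.det_one] at h1
  exact zero_ne_one h1

/-- The top-degree form `∏ dzᵖ ∧ dz̄ᵖ`. -/
def topForm (n : ℕ) : FormSpace n :=
  ((∏ p, xyGen n p p : xyAlg n) : Module.End ℂ (FormSpace n)) (unitForm n)

/-- Up to the order of its factors the top form is the product of all `dzʲ`, `dz̄ʲ`, whose value on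
the real basis is a nonzero determinant. -/
lemma topForm_ne_zero : topForm n ≠ 0 := by
  have hcast : n + n = n * 2 := by ring
  let e : Fin (n * 2) ≃ Fin n ⊕ Fin n :=
    (finProdFinEquiv.symm.trans (Equiv.prodComm _ _)).trans
      ((finTwoEquiv.prodCongr (Equiv.refl _)).trans (Equiv.boolProdEquivSum _))
  have hword : ((∏ p, xyGen n p p : xyAlg n) : Module.End ℂ (FormSpace n))
      = wordOp fun i => coframe (e i) := by
    rw [wordOp, ← List.prod_ofFn, ← Subalgebra.coe_val, map_list_prod, List.map_ofFn,
      List.ofFn_mul, List.prod_flatten, List.map_ofFn]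
    congr 2
    funext p
    simp only [Function.comp_apply, List.ofFn_succ, List.ofFn_zero, List.prod_cons, List.prod_nil,
      mul_one]
    have h0 : ∀ j : Fin 2, ∀ h, e ⟨(p : ℕ) * 2 + j, h⟩
        = if j = 0 then Sum.inl p else Sum.inr p := by
      intro j h
      have : (⟨(p : ℕ) * 2 + j, h⟩ : Fin (n * 2)) = finProdFinEquiv (p, j) := by
        ext; simp [finProdFinEquiv]; ring
      rw [this]
      have h01 : finTwoEquiv 0 = false ∧ finTwoEquiv 1 = true := by decide
      fin_cases j <;> simp [e, Equiv.boolProdEquivSum, h01.1, h01.2]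
    rw [h0, h0]
    rfl
  intro h
  rw [topForm, hword, ← incl_extWord] at h
  have h2 : extWord (n * 2) (fun i => coframe (e i)) = 0 :=
    incl_injective (h.trans (map_zero _).symm)
  refine extWord_coframe_equiv_ne_zero ((finCongr hcast).trans e) ?_
  have h3 := congrArg (fun α : Alt n (n * 2) => α fun i => realBasis n ((finCongr hcast).symm i)) h2
  simp only [extWord_apply, alt_zero_apply] at h3 ⊢
  rw [← h3, ← Matrix.det_reindex_self (finCongr hcast)]
  rfl

lemma coe_oneOne (a : Matrix (Fin n) (Fin n) ℂ) :
    ((oneOne a (xyGen n) : xyAlg n) : Module.End ℂ (FormSpace n)) = oneOneOp a := by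
  simp [oneOne, changeFrame, oneOneOp, xyGen]

/-- `dzʲ ∧ dz̄ᵏ ∧ w^{n-1}` for `w = ∑ a_{pq} dzᵖ ∧ dz̄^q`. -/
lemma xyOp_oneOneOp_pow {a b : Matrix (Fin n) (Fin n) ℂ} (hab : b * a = 1) (j k : Fin n) :
    xyOp n j k ((oneOneOp a ^ (n - 1)) (unitForm n))
      = (((n - 1).factorial : ℂ) * b k j * a.det) • topForm n := by
  have h := congrArg (fun s : xyAlg n => (s : Module.End ℂ (FormSpace n)) (unitForm n))
    (swapRel_xyGen.mul_oneOne_pow hab j k)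
  simp only [MulMemClass.coe_mul, SubmonoidClass.coe_pow, coe_oneOne] at h
  exact h

/-- `dzˡ ∧ dz̄ᵐ ∧ dzʲ ∧ dz̄ᵏ ∧ w^{n-2}` for `w = ∑ a_{pq} dzᵖ ∧ dz̄^q`. -/
lemma xyOp_xyOp_oneOneOp_pow {a b : Matrix (Fin n) (Fin n) ℂ} (hab : b * a = 1) (l m j k : Fin n) :
    xyOp n l m (xyOp n j k ((oneOneOp a ^ (n - 2)) (unitForm n)))
      = (((n - 2).factorial : ℂ) * (b m l * b k j - b m j * b k l) * a.det) • topForm n := by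
  have h := congrArg (fun s : xyAlg n => (s : Module.End ℂ (FormSpace n)) (unitForm n))
    (swapRel_xyGen.mul_mul_oneOne_pow hab l m j k)
  simp only [MulMemClass.coe_mul, SubmonoidClass.coe_pow, coe_oneOne] at h
  exact h

lemma extOp_inl_mul_xyOp (j q : Fin n) : extOp (coframe (.inl j)) * xyOp n j q = 0 := by
  rw [xyOp, ← mul_assoc, extOp_mul_self, zero_mul]

lemma extOp_inr_mul_xyOp (p k : Fin n) : extOp (coframe (.inr k)) * xyOp n p k = 0 := by
  rw [xyOp_comm_extOp, xyOp, mul_assoc, extOp_mul_self, mul_zero]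

/-- If `z` is annihilated by `dzʲ`, `j ∈ T`, then `z ∧ wᵐ = 0` for `m > n - |T|`. -/
lemma mul_oneOneOp_pow_eq_zero_of_left (a : Matrix (Fin n) (Fin n) ℂ)
    (z : Module.End ℂ (FormSpace n)) (T : Finset (Fin n)) (hz : ∀ j ∈ T, ∀ q, z * xyOp n j q = 0)
    (m : ℕ) (hm : n < m + T.card) : z * oneOneOp a ^ m = 0 := by
  let v : Fin n → xyAlg n := fun p => changeFrame a (xyGen n) p p
  have hv : ∀ p, v p * v p = 0 := fun p => (swapRel_xyGen.changeFrame a).mul_self p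
  have h := mul_sum_pow_eq_of_annihilates (fun p => (v p : Module.End ℂ (FormSpace n)))
    (fun i j => by
      change ((v i * v j : xyAlg n) : Module.End ℂ (FormSpace n)) = ((v j * v i : xyAlg n) : _)
      rw [mul_comm]) z T (fun i hi => by simp [v, changeFrame, xyGen, Finset.mul_sum, hz i hi]) m
  have h2 : (∑ i ∈ Tᶜ, v i) ^ m = 0 := by
    refine sum_pow_eq_zero_of_card_lt v hv _ _ ?_
    rw [Finset.card_compl, Fintype.card_fin]
    have := Finset.card_le_univ T
    rw [Fintype.card_fin] at this
    omega
  have h3 : (∑ i ∈ Tᶜ, (v i : Module.End ℂ (FormSpace n))) ^ m = 0 := by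
    have := congrArg (fun s : xyAlg n => (s : Module.End ℂ (FormSpace n))) h2
    simpa using this
  rw [h3, mul_zero] at h
  rw [← coe_oneOne, oneOne, ← h]
  simp [v]

/-- If `z` is annihilated by `dz̄ᵏ`, `k ∈ T`, then `z ∧ wᵐ = 0` for `m > n - |T|`. -/
lemma mul_oneOneOp_pow_eq_zero_of_right (a : Matrix (Fin n) (Fin n) ℂ)
    (z : Module.End ℂ (FormSpace n)) (T : Finset (Fin n)) (hz : ∀ k ∈ T, ∀ p, z * xyOp n p k = 0)
    (m : ℕ) (hm : n < m + T.card) : z * oneOneOp a ^ m = 0 := by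
  have hsw : SwapRel fun k j => xyGen n j k := by
    intro j k l m
    change xyGen n k j * xyGen n m l = -(xyGen n m j * xyGen n k l)
    rw [swapRel_xyGen, mul_comm]
  let v : Fin n → xyAlg n := fun p => changeFrame a.transpose (fun k j => xyGen n j k) p p
  have hv : ∀ p, v p * v p = 0 := fun p => (hsw.changeFrame a.transpose).mul_self p
  have h := mul_sum_pow_eq_of_annihilates (fun p => (v p : Module.End ℂ (FormSpace n)))
    (fun i j => by
      change ((v i * v j : xyAlg n) : Module.End ℂ (FormSpace n)) = ((v j * v i : xyAlg n) : _)
      rw [mul_comm]) z T (fun i hi => by simp [v, changeFrame, xyGen, Finset.mul_sum, hz i hi]) m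
  have h2 : (∑ i ∈ Tᶜ, v i) ^ m = 0 := by
    refine sum_pow_eq_zero_of_card_lt v hv _ _ ?_
    rw [Finset.card_compl, Fintype.card_fin]
    have := Finset.card_le_univ T
    rw [Fintype.card_fin] at this
    omega
  have h3 : (∑ i ∈ Tᶜ, (v i : Module.End ℂ (FormSpace n))) ^ m = 0 := by
    have := congrArg (fun s : xyAlg n => (s : Module.End ℂ (FormSpace n))) h2
    simpa using this
  rw [h3, mul_zero] at h
  rw [oneOneOp, Finset.sum_comm, ← h]
  simp [v, changeFrame, xyGen]

lemma inl_inl_oneOneOp_pow (a : Matrix (Fin n) (Fin n) ℂ) (j k : Fin n) :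
    extOp (coframe (.inl j)) (extOp (coframe (.inl k)) ((oneOneOp a ^ (n - 1)) (unitForm n))) = 0 := by
  have h : extOp (coframe (.inl j)) * extOp (coframe (.inl k)) * oneOneOp a ^ (n - 1) = 0 := by
    by_cases hjk : j = k
    · rw [hjk, extOp_mul_self, zero_mul]
    refine mul_oneOneOp_pow_eq_zero_of_left a _ {j, k} ?_ _ ?_
    · intro i hi q
      rw [Finset.mem_insert, Finset.mem_singleton] at hi
      rcases hi with rfl | rfl
      · rw [mul_assoc, xyOp_comm_extOp, ← mul_assoc, extOp_inl_mul_xyOp, zero_mul]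
      · rw [mul_assoc, extOp_inl_mul_xyOp, mul_zero]
    · rw [Finset.card_pair hjk]
      omega
  exact LinearMap.congr_fun h (unitForm n)

lemma inr_inr_oneOneOp_pow (a : Matrix (Fin n) (Fin n) ℂ) (j k : Fin n) :
    extOp (coframe (.inr j)) (extOp (coframe (.inr k)) ((oneOneOp a ^ (n - 1)) (unitForm n))) = 0 := by
  have h : extOp (coframe (.inr j)) * extOp (coframe (.inr k)) * oneOneOp a ^ (n - 1) = 0 := by
    by_cases hjk : j = k
    · rw [hjk, extOp_mul_self, zero_mul]
    refine mul_oneOneOp_pow_eq_zero_of_right a _ {j, k} ?_ _ ?_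
    · intro i hi q
      rw [Finset.mem_insert, Finset.mem_singleton] at hi
      rcases hi with rfl | rfl
      · rw [mul_assoc, xyOp_comm_extOp, ← mul_assoc, extOp_inr_mul_xyOp, zero_mul]
      · rw [mul_assoc, extOp_inr_mul_xyOp, mul_zero]
    · rw [Finset.card_pair hjk]
      omega
  exact LinearMap.congr_fun h (unitForm n)

/-- The form has type `(n + 1, n - 1)`, hence vanishes. -/
lemma inl_inl_xyOp_oneOneOp_pow (a : Matrix (Fin n) (Fin n) ℂ) (j k l m : Fin n) :
    extOp (coframe (.inl j)) (extOp (coframe (.inl k)) (xyOp n l m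
      ((oneOneOp a ^ (n - 2)) (unitForm n)))) = 0 := by
  have h : extOp (coframe (.inl j)) * extOp (coframe (.inl k)) * xyOp n l m *
      oneOneOp a ^ (n - 2) = 0 := by
    by_cases hjk : j = k
    · rw [hjk, extOp_mul_self, zero_mul, zero_mul]
    by_cases hkl : k = l
    · rw [hkl, mul_assoc (extOp _), extOp_inl_mul_xyOp, mul_zero, zero_mul]
    by_cases hjl : j = l
    · rw [hjl, mul_assoc (extOp _), xyOp_comm_extOp, ← mul_assoc, extOp_inl_mul_xyOp, zero_mul,
        zero_mul]
    refine mul_oneOneOp_pow_eq_zero_of_left a _ {j, k, l} ?_ _ ?_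
    · intro i hi q
      simp only [Finset.mem_insert, Finset.mem_singleton] at hi
      rcases hi with rfl | rfl | rfl
      · rw [mul_assoc, xyOp_comm_xyOp, mul_assoc, ← mul_assoc (extOp (coframe (.inl k))),
          xyOp_comm_extOp, ← mul_assoc, ← mul_assoc, extOp_inl_mul_xyOp, zero_mul, zero_mul]
      · rw [mul_assoc, xyOp_comm_xyOp, mul_assoc, ← mul_assoc (extOp (coframe (.inl i))),
          extOp_inl_mul_xyOp, zero_mul, mul_zero]
      · rw [mul_assoc, show xyOp n i m * xyOp n i q = 0 from
          congrArg Subtype.val (swapRel_xyGen.mul_same_left i m q), mul_zero]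
    · have : ({j, k, l} : Finset (Fin n)).card = 3 := by
        rw [Finset.card_eq_three]; exact ⟨j, k, l, hjk, hjl, hkl, rfl⟩
      omega
  exact LinearMap.congr_fun h (unitForm n)

lemma inr_inr_xyOp_oneOneOp_pow (a : Matrix (Fin n) (Fin n) ℂ) (j k l m : Fin n) :
    extOp (coframe (.inr j)) (extOp (coframe (.inr k)) (xyOp n l m
      ((oneOneOp a ^ (n - 2)) (unitForm n)))) = 0 := by
  have h : extOp (coframe (.inr j)) * extOp (coframe (.inr k)) * xyOp n l m *
      oneOneOp a ^ (n - 2) = 0 := by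
    by_cases hjk : j = k
    · rw [hjk, extOp_mul_self, zero_mul, zero_mul]
    by_cases hkl : k = m
    · rw [hkl, mul_assoc (extOp _), extOp_inr_mul_xyOp, mul_zero, zero_mul]
    by_cases hjl : j = m
    · rw [hjl, mul_assoc (extOp _), xyOp_comm_extOp, ← mul_assoc, extOp_inr_mul_xyOp, zero_mul,
        zero_mul]
    refine mul_oneOneOp_pow_eq_zero_of_right a _ {j, k, m} ?_ _ ?_
    · intro i hi q
      simp only [Finset.mem_insert, Finset.mem_singleton] at hi
      rcases hi with rfl | rfl | rfl
      · rw [mul_assoc, xyOp_comm_xyOp, mul_assoc, ← mul_assoc (extOp (coframe (.inr k))),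
          xyOp_comm_extOp, ← mul_assoc, ← mul_assoc, extOp_inr_mul_xyOp, zero_mul, zero_mul]
      · rw [mul_assoc, xyOp_comm_xyOp, mul_assoc, ← mul_assoc (extOp (coframe (.inr i))),
          extOp_inr_mul_xyOp, zero_mul, mul_zero]
      · rw [mul_assoc, show xyOp n l i * xyOp n q i = 0 from
          congrArg Subtype.val (swapRel_xyGen.mul_same_right l i q), mul_zero]
    · have : ({j, k, m} : Finset (Fin n)).card = 3 := by
        rw [Finset.card_eq_three]; exact ⟨j, k, m, hjk, hjl, hkl, rfl⟩
      omega
  exact LinearMap.congr_fun h (unitForm n)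

end TopForms

/-! ### The Hermitian product of forms in the complex coframe -/

section HermitianProduct

variable {n k : ℕ}

/-- The Hermitian product of one-forms defined by the inverse Gram matrix. -/
def covInner (w : Alt n 2) (φ ψ : CoVec n) : ℂ :=
  ∑ a, ∑ b, ((gram w)⁻¹ a b : ℂ) * φ (realBasis n a) * (starRingEnd ℂ) (ψ (realBasis n b))

lemma hermInner_add_left (w : Alt n 2) (α α' β : Alt n k) :
    hermInner w (α + α') β = hermInner w α β + hermInner w α' β := by
  simp [hermInner, mul_add, add_mul, Finset.sum_add_distrib]

lemma hermInner_smul_left (w : Alt n 2) (c : ℂ) (α β : Alt n k) :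
    hermInner w (c • α) β = c * hermInner w α β := by
  simp only [hermInner, ContinuousAlternatingMap.smul_apply, smul_eq_mul, Finset.mul_sum]
  exact Finset.sum_congr rfl fun a _ => Finset.sum_congr rfl fun b _ => by ring

lemma hermInner_add_right (w : Alt n 2) (α β β' : Alt n k) :
    hermInner w α (β + β') = hermInner w α β + hermInner w α β' := by
  simp [hermInner, mul_add, Finset.sum_add_distrib]

lemma hermInner_smul_right (w : Alt n 2) (c : ℂ) (α β : Alt n k) :
    hermInner w α (c • β) = (starRingEnd ℂ) c * hermInner w α β := by
  simp only [hermInner, ContinuousAlternatingMap.smul_apply, smul_eq_mul, Finset.mul_sum, map_mul]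
  exact Finset.sum_congr rfl fun a _ => Finset.sum_congr rfl fun b _ => by ring

@[simp] lemma hermInner_zero_left (w : Alt n 2) (β : Alt n k) : hermInner w 0 β = 0 := by
  simp [hermInner, alt_zero_apply]

@[simp] lemma hermInner_zero_right (w : Alt n 2) (α : Alt n k) : hermInner w α 0 = 0 := by
  simp [hermInner, alt_zero_apply]

lemma hermInner_sum_left {ι : Type*} (s : Finset ι) (w : Alt n 2) (α : ι → Alt n k) (β : Alt n k) :
    hermInner w (∑ i ∈ s, α i) β = ∑ i ∈ s, hermInner w (α i) β := by
  classical
  induction s using Finset.induction_on with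
  | empty => simp
  | insert i s hi ih => rw [Finset.sum_insert hi, hermInner_add_left, ih, Finset.sum_insert hi]

lemma hermInner_sum_right {ι : Type*} (s : Finset ι) (w : Alt n 2) (α : Alt n k) (β : ι → Alt n k) :
    hermInner w α (∑ i ∈ s, β i) = ∑ i ∈ s, hermInner w α (β i) := by
  classical
  induction s using Finset.induction_on with
  | empty => simp
  | insert i s hi ih => rw [Finset.sum_insert hi, hermInner_add_right, ih, Finset.sum_insert hi]

lemma hermInner_neg_right (w : Alt n 2) (α β : Alt n k) :
    hermInner w α (-β) = -hermInner w α β := by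
  have h := hermInner_smul_right w (-1) α β
  rw [map_neg, map_one] at h
  rw [show -β = (-1 : ℂ) • β by module, h]
  ring

lemma hermInner_sub_right (w : Alt n 2) (α β β' : Alt n k) :
    hermInner w α (β - β') = hermInner w α β - hermInner w α β' := by
  rw [sub_eq_add_neg, hermInner_add_right, hermInner_neg_right, sub_eq_add_neg]

/-- The Gram determinant identity behind `⟨φ₁ ∧ ⋯ ∧ φ_k, ψ₁ ∧ ⋯ ∧ ψ_k⟩ = det ⟨φᵢ, ψⱼ⟩`. -/
lemma sum_det_mul_prod_eq {ι : Type*} [Fintype ι] (x y : Fin k → ι → ℂ) (g : ι → ι → ℂ) :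
    ∑ a : Fin k → ι, ∑ b : Fin k → ι, (∏ i, g (a i) (b i)) *
      (Matrix.of fun i j => x i (a j)).det * (Matrix.of fun i j => y i (b j)).det
      = (k.factorial : ℂ) * (Matrix.of fun i j => ∑ a, ∑ b, g a b * x i a * y j b).det := by
  have h1 : ∀ σ τ : Equiv.Perm (Fin k), ∑ a : Fin k → ι, ∑ b : Fin k → ι,
      (∏ i, g (a i) (b i)) * (∏ i, x (σ i) (a i)) * (∏ i, y (τ i) (b i))
      = ∏ i, ∑ a, ∑ b, g a b * x (σ i) a * y (τ i) b := by
    intro σ τ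
    have h2 : ∀ i, ∑ a, ∑ b, g a b * x (σ i) a * y (τ i) b
        = ∑ p : ι × ι, g p.1 p.2 * x (σ i) p.1 * y (τ i) p.2 := fun i =>
      (Fintype.sum_prod_type (fun p : ι × ι => g p.1 p.2 * x (σ i) p.1 * y (τ i) p.2)).symm
    simp only [h2]
    rw [Finset.prod_univ_sum, Fintype.piFinset_univ, ← Fintype.sum_prod_type']
    refine Fintype.sum_equiv (Equiv.arrowProdEquivProdArrow (Fin k) (fun _ => ι) (fun _ => ι)).symm _ _ fun p => ?_
    simp [Finset.prod_mul_distrib, Equiv.arrowProdEquivProdArrow]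
  have h3 : ∀ τ : Equiv.Perm (Fin k), ∑ σ : Equiv.Perm (Fin k),
      ((Equiv.Perm.sign σ : ℤ) : ℂ) * ((Equiv.Perm.sign τ : ℤ) : ℂ) *
        ∏ i, ∑ a, ∑ b, g a b * x (σ i) a * y (τ i) b
      = (Matrix.of fun i j => ∑ a, ∑ b, g a b * x i a * y j b).det := by
    intro τ
    rw [Matrix.det_apply']
    refine Fintype.sum_equiv (Equiv.mulRight τ⁻¹) _ _ fun σ => ?_
    rw [Equiv.coe_mulRight, Equiv.Perm.sign_mul, Equiv.Perm.sign_inv]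
    push_cast
    congr 1
    refine Fintype.prod_equiv τ _ _ fun i => ?_
    simp
  calc _ = ∑ a : Fin k → ι, ∑ b : Fin k → ι, ∑ τ : Equiv.Perm (Fin k), ∑ σ : Equiv.Perm (Fin k),
        ((Equiv.Perm.sign σ : ℤ) : ℂ) * ((Equiv.Perm.sign τ : ℤ) : ℂ) *
        ((∏ i, g (a i) (b i)) * (∏ i, x (σ i) (a i)) * (∏ i, y (τ i) (b i))) := by
        refine Finset.sum_congr rfl fun a _ => Finset.sum_congr rfl fun b _ => ?_
        rw [Matrix.det_apply', Matrix.det_apply', Finset.mul_sum]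
        refine Finset.sum_congr rfl fun τ _ => ?_
        rw [Finset.mul_sum, Finset.sum_mul]
        refine Finset.sum_congr rfl fun σ _ => ?_
        simp only [Matrix.of_apply]
        ring
    _ = ∑ τ : Equiv.Perm (Fin k), ∑ σ : Equiv.Perm (Fin k),
        ((Equiv.Perm.sign σ : ℤ) : ℂ) * ((Equiv.Perm.sign τ : ℤ) : ℂ) *
        ∏ i, ∑ a, ∑ b, g a b * x (σ i) a * y (τ i) b := by
        simp only [← h1, Finset.mul_sum]
        rw [Finset.sum_congr rfl fun a _ => Finset.sum_comm, Finset.sum_comm]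
        refine Finset.sum_congr rfl fun τ _ => ?_
        rw [Finset.sum_congr rfl fun a _ => Finset.sum_comm, Finset.sum_comm]
    _ = _ := by
        rw [Finset.sum_congr rfl fun τ _ => h3 τ]
        simp [Fintype.card_perm]

/-- The Hermitian product of decomposable forms is the Gram determinant. -/
lemma hermInner_extWord (w : Alt n 2) (φ ψ : Fin k → CoVec n) :
    hermInner w (extWord k φ) (extWord k ψ) = (Matrix.of fun i j => covInner w (φ i) (ψ j)).det := by
  have h := sum_det_mul_prod_eq (fun i a => φ i (realBasis n a))
    (fun i a => (starRingEnd ℂ) (ψ i (realBasis n a))) (fun a b => ((gram w)⁻¹ a b : ℂ))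
  have hconj : ∀ b : Fin k → Fin (n + n), (starRingEnd ℂ) (Matrix.of fun i j =>
      ψ i (realBasis n (b j))).det
      = (Matrix.of fun i j => (starRingEnd ℂ) (ψ i (realBasis n (b j)))).det := fun b => by
    rw [RingHom.map_det]; rfl
  rw [hermInner]
  simp only [extWord_apply, hconj, Complex.ofReal_prod]
  rw [h, ← mul_assoc, inv_mul_cancel₀ (by exact_mod_cast k.factorial_ne_zero), one_mul]
  rfl

lemma mem_span_extWord (α : Alt n k) : α ∈ Submodule.span ℂ (Set.range fun e : Fin k →
    Fin n ⊕ Fin n => extWord k fun i => coframe (e i)) := by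
  rw [span_extWord_coframe]; trivial

lemma extWord_comp (φ : Fin k → CoVec n) (A : Cn n →L[ℝ] Cn n) :
    (extWord k φ).compContinuousLinearMap A = extWord k fun i => (φ i).comp A := by
  ext v
  simp [extWord_apply]

/-- The matrix of a real-linear map in the real basis. -/
def realMatrix (A : Cn n →L[ℝ] Cn n) : Matrix (Fin (n + n)) (Fin (n + n)) ℝ :=
  LinearMap.toMatrix (stdRealBasis n) (stdRealBasis n) A

lemma apply_realBasis (A : Cn n →L[ℝ] Cn n) (a : Fin (n + n)) :
    A (realBasis n a) = ∑ c, realMatrix A c a • realBasis n c := by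
  have h := LinearMap.toMatrix_apply (stdRealBasis n) (stdRealBasis n) (A : Cn n →ₗ[ℝ] Cn n)
  have h2 := (stdRealBasis n).sum_repr (A (realBasis n a))
  simp only [stdRealBasis_apply] at h h2
  rw [← h2]
  refine Finset.sum_congr rfl fun c _ => ?_
  rw [realMatrix, h]
  rfl

lemma alt_two_swap (w : Alt n 2) (u v : Cn n) : w ![u, v] = -w ![v, u] := by
  have h := w.toAlternatingMap.map_swap ![v, u] (i := 0) (j := 1) (by decide)
  have e : ![v, u] ∘ Equiv.swap (0 : Fin 2) 1 = ![u, v] := by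
    funext i; fin_cases i <;> simp
  rw [e] at h
  exact h

/-- A two-form as a bilinear map. -/
def bilin (w : Alt n 2) : Cn n →ₗ[ℝ] Cn n →ₗ[ℝ] ℂ :=
  LinearMap.mk₂ ℝ (fun u v => w ![u, v])
    (fun u u' v => ContinuousAlternatingMap.vecCons_add w ![v] u u')
    (fun c u v => ContinuousAlternatingMap.vecCons_smul w ![v] c u)
    (fun u v v' => by
      simp only [alt_two_swap w u]
      rw [show w ![v + v', u] = _ from ContinuousAlternatingMap.vecCons_add w ![u] v v', neg_add])
    (fun c u v => by
      simp only [alt_two_swap w u]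
      rw [show w ![c • v, u] = _ from ContinuousAlternatingMap.vecCons_smul w ![u] c v, smul_neg])

lemma bilin_apply (w : Alt n 2) (u v : Cn n) : bilin w u v = w ![u, v] := rfl

lemma gram_comp (w : Alt n 2) (A : Cn n →L[ℝ] Cn n) (hA : ∀ v, A (mulI n v) = mulI n (A v)) :
    gram (w.compContinuousLinearMap A) = (realMatrix A).transpose * gram w * realMatrix A := by
  ext a b
  have h : (w.compContinuousLinearMap A) ![realBasis n a, mulI n (realBasis n b)]
      = bilin w (A (realBasis n a)) (mulI n (A (realBasis n b))) := by
    rw [bilin_apply, ← hA]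
    change w _ = w _
    congr 1
    funext i
    fin_cases i <;> rfl
  have hg : ∀ c d, gram w c d = (bilin w (realBasis n c) (mulI n (realBasis n d))).re :=
    fun c d => rfl
  simp only [Matrix.mul_apply, Matrix.transpose_apply, hg, Finset.sum_mul]
  rw [gram, Matrix.of_apply, h, apply_realBasis A a, apply_realBasis A b]
  simp only [map_sum, map_smul, LinearMap.sum_apply, LinearMap.smul_apply, Complex.re_sum,
    Complex.smul_re, smul_eq_mul]
  refine Finset.sum_congr rfl fun c _ => ?_
  rw [Finset.mul_sum]
  exact Finset.sum_congr rfl fun d _ => by ring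

lemma realMatrix_mul_of_inverse {A B : Cn n →L[ℝ] Cn n} (h : ∀ v, A (B v) = v) :
    realMatrix A * realMatrix B = 1 := by
  rw [realMatrix, realMatrix, ← LinearMap.toMatrix_comp,
    ← LinearMap.toMatrix_id (stdRealBasis n)]
  congr 1
  ext1 v
  exact h v

/-- The product of covectors is invariant under complex linear changes of coordinates. -/
lemma covInner_comp (w : Alt n 2) {A B : Cn n →L[ℝ] Cn n} (hAB : ∀ v, A (B v) = v)
    (hA : ∀ v, A (mulI n v) = mulI n (A v)) (φ ψ : CoVec n) :
    covInner (w.compContinuousLinearMap A) (φ.comp A) (ψ.comp A) = covInner w φ ψ := by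
  have hP := realMatrix_mul_of_inverse hAB
  have hP' : realMatrix B * realMatrix A = 1 := mul_eq_one_comm.1 hP
  have hinv : (realMatrix A * (gram (w.compContinuousLinearMap A))⁻¹ * (realMatrix A).transpose)
      = (gram w)⁻¹ := by
    rw [gram_comp w A hA, Matrix.mul_inv_rev, Matrix.mul_inv_rev, ← Matrix.mul_assoc,
      ← Matrix.mul_assoc]
    have hPT : ((realMatrix A).transpose)⁻¹ * (realMatrix A).transpose = 1 := by
      refine Matrix.nonsing_inv_mul _ ?_
      rw [Matrix.det_transpose]
      exact Matrix.isUnit_det_of_right_inverse hP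
    rw [Matrix.mul_assoc _ _ (realMatrix A).transpose, hPT,
      Matrix.mul_nonsing_inv _ (Matrix.isUnit_det_of_right_inverse hP), Matrix.mul_one,
      Matrix.one_mul]
  have h1 : ∀ c d, (((gram w)⁻¹ c d : ℝ) : ℂ) = ∑ a, ∑ b, (realMatrix A c a : ℂ) *
      ((gram (w.compContinuousLinearMap A))⁻¹ a b : ℝ) * (realMatrix A d b : ℂ) := by
    intro c d
    rw [← hinv]
    simp only [Matrix.mul_apply, Matrix.transpose_apply, Finset.sum_mul]
    push_cast
    rw [Finset.sum_comm]
  simp only [covInner, ContinuousLinearMap.comp_apply, apply_realBasis, map_sum, map_smul, h1,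
    Finset.mul_sum, Finset.sum_mul, Complex.real_smul, map_mul, Complex.conj_ofReal]
  have e1 : ∀ F : Fin (n + n) → Fin (n + n) → Fin (n + n) → Fin (n + n) → ℂ,
      ∑ a, ∑ b, ∑ c, ∑ d, F a b c d = ∑ c, ∑ d, ∑ a, ∑ b, F a b c d := by
    intro F
    have : ∀ a, ∑ b, ∑ c, ∑ d, F a b c d = ∑ c, ∑ d, ∑ b, F a b c d := fun a => by
      rw [Finset.sum_comm]
      exact Finset.sum_congr rfl fun c _ => Finset.sum_comm
    rw [Finset.sum_congr rfl fun a _ => this a, Finset.sum_comm]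
    exact Finset.sum_congr rfl fun c _ => Finset.sum_comm
  rw [e1]
  rw [Finset.sum_comm]
  refine Finset.sum_congr rfl fun c _ => Finset.sum_congr rfl fun d _ =>
    Finset.sum_congr rfl fun a _ => Finset.sum_congr rfl fun b _ => by ring

/-- Invariance of the Hermitian product under complex linear changes of coordinates. -/
lemma hermInner_comp (w : Alt n 2) {A B : Cn n →L[ℝ] Cn n} (hAB : ∀ v, A (B v) = v)
    (hA : ∀ v, A (mulI n v) = mulI n (A v)) (α β : Alt n k) :
    hermInner (w.compContinuousLinearMap A) (α.compContinuousLinearMap A)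
      (β.compContinuousLinearMap A) = hermInner w α β := by
  refine Submodule.span_induction ?_ ?_ ?_ ?_ (mem_span_extWord α)
  · rintro _ ⟨e, rfl⟩
    refine Submodule.span_induction ?_ ?_ ?_ ?_ (mem_span_extWord β)
    · rintro _ ⟨d, rfl⟩
      simp only [extWord_comp, hermInner_extWord, covInner_comp w hAB hA]
    · have : (0 : Alt n k).compContinuousLinearMap A = 0 := rfl
      rw [this, hermInner_zero_right, hermInner_zero_right]
    · intro x y _ _ hx hy
      have : (x + y).compContinuousLinearMap A
          = x.compContinuousLinearMap A + y.compContinuousLinearMap A := rfl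
      rw [this, hermInner_add_right, hermInner_add_right, hx, hy]
    · intro c x _ hx
      have : (c • x).compContinuousLinearMap A = c • x.compContinuousLinearMap A := rfl
      rw [this, hermInner_smul_right, hermInner_smul_right, hx]
  · have : (0 : Alt n k).compContinuousLinearMap A = 0 := rfl
    rw [this, hermInner_zero_left, hermInner_zero_left]
  · intro x y _ _ hx hy
    have : (x + y).compContinuousLinearMap A
        = x.compContinuousLinearMap A + y.compContinuousLinearMap A := rfl
    rw [this, hermInner_add_left, hermInner_add_left, hx, hy]
  · intro c x _ hx
    have : (c • x).compContinuousLinearMap A = c • x.compContinuousLinearMap A := rfl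
    rw [this, hermInner_smul_left, hermInner_smul_left, hx]

end HermitianProduct

/-! ### The matrix of a Hermitian form -/

section MetricMatrix

variable {n k : ℕ}

/-- The matrix `h_{jk} = g_{j k̄}` of a form `w = i h_{jk} dzʲ ∧ dz̄ᵏ`. -/
def hMat (w : Alt n 2) : Matrix (Fin n) (Fin n) ℂ := Matrix.of fun j k =>
  2⁻¹ * (w ![EuclideanSpace.single j 1, EuclideanSpace.single k Complex.I]
    - Complex.I * w ![EuclideanSpace.single j 1, EuclideanSpace.single k 1])

lemma extWord_two_apply (φ ψ : CoVec n) (u v : Cn n) :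
    extWord 2 ![φ, ψ] ![u, v] = φ u * ψ v - φ v * ψ u := by
  rw [extWord_apply, Matrix.det_fin_two]
  simp

lemma oneOneForm_apply (a : Matrix (Fin n) (Fin n) ℂ) (u v : Cn n) :
    oneOneForm a ![u, v] = ∑ p, ∑ q, a p q *
      (u p * (starRingEnd ℂ) (v q) - v p * (starRingEnd ℂ) (u q)) := by
  simp only [oneOneForm, ContinuousAlternatingMap.sum_apply, ContinuousAlternatingMap.smul_apply,
    extWord_two_apply, coframe_inl, coframe_inr, smul_eq_mul]

lemma alt_two_ext {w w' : Alt n 2} (h : ∀ a b, w ![realBasis n a, realBasis n b]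
    = w' ![realBasis n a, realBasis n b]) : w = w' := by
  refine ext_realBasis fun a => ?_
  have e : (fun i => realBasis n (a i)) = ![realBasis n (a 0), realBasis n (a 1)] := by
    funext i; fin_cases i <;> rfl
  rw [e, h]

lemma mulI_apply (v : Cn n) : mulI n v = Complex.I • v := rfl

lemma mulI_single (j : Fin n) :
    mulI n (EuclideanSpace.single j 1) = EuclideanSpace.single j Complex.I := by
  ext i
  simp [mulI_apply]

lemma mulI_mulI (v : Cn n) : mulI n (mulI n v) = -v := by
  rw [mulI_apply, mulI_apply, smul_smul, Complex.I_mul_I, neg_one_smul]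

lemma alt_two_neg_right (w : Alt n 2) (u v : Cn n) : w ![u, -v] = -w ![u, v] := by
  rw [← bilin_apply, map_neg]; rfl

lemma hMat_oneOneForm (a : Matrix (Fin n) (Fin n) ℂ) :
    hMat (oneOneForm (Complex.I • a)) = a := by
  ext j k
  have hI := Complex.I_mul_I
  simp only [hMat, Matrix.of_apply, oneOneForm_apply, Matrix.smul_apply, smul_eq_mul,
    PiLp.single_apply]
  have h1 : ∀ (c d : ℂ) (x y : Fin n → ℂ) (j k : Fin n), (∀ p, x p = if p = j then c else 0) →
      (∀ p, y p = if p = k then d else 0) → ∑ p, ∑ q, Complex.I * a p q * (x p * y q)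
        = Complex.I * a j k * (c * d) := by
    intro c d x y j k hx hy
    rw [Finset.sum_eq_single j (fun p _ hp => by simp [hx, hp]) (by simp),
      Finset.sum_eq_single k (fun p _ hp => by simp [hy, hp]) (by simp)]
    simp [hx, hy]
  simp only [mul_sub, Finset.sum_sub_distrib]
  rw [h1 1 (-Complex.I) _ _ j k (fun p => rfl) (fun p => by split_ifs <;> simp),
    h1 Complex.I 1 _ _ k j (fun p => rfl) (fun p => by split_ifs <;> simp),
    h1 1 1 _ _ j k (fun p => rfl) (fun p => by split_ifs <;> simp),
    h1 1 1 _ _ k j (fun p => rfl) (fun p => by split_ifs <;> simp)]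
  linear_combination (-(a j k)) * hI

/-- A form of type `(1,1)` is determined by its matrix. -/
lemma eq_oneOneForm {w : Alt n 2} (hw : ∀ u v, w ![mulI n u, mulI n v] = w ![u, v]) :
    w = oneOneForm (Complex.I • hMat w) := by
  have hI := Complex.I_mul_I
  have hw' : ∀ u v, (oneOneForm (Complex.I • hMat w)) ![mulI n u, mulI n v]
      = (oneOneForm (Complex.I • hMat w)) ![u, v] := by
    intro u v
    rw [oneOneForm_apply, oneOneForm_apply]
    refine Finset.sum_congr rfl fun p _ => Finset.sum_congr rfl fun q _ => ?_
    simp only [mulI_apply, PiLp.smul_apply, smul_eq_mul, map_mul, Complex.conj_I]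
    linear_combination (-(Complex.I • hMat w) p q * (u p * (starRingEnd ℂ) (v q) -
      v p * (starRingEnd ℂ) (u q))) * hI
  have hmat : hMat (oneOneForm (Complex.I • hMat w)) = hMat w := hMat_oneOneForm _
  -- `h_{jk}` and `h_{kj}` together determine the values on `(e_j, e_k)` and `(e_j, i e_k)`.
  have key : ∀ w : Alt n 2, (∀ u v, w ![mulI n u, mulI n v] = w ![u, v]) → ∀ j k,
      w ![EuclideanSpace.single j 1, EuclideanSpace.single k 1]
        = Complex.I * (hMat w j k - hMat w k j) ∧
      w ![EuclideanSpace.single j 1, EuclideanSpace.single k Complex.I]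
        = hMat w j k + hMat w k j := by
    intro w hw j k
    have s1 := alt_two_swap w (EuclideanSpace.single k 1) (EuclideanSpace.single j 1)
    have s2 : w ![EuclideanSpace.single k 1, EuclideanSpace.single j Complex.I]
        = w ![EuclideanSpace.single j 1, EuclideanSpace.single k Complex.I] := by
      rw [← mulI_single, ← mulI_single, ← hw (EuclideanSpace.single k 1), mulI_mulI,
        alt_two_neg_right, alt_two_swap]
      ring
    simp only [hMat, Matrix.of_apply, s1, s2]
    constructor
    · linear_combination (w ![EuclideanSpace.single j 1, EuclideanSpace.single k 1]) * hI
    · ring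
  have key2 : ∀ j k, w ![EuclideanSpace.single j 1, EuclideanSpace.single k 1]
        = oneOneForm (Complex.I • hMat w) ![EuclideanSpace.single j 1, EuclideanSpace.single k 1] ∧
      w ![EuclideanSpace.single j 1, EuclideanSpace.single k Complex.I]
        = oneOneForm (Complex.I • hMat w) ![EuclideanSpace.single j 1,
          EuclideanSpace.single k Complex.I] := fun j k => by
    rw [(key w hw j k).1, (key w hw j k).2, (key _ hw' j k).1, (key _ hw' j k).2, hmat]
    exact ⟨rfl, rfl⟩
  refine alt_two_ext fun a b => ?_
  refine Fin.addCases (fun j => ?_) (fun j => ?_) a <;>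
    refine Fin.addCases (fun k => ?_) (fun k => ?_) b <;>
    simp only [realBasis, Fin.append_left, Fin.append_right]
  · exact (key2 j k).1
  · exact (key2 j k).2
  · rw [alt_two_swap w, alt_two_swap (oneOneForm _), (key2 k j).2]
  · rw [← mulI_single, ← mulI_single, hw, hw', (key2 j k).1]

lemma conjAlt_apply (α : Alt n k) (v : Fin k → Cn n) :
    conjAlt α v = (starRingEnd ℂ) (α v) := rfl

lemma hMat_isHermitian {w : Alt n 2} (hw : ∀ u v, w ![mulI n u, mulI n v] = w ![u, v])
    (hr : conjAlt w = w) : (hMat w).IsHermitian := by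
  have hr' : ∀ v, (starRingEnd ℂ) (w v) = w v := fun v => by
    rw [← conjAlt_apply, hr]
  refine Matrix.IsHermitian.ext fun j k => ?_
  have s1 := alt_two_swap w (EuclideanSpace.single k 1) (EuclideanSpace.single j 1)
  have s2 : w ![EuclideanSpace.single k 1, EuclideanSpace.single j Complex.I]
      = w ![EuclideanSpace.single j 1, EuclideanSpace.single k Complex.I] := by
    rw [← mulI_single, ← mulI_single, ← hw (EuclideanSpace.single k 1), mulI_mulI,
      alt_two_neg_right, alt_two_swap]
    ring
  simp only [hMat, Matrix.of_apply, s1, s2, star_mul', star_sub, RCLike.star_def, map_neg, hr',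
    Complex.conj_I, map_inv₀, map_ofNat]
  ring

/-- A positive Hermitian form at a point: a real positive form of type `(1,1)`. -/
structure IsHermitianForm (w : Alt n 2) : Prop where
  real : conjAlt w = w
  type_one_one : ∀ u v, w ![mulI n u, mulI n v] = w ![u, v]
  pos : ∀ v, v ≠ 0 → 0 < (w ![v, mulI n v]).re

lemma oneOneForm_mulI {h : Matrix (Fin n) (Fin n) ℂ} (u v : Cn n) :
    oneOneForm (Complex.I • h) ![u, mulI n v] = ∑ p, ∑ q, h p q *
      (u p * (starRingEnd ℂ) (v q) + v p * (starRingEnd ℂ) (u q)) := by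
  have hI := Complex.I_mul_I
  rw [oneOneForm_apply]
  refine Finset.sum_congr rfl fun p _ => Finset.sum_congr rfl fun q _ => ?_
  simp only [mulI_apply, PiLp.smul_apply, smul_eq_mul, map_mul, Complex.conj_I, Matrix.smul_apply]
  linear_combination (-h p q * (u p * (starRingEnd ℂ) (v q) + v p * (starRingEnd ℂ) (u q))) * hI

namespace IsHermitianForm

variable {w : Alt n 2} (hw : IsHermitianForm w)
include hw

lemma eq_oneOne : w = oneOneForm (Complex.I • hMat w) := eq_oneOneForm hw.type_one_one

lemma isHermitian : (hMat w).IsHermitian := hMat_isHermitian hw.type_one_one hw.real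

/-- A kernel vector of the matrix would be a null vector of the positive form. -/
lemma isUnit_det : IsUnit (hMat w).det := by
  rw [isUnit_iff_ne_zero]
  intro h0
  obtain ⟨x, hx, hx0⟩ := Matrix.exists_mulVec_eq_zero_iff.2 h0
  let v : Cn n := WithLp.toLp 2 (fun i => (starRingEnd ℂ) (x i))
  have hv : v ≠ 0 := by
    intro h
    apply hx
    funext i
    have := congrArg (fun u : Cn n => u i) h
    simpa [v] using this
  have hpos := hw.pos v hv
  rw [hw.eq_oneOne, oneOneForm_mulI] at hpos
  have hzero : ∑ p, ∑ q, hMat w p q * (v p * (starRingEnd ℂ) (v q)) = 0 := by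
    refine Finset.sum_eq_zero fun p _ => ?_
    have : ∑ q, hMat w p q * (v p * (starRingEnd ℂ) (v q)) = v p * (hMat w).mulVec x p := by
      rw [Matrix.mulVec, dotProduct, Finset.mul_sum]
      exact Finset.sum_congr rfl fun q _ => by simp [v]; ring
    rw [this, hx0]
    simp
  simp only [mul_add, Finset.sum_add_distrib, hzero] at hpos
  simp at hpos

lemma hMat_mul_inv : hMat w * (hMat w)⁻¹ = 1 := Matrix.mul_nonsing_inv _ hw.isUnit_det

lemma inv_mul_hMat : (hMat w)⁻¹ * hMat w = 1 := Matrix.nonsing_inv_mul _ hw.isUnit_det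

lemma inv_isHermitian : (hMat w)⁻¹.IsHermitian := hw.isHermitian.inv

lemma conj_inv (j k : Fin n) : (starRingEnd ℂ) ((hMat w)⁻¹ j k) = (hMat w)⁻¹ k j :=
  hw.inv_isHermitian.apply k j

/-- The real Gram matrix in the complex coframe: only the products of a `dzʲ` with a `dz̄ᵏ` occur.
Inverting it gives `⟨dzʲ, dzᵏ⟩ = g^{j k̄}`. -/
lemma gram_map : (gram w).map Complex.ofReal = coframeMatrix (n := n) *
    Matrix.fromBlocks 0 (hMat w) (hMat w).transpose 0 * (coframeMatrix (n := n)).transpose := by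
  ext a b
  have hreal : (starRingEnd ℂ) (w ![realBasis n a, mulI n (realBasis n b)])
      = w ![realBasis n a, mulI n (realBasis n b)] := by
    rw [← conjAlt_apply, hw.real]
  rw [Matrix.map_apply, gram, Matrix.of_apply, Complex.conj_eq_iff_re.1 hreal]
  conv_lhs => rw [hw.eq_oneOne]
  rw [oneOneForm_mulI]
  simp only [Matrix.mul_apply, Fintype.sum_sum_type, Matrix.transpose_apply, Matrix.fromBlocks_apply₁₁,
    Matrix.fromBlocks_apply₁₂, Matrix.fromBlocks_apply₂₁, Matrix.fromBlocks_apply₂₂,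
    Matrix.zero_apply, mul_zero, Finset.sum_const_zero, zero_add, add_zero, coframeMatrix,
    Matrix.of_apply, coframe_inl, coframe_inr, mul_add, Finset.sum_add_distrib, Finset.sum_mul]
  rw [add_comm]
  congr 1
  · refine Finset.sum_congr rfl fun p _ => Finset.sum_congr rfl fun q _ => by ring
  · rw [Finset.sum_comm]
    refine Finset.sum_congr rfl fun p _ => Finset.sum_congr rfl fun q _ => by ring

lemma gram_posDef : (gram w).PosDef := by
  have hsymm : (gram w).IsHermitian := by
    refine Matrix.IsHermitian.ext fun a b => ?_
    rw [star_trivial, gram, Matrix.of_apply, Matrix.of_apply,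
      ← hw.type_one_one (realBasis n b), mulI_mulI, alt_two_neg_right, alt_two_swap, neg_neg]
  refine Matrix.PosDef.of_dotProduct_mulVec_pos hsymm fun x hx => ?_
  let v : Cn n := ∑ a, x a • realBasis n a
  have hv : v ≠ 0 := by
    intro h
    apply hx
    have hli := Fintype.linearIndependent_iff.1 (stdRealBasis n).linearIndependent x (by
      simpa [v] using h)
    exact funext hli
  have hpos := hw.pos v hv
  have : (w ![v, mulI n v]).re = star x ⬝ᵥ (gram w).mulVec x := by
    rw [← bilin_apply]
    have hg : ∀ c d, gram w c d = (bilin w (realBasis n c) (mulI n (realBasis n d))).re :=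
      fun c d => rfl
    simp only [v, map_sum, map_smul, LinearMap.sum_apply, LinearMap.smul_apply, Complex.re_sum,
      Complex.smul_re, smul_eq_mul, dotProduct, Matrix.mulVec, hg, Finset.mul_sum, star_trivial]
    rw [Finset.sum_comm]
    exact Finset.sum_congr rfl fun a _ => Finset.sum_congr rfl fun b _ => by ring
  rwa [this] at hpos

lemma isUnit_det_gram : IsUnit (gram w).det := (hw.gram_posDef.det_pos).ne'.isUnit

/-- The Hermitian products of the coframe: `⟨dzʲ, dzᵏ⟩ = H_{kj}`, `⟨dz̄ʲ, dz̄ᵏ⟩ = H_{jk}` with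
`H = h⁻¹`, the mixed products vanish. -/
lemma covInner_coframe (c d : Fin n ⊕ Fin n) : covInner w (coframe c) (coframe d)
    = Matrix.fromBlocks ((hMat w)⁻¹).transpose 0 0 (hMat w)⁻¹ c d := by
  set X : Matrix (Fin (n + n)) (Fin (n + n)) ℂ := ((gram w)⁻¹).map Complex.ofReal with hX
  have h1 : (gram w).map Complex.ofReal * X = 1 := by
    change (gram w).map Complex.ofRealHom * ((gram w)⁻¹).map Complex.ofRealHom = 1
    rw [← Matrix.map_mul, Matrix.mul_nonsing_inv _ hw.isUnit_det_gram]
    simp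
  rw [hw.gram_map, Matrix.mul_assoc, Matrix.mul_assoc] at h1
  have h2 := (Matrix.mul_eq_one_comm_of_card_eq _ _ _ (by simp)).1 h1
  have h3 : (coframeMatrix (n := n)).transpose * X * coframeMatrix (n := n)
      = Matrix.fromBlocks 0 ((hMat w)⁻¹).transpose (hMat w)⁻¹ 0 := by
    have h4 : Matrix.fromBlocks 0 ((hMat w)⁻¹).transpose (hMat w)⁻¹ 0 *
        Matrix.fromBlocks 0 (hMat w) (hMat w).transpose 0
        = (1 : Matrix (Fin n ⊕ Fin n) (Fin n ⊕ Fin n) ℂ) := by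
      rw [Matrix.fromBlocks_multiply, ← Matrix.transpose_mul, hw.hMat_mul_inv, hw.inv_mul_hMat]
      simp
    rw [Matrix.mul_assoc] at h2
    calc (coframeMatrix (n := n)).transpose * X * coframeMatrix (n := n)
        = (Matrix.fromBlocks 0 ((hMat w)⁻¹).transpose (hMat w)⁻¹ 0 *
          Matrix.fromBlocks 0 (hMat w) (hMat w).transpose 0) *
            ((coframeMatrix (n := n)).transpose * X * coframeMatrix (n := n)) := by rw [h4, Matrix.one_mul]
      _ = _ := by
        rw [Matrix.mul_assoc, h2, Matrix.mul_one]
  have hconj : ∀ a, (starRingEnd ℂ) (coframe d (realBasis n a))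
      = coframe d.swap (realBasis n a) := by
    intro a
    rcases d with j | j <;> simp
  have h5 : covInner w (coframe c) (coframe d)
      = ((coframeMatrix (n := n)).transpose * X * coframeMatrix (n := n)) c d.swap := by
    simp only [covInner, hconj, Matrix.mul_apply, Matrix.transpose_apply, coframeMatrix,
      Matrix.of_apply, Finset.sum_mul, hX, Matrix.map_apply]
    rw [Finset.sum_comm]
    exact Finset.sum_congr rfl fun a _ => Finset.sum_congr rfl fun b _ => by ring
  rw [h5, h3]
  rcases c with j | j <;> rcases d with k | k <;> simp

end IsHermitianForm

end MetricMatrix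

/-! ### Pairings of forms of low degree -/

section Pairings

variable {n k : ℕ}

lemma extMul_extWord (φ : CoVec n) (ψ : Fin k → CoVec n) :
    extMul φ (extWord k ψ) = extWord (k + 1) (Fin.cons φ ψ) := by
  simp [extWord]

/-- The coefficient `Θ(e₁, …, eₙ)` of an `(n,0)`-form. -/
def volCoeff (Θ : Alt n n) : ℂ := Θ fun j => EuclideanSpace.single j 1

/-- Forms of type `(n,0)` at a point. -/
def IsTypeNZero (Θ : Alt n n) : Prop :=
  ∀ v i, Θ (Function.update v i (mulI n (v i))) = Complex.I * Θ v

/-- An `(n,0)`-form is complex multilinear, hence a multiple of `dz¹ ∧ ⋯ ∧ dzⁿ`. -/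
lemma IsTypeNZero.eq_smul_extWord {Θ : Alt n n} (h : IsTypeNZero Θ) :
    Θ = volCoeff Θ • extWord n fun j => coframe (.inl j) := by
  let f : Cn n [⋀^Fin n]→ₗ[ℂ] ℂ :=
    { Θ.toMultilinearMap with
      toFun := Θ
      map_update_add' := fun v i x y => Θ.toMultilinearMap.map_update_add v i x y
      map_update_smul' := by
        intro inst v i c x
        have hsub : inst = instDecidableEqFin n := Subsingleton.elim _ _
        subst hsub
        have hx : c • x = c.re • x + c.im • mulI n x := by
          conv_lhs => rw [← Complex.re_add_im c]
          rw [add_smul, mul_smul, mulI_apply, Complex.coe_smul, Complex.coe_smul]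
        have hI := h (Function.update v i x) i
        rw [Function.update_idem, Function.update_self] at hI
        have e1 := Θ.toMultilinearMap.map_update_add v i (c.re • x) (c.im • mulI n x)
        have e2 := Θ.toMultilinearMap.map_update_smul v i c.re x
        have e3 := Θ.toMultilinearMap.map_update_smul v i c.im (mulI n x)
        change Θ _ = c • Θ _
        rw [hx]
        refine e1.trans ?_
        rw [e2, e3]
        change c.re • Θ _ + c.im • Θ _ = _
        rw [hI, Complex.real_smul, Complex.real_smul, smul_eq_mul]
        conv_rhs => rw [← Complex.re_add_im c]
        ring
      map_eq_zero_of_eq' := fun v i j hij hne => Θ.map_eq_zero_of_eq v hij hne }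
  have hf := AlternatingMap.eq_smul_basis_det (PiLp.basisFun 2 ℂ (Fin n)) f
  ext v
  have h1 : f v = f (PiLp.basisFun 2 ℂ (Fin n)) * (PiLp.basisFun 2 ℂ (Fin n)).det v := by
    conv_lhs => rw [hf]
    rfl
  have h2 : f (PiLp.basisFun 2 ℂ (Fin n)) = volCoeff Θ := by
    change Θ _ = Θ _
    congr 1
    funext j
    simp
  rw [ContinuousAlternatingMap.smul_apply, extWord_apply, smul_eq_mul, ← h2]
  refine h1.trans ?_
  rw [Module.Basis.det_apply]
  rfl

lemma conjAlt_smul (c : ℂ) (α : Alt n k) : conjAlt (c • α) = (starRingEnd ℂ) c • conjAlt α := by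
  ext v
  simp [conjAlt_apply]

lemma conjAlt_extWord_inl (j : Fin k → Fin n) :
    conjAlt (extWord k fun i => coframe (.inl (j i)))
      = extWord k fun i => coframe (n := n) (.inr (j i)) := by
  ext v
  rw [conjAlt_apply, extWord_apply, extWord_apply, RingHom.map_det]
  rfl

/-- The constant relating `‖Ω ∧ Ω̄‖` to `|Ω(e₁, …, eₙ)|²`. -/
def volConst (n : ℕ) : ℝ :=
  ‖wedge (extWord n fun j => coframe (.inl j)) (extWord n fun j => coframe (.inr j)) (realBasis n)‖

lemma volConst_pos : 0 < volConst n := by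
  rw [volConst, norm_pos_iff]
  have h : wedge (extWord n fun j => coframe (.inl j)) (extWord n fun j => coframe (.inr j))
      = extWord (n + n) fun i => coframe (n := n) (finSumFinEquiv.symm i) := by
    apply incl_injective
    rw [incl_wedge_extWord, incl_extWord, incl_extWord, ← Module.End.mul_apply]
    congr 1
    rw [wordOp, wordOp, wordOp, ← List.prod_append, ← List.ofFn_fin_append]
    congr 2
    funext i
    refine Fin.addCases (fun j => ?_) (fun j => ?_) i <;>
      simp [-Fin.natAdd_eq_addNat]
  rw [h]
  exact extWord_coframe_equiv_ne_zero _

lemma norm_volForm_apply {Θ : Alt n n} (h : IsTypeNZero Θ) :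
    ‖(Complex.I ^ (n ^ 2) • wedge Θ (conjAlt Θ)) (realBasis n)‖
      = volConst n * Complex.normSq (volCoeff Θ) := by
  have e : wedge Θ (conjAlt Θ) = (volCoeff Θ * (starRingEnd ℂ) (volCoeff Θ)) •
      wedge (extWord n fun j => coframe (.inl j)) (extWord n fun j => coframe (.inr j)) := by
    conv_lhs => rw [h.eq_smul_extWord]
    rw [conjAlt_smul, wedge_smul_left, wedge_smul_right, smul_smul,
      conjAlt_extWord_inl (j := fun i => i)]
  rw [e, ContinuousAlternatingMap.smul_apply, ContinuousAlternatingMap.smul_apply, norm_smul,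
    norm_smul, norm_pow, Complex.norm_I, one_pow, one_mul, Complex.mul_conj, Complex.norm_real,
    Real.norm_of_nonneg (Complex.normSq_nonneg _), mul_comm]
  rfl

lemma hermInner_two (w : Alt n 2) (c d : Fin n ⊕ Fin n) (a : Matrix (Fin n) (Fin n) ℂ) :
    hermInner w (extWord 2 ![coframe c, coframe d]) (oneOneForm a)
      = ∑ p, ∑ q, (starRingEnd ℂ) (a p q) *
        (covInner w (coframe c) (coframe (.inl p)) * covInner w (coframe d) (coframe (.inr q))
          - covInner w (coframe c) (coframe (.inr q)) * covInner w (coframe d) (coframe (.inl p))) := by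
  simp only [oneOneForm, hermInner_sum_right, hermInner_smul_right, hermInner_extWord,
    Matrix.det_fin_two]
  simp

/-- The pairing of `dzˡ ∧ dzʲ ∧ dz̄ᵏ` with a form of type `(2,1)`. -/
lemma hermInner_three (w : Alt n 2) (c d e : Fin n ⊕ Fin n) (t : Fin n → Fin n → Fin n → ℂ) :
    hermInner w (extWord 3 ![coframe c, coframe d, coframe e])
      (∑ p, ∑ q, ∑ r, t p q r • extWord 3 ![coframe (.inl p), coframe (.inl q), coframe (.inr r)])
      = ∑ p, ∑ q, ∑ r, (starRingEnd ℂ) (t p q r) *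
        (Matrix.of fun i j => covInner w (![coframe c, coframe d, coframe e] i)
          (![coframe (.inl p), coframe (.inl q), coframe (.inr r)] j)).det := by
  simp only [hermInner_sum_right, hermInner_smul_right, hermInner_extWord]

namespace IsHermitianForm

variable {w : Alt n 2} (hw : IsHermitianForm w)
include hw

lemma conj_det : (starRingEnd ℂ) (hMat w).det = (hMat w).det := by
  have h := congrArg Matrix.det hw.isHermitian
  rwa [Matrix.det_conjTranspose] at h

/-- `‖Ω‖²_ω = |Ω(e₁, …, eₙ)|² / det(g)`. -/
lemma normSq_mul_det {Θ : Alt n n} (h : IsTypeNZero Θ) :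
    (normSq w Θ : ℂ) * (hMat w).det = Complex.normSq (volCoeff Θ) := by
  have h1 : hermInner w Θ Θ = Complex.normSq (volCoeff Θ) * ((hMat w).det)⁻¹ := by
    conv_lhs => rw [h.eq_smul_extWord]
    rw [hermInner_smul_left, hermInner_smul_right, hermInner_extWord, ← mul_assoc, Complex.mul_conj]
    congr 1
    simp only [hw.covInner_coframe, Matrix.fromBlocks_apply₁₁]
    rw [show (Matrix.of fun i j => ((hMat w)⁻¹).transpose i j) = ((hMat w)⁻¹).transpose from rfl,
      Matrix.det_transpose, Matrix.det_nonsing_inv, Ring.inverse_eq_inv']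
  have h2 : (hermInner w Θ Θ).re = hermInner w Θ Θ := by
    rw [← Complex.conj_eq_iff_re, h1, map_mul, map_inv₀, hw.conj_det, Complex.conj_ofReal]
  rw [normSq, h2, h1, inv_mul_cancel_right₀ hw.isUnit_det.ne_zero]

/-- `⟨dzˡ ∧ dz̄ᵏ, a_{pq} dzᵖ ∧ dz̄^q⟩`. -/
lemma hermInner_inl_inr (l k : Fin n) (a : Matrix (Fin n) (Fin n) ℂ) :
    hermInner w (extWord 2 ![coframe (.inl l), coframe (.inr k)]) (oneOneForm a)
      = ∑ p, ∑ q, (starRingEnd ℂ) (a p q) * ((hMat w)⁻¹ p l * (hMat w)⁻¹ k q) := by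
  rw [hermInner_two]
  simp [hw.covInner_coframe]

lemma hermInner_inl_inl (l k : Fin n) (a : Matrix (Fin n) (Fin n) ℂ) :
    hermInner w (extWord 2 ![coframe (.inl l), coframe (.inl k)]) (oneOneForm a) = 0 := by
  rw [hermInner_two]
  simp [hw.covInner_coframe]

lemma hermInner_inr_inr (l k : Fin n) (a : Matrix (Fin n) (Fin n) ℂ) :
    hermInner w (extWord 2 ![coframe (.inr l), coframe (.inr k)]) (oneOneForm a) = 0 := by
  rw [hermInner_two]
  simp [hw.covInner_coframe]

/-- `⟨dzˡ ∧ dz̄ᵏ, ω⟩_ω = -i g^{l k̄}`. -/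
lemma hermInner_self (l k : Fin n) :
    hermInner w (extWord 2 ![coframe (.inl l), coframe (.inr k)]) w
      = -Complex.I * (hMat w)⁻¹ k l := by
  conv_lhs => rw [show hermInner w (extWord 2 ![coframe (.inl l), coframe (.inr k)]) w
    = hermInner w (extWord 2 ![coframe (.inl l), coframe (.inr k)])
      (oneOneForm (Complex.I • hMat w)) by rw [← hw.eq_oneOne]]
  rw [hw.hermInner_inl_inr]
  have h1 : (hMat w)⁻¹ k l = ∑ p, ∑ q, (hMat w)⁻¹ k q * hMat w q p * (hMat w)⁻¹ p l := by
    have : (hMat w)⁻¹ = (hMat w)⁻¹ * hMat w * (hMat w)⁻¹ := by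
      rw [hw.inv_mul_hMat, Matrix.one_mul]
    conv_lhs => rw [this]
    simp only [Matrix.mul_apply, Finset.sum_mul]
  rw [h1, Finset.mul_sum]
  refine Finset.sum_congr rfl fun p _ => ?_
  rw [Finset.mul_sum]
  refine Finset.sum_congr rfl fun q _ => ?_
  have := hw.isHermitian.apply q p
  rw [Matrix.smul_apply, smul_eq_mul, map_mul, Complex.conj_I]
  rw [← this]
  simp only [RCLike.star_def]
  ring

lemma hermInner_inl_inl_inr (l j k : Fin n) (t : Fin n → Fin n → Fin n → ℂ) :
    hermInner w (extWord 3 ![coframe (.inl l), coframe (.inl j), coframe (.inr k)])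
      (∑ p, ∑ q, ∑ r, t p q r • extWord 3 ![coframe (.inl p), coframe (.inl q), coframe (.inr r)])
      = ∑ p, ∑ q, ∑ r, (starRingEnd ℂ) (t p q r) * (((hMat w)⁻¹ p l * (hMat w)⁻¹ q j
          - (hMat w)⁻¹ q l * (hMat w)⁻¹ p j) * (hMat w)⁻¹ k r) := by
  rw [hermInner_three]
  refine Finset.sum_congr rfl fun p _ => Finset.sum_congr rfl fun q _ =>
    Finset.sum_congr rfl fun r _ => ?_
  rw [Matrix.det_fin_three]
  simp [hw.covInner_coframe, -mul_eq_mul_left_iff]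
  ring

lemma hermInner_inl_inl_inl (l j k : Fin n) (t : Fin n → Fin n → Fin n → ℂ) :
    hermInner w (extWord 3 ![coframe (.inl l), coframe (.inl j), coframe (.inl k)])
      (∑ p, ∑ q, ∑ r, t p q r • extWord 3 ![coframe (.inl p), coframe (.inl q), coframe (.inr r)])
      = 0 := by
  rw [hermInner_three]
  refine Finset.sum_eq_zero fun p _ => Finset.sum_eq_zero fun q _ =>
    Finset.sum_eq_zero fun r _ => ?_
  rw [Matrix.det_fin_three]
  simp [hw.covInner_coframe]

lemma hermInner_inl_inr_inr (l j k : Fin n) (t : Fin n → Fin n → Fin n → ℂ) :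
    hermInner w (extWord 3 ![coframe (.inl l), coframe (.inr j), coframe (.inr k)])
      (∑ p, ∑ q, ∑ r, t p q r • extWord 3 ![coframe (.inl p), coframe (.inl q), coframe (.inr r)])
      = 0 := by
  rw [hermInner_three]
  refine Finset.sum_eq_zero fun p _ => Finset.sum_eq_zero fun q _ =>
    Finset.sum_eq_zero fun r _ => ?_
  rw [Matrix.det_fin_three]
  simp [hw.covInner_coframe]

/-- The Hermitian product of forms is positive definite: if the inverse Gram matrix is `QᵀQ`, then
`k! ⟨α, α⟩` is the sum of the squares `|α(Q-frame)|²`. -/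
lemma hermInner_self_pos {α : Alt n k} (hα : α ≠ 0) : 0 < (hermInner w α α).re := by
  obtain ⟨Q, hQ⟩ : ∃ Q : Matrix (Fin (n + n)) (Fin (n + n)) ℝ, (gram w)⁻¹ = Q.conjTranspose * Q := by
    open scoped MatrixOrder Matrix.Norms.L2Operator in
    exact CStarAlgebra.nonneg_iff_eq_star_mul_self.1 hw.gram_posDef.inv.posSemidef.nonneg
  have hQu : IsUnit Q.det := by
    have h := hw.gram_posDef.inv.det_pos
    rw [hQ, Matrix.det_mul] at h
    rw [isUnit_iff_ne_zero]
    intro h0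
    rw [h0, mul_zero] at h
    exact lt_irrefl _ h
  let S : (Fin k → Fin (n + n)) → ℂ := fun c =>
    ∑ a : Fin k → Fin (n + n), (∏ i, (Q (c i) (a i) : ℂ)) * α fun i => realBasis n (a i)
  have hsum : hermInner w α α = ((k.factorial : ℂ))⁻¹ * ∑ c, S c * (starRingEnd ℂ) (S c) := by
    rw [hermInner]
    congr 1
    have h1 : ∀ a b : Fin k → Fin (n + n), ((∏ i, (gram w)⁻¹ (a i) (b i) : ℝ) : ℂ)
        = ∑ c : Fin k → Fin (n + n), (∏ i, (Q (c i) (a i) : ℂ)) * ∏ i, (Q (c i) (b i) : ℂ) := by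
      intro a b
      have h2 : ∀ i, (gram w)⁻¹ (a i) (b i) = ∑ c, Q c (a i) * Q c (b i) := fun i => by
        rw [hQ, Matrix.mul_apply]
        simp
      simp only [h2, ← Finset.prod_mul_distrib]
      push_cast
      rw [Finset.prod_univ_sum, Fintype.piFinset_univ]
    simp only [h1, S, map_sum, map_mul, map_prod, Complex.conj_ofReal, Finset.sum_mul]
    rw [Finset.sum_congr rfl fun a _ => Finset.sum_comm, Finset.sum_comm]
    refine Finset.sum_congr rfl fun c _ => Finset.sum_congr rfl fun a _ => ?_
    rw [Finset.mul_sum]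
    exact Finset.sum_congr rfl fun b _ => by ring
  have hex : ∃ c, S c ≠ 0 := by
    by_contra! hS
    apply hα
    refine ext_realBasis fun b => ?_
    have h3 : ∑ c : Fin k → Fin (n + n), (∏ i, (Q⁻¹ (b i) (c i) : ℂ)) * S c
        = α fun i => realBasis n (b i) := by
      simp only [S, Finset.mul_sum]
      rw [Finset.sum_comm]
      have h4 : ∀ a : Fin k → Fin (n + n), ∑ c : Fin k → Fin (n + n),
          (∏ i, (Q⁻¹ (b i) (c i) : ℂ)) * ((∏ i, (Q (c i) (a i) : ℂ)) *
            α fun i => realBasis n (a i))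
          = (if b = a then 1 else 0) * α fun i => realBasis n (a i) := by
        intro a
        simp only [← mul_assoc, ← Finset.sum_mul, ← Finset.prod_mul_distrib]
        congr 1
        have h5 : ∀ i, ∑ c, ((Q⁻¹ (b i) c : ℝ) : ℂ) * (Q c (a i) : ℂ)
            = if b i = a i then 1 else 0 := fun i => by
          have := congrArg (fun m : Matrix (Fin (n + n)) (Fin (n + n)) ℝ => m (b i) (a i))
            (Matrix.nonsing_inv_mul _ hQu)
          simp only [Matrix.mul_apply, Matrix.one_apply] at this
          have := congrArg Complex.ofReal this
          push_cast at this
          rw [this]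
          split_ifs <;> simp
        rw [← Fintype.piFinset_univ, ← Finset.prod_univ_sum (fun _ => Finset.univ)
          (fun i c => ((Q⁻¹ (b i) c : ℝ) : ℂ) * (Q c (a i) : ℂ)), Finset.prod_congr rfl fun i _ => h5 i]
        by_cases hba : b = a
        · simp [hba]
        · rw [if_neg hba]
          obtain ⟨i, hi⟩ := Function.ne_iff.1 hba
          exact Finset.prod_eq_zero (Finset.mem_univ i) (if_neg hi)
      rw [Finset.sum_congr rfl fun a _ => h4 a]
      simp
    rw [← h3, Finset.sum_eq_zero fun c _ => by rw [hS c, mul_zero]]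
    rfl
  have hre : (hermInner w α α).re = ((k.factorial : ℝ))⁻¹ * ∑ c, Complex.normSq (S c) := by
    rw [hsum]
    simp only [Complex.mul_conj]
    rw [← Complex.ofReal_sum, ← Complex.ofReal_natCast, ← Complex.ofReal_inv, ← Complex.ofReal_mul,
      Complex.ofReal_re]
  rw [hre]
  obtain ⟨c, hc⟩ := hex
  refine mul_pos (inv_pos.2 (by exact_mod_cast k.factorial_pos)) ?_
  exact Finset.sum_pos' (fun c _ => Complex.normSq_nonneg _) ⟨c, Finset.mem_univ c,
    Complex.normSq_pos.2 hc⟩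

/-- Forms with the same products with all forms are equal. -/
lemma eq_of_hermInner_eq {β γ : Alt n k} (h : ∀ α, hermInner w α β = hermInner w α γ) : β = γ := by
  by_contra hne
  have := hw.hermInner_self_pos (sub_ne_zero.2 hne)
  rw [hermInner_sub_right, h, sub_self] at this
  simp at this

lemma eq_of_hermInner_extWord_eq {β γ : Alt n k} (h : ∀ e : Fin k → Fin n ⊕ Fin n,
    hermInner w (extWord k fun i => coframe (e i)) β
      = hermInner w (extWord k fun i => coframe (e i)) γ) : β = γ := by
  refine hw.eq_of_hermInner_eq fun α => ?_
  refine Submodule.span_induction ?_ ?_ ?_ ?_ (mem_span_extWord α)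
  · rintro _ ⟨e, rfl⟩
    exact h e
  · simp
  · intro x y _ _ hx hy
    rw [hermInner_add_left, hermInner_add_left, hx, hy]
  · intro c x _ hx
    rw [hermInner_smul_left, hermInner_smul_left, hx]

end IsHermitianForm

end Pairings

/-! ### Wirtinger derivatives -/

section Wirtinger

variable {n k : ℕ} {V W : Type*} [NormedAddCommGroup V] [NormedSpace ℝ V] [NormedSpace ℂ V]
  [NormedAddCommGroup W] [NormedSpace ℝ W] [NormedSpace ℂ W]

/-- The index `j` of the coordinate `zʲ` or `z̄ʲ`. -/
def coordIndex : Fin n ⊕ Fin n → Fin n := Sum.elim id id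

/-- The factor `±i` with `∂/∂z = ½ (∂/∂x - i ∂/∂y)` and `∂/∂z̄ = ½ (∂/∂x + i ∂/∂y)`. -/
def coordUnit : Fin n ⊕ Fin n → ℂ := Sum.elim (fun _ => Complex.I) fun _ => -Complex.I

/-- The Wirtinger derivative `∂a/∂zʲ` (for `c = inl j`) or `∂a/∂z̄ʲ` (for `c = inr j`). -/
def wirt (c : Fin n ⊕ Fin n) (a : Cn n → V) (y : Cn n) : V :=
  (2⁻¹ : ℂ) • (fderiv ℝ a y (EuclideanSpace.single (coordIndex c) 1)
    - coordUnit c • fderiv ℝ a y (EuclideanSpace.single (coordIndex c) Complex.I))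

lemma _root_.Filter.EventuallyEq.wirt_eq {a b : Cn n → V} {y : Cn n} (h : a =ᶠ[nhds y] b)
    (c : Fin n ⊕ Fin n) : wirt c a y = wirt c b y := by
  rw [wirt, wirt, h.fderiv_eq]

lemma _root_.Filter.EventuallyEq.wirt {a b : Cn n → V} {y : Cn n} (h : a =ᶠ[nhds y] b)
    (c : Fin n ⊕ Fin n) : wirt c a =ᶠ[nhds y] wirt c b :=
  h.eventuallyEq_nhds.mono fun _ hz => hz.wirt_eq c

lemma wirt_const (c : Fin n ⊕ Fin n) (v : V) (y : Cn n) : wirt c (fun _ => v) y = 0 := by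
  simp [wirt]

lemma wirt_add {a b : Cn n → V} {y : Cn n} (ha : DifferentiableAt ℝ a y)
    (hb : DifferentiableAt ℝ b y) (c : Fin n ⊕ Fin n) :
    wirt c (fun z => a z + b z) y = wirt c a y + wirt c b y := by
  rw [wirt, wirt, wirt, fderiv_fun_add ha hb]
  simp only [add_apply, smul_add, smul_sub]
  abel

lemma wirt_sum {ι : Type*} (s : Finset ι) {a : ι → Cn n → V} {y : Cn n}
    (ha : ∀ i ∈ s, DifferentiableAt ℝ (a i) y) (c : Fin n ⊕ Fin n) :
    wirt c (fun z => ∑ i ∈ s, a i z) y = ∑ i ∈ s, wirt c (a i) y := by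
  simp only [wirt]
  rw [fderiv_fun_sum ha]
  simp only [sum_apply, Finset.smul_sum, ← Finset.sum_sub_distrib]

variable [IsScalarTower ℝ ℂ V] [IsScalarTower ℝ ℂ W]

lemma fderiv_eq_sum_wirt (a : Cn n → V) (y v : Cn n) :
    fderiv ℝ a y v = ∑ c, coframe c v • wirt c a y := by
  rw [apply_eq_sum_coframe (fderiv ℝ a y) v, Fintype.sum_sum_type]
  simp [wirt, coordIndex, coordUnit]

lemma wirt_clm (L : V →L[ℂ] W) {a : Cn n → V} {y : Cn n} (ha : DifferentiableAt ℝ a y)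
    (c : Fin n ⊕ Fin n) : wirt c (fun z => L (a z)) y = L (wirt c a y) := by
  have h : fderiv ℝ (fun z => L (a z)) y = (L.restrictScalars ℝ).comp (fderiv ℝ a y) :=
    ((L.restrictScalars ℝ).hasFDerivAt.comp y ha.hasFDerivAt).fderiv
  rw [wirt, wirt, h]
  simp

lemma wirt_const_smul (t : ℂ) {a : Cn n → V} {y : Cn n} (ha : DifferentiableAt ℝ a y)
    (c : Fin n ⊕ Fin n) : wirt c (fun z => t • a z) y = t • wirt c a y :=
  wirt_clm (t • ContinuousLinearMap.id ℂ V) ha c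

lemma wirt_linear [FiniteDimensional ℂ V] (L : V →ₗ[ℂ] W) {a : Cn n → V} {y : Cn n}
    (ha : DifferentiableAt ℝ a y) (c : Fin n ⊕ Fin n) :
    wirt c (fun z => L (a z)) y = L (wirt c a y) :=
  wirt_clm L.toContinuousLinearMap ha c

lemma wirt_smul {f : Cn n → ℂ} {a : Cn n → V} {y : Cn n} (hf : DifferentiableAt ℝ f y)
    (ha : DifferentiableAt ℝ a y) (c : Fin n ⊕ Fin n) :
    wirt c (fun z => f z • a z) y = wirt c f y • a y + f y • wirt c a y := by
  rw [wirt, wirt, wirt, fderiv_fun_smul hf ha]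
  simp only [add_apply, smul_apply,
    ContinuousLinearMap.smulRight_apply, smul_eq_mul]
  module

lemma wirt_mul {f g : Cn n → ℂ} {y : Cn n} (hf : DifferentiableAt ℝ f y)
    (hg : DifferentiableAt ℝ g y) (c : Fin n ⊕ Fin n) :
    wirt c (fun z => f z * g z) y = wirt c f y * g y + f y * wirt c g y :=
  wirt_smul hf hg c

lemma wirt_conj {f : Cn n → ℂ} {y : Cn n} (hf : DifferentiableAt ℝ f y) (c : Fin n ⊕ Fin n) :
    wirt c (fun z => (starRingEnd ℂ) (f z)) y = (starRingEnd ℂ) (wirt c.swap f y) := by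
  have h : fderiv ℝ (fun z => (starRingEnd ℂ) (f z)) y
      = Complex.conjCLE.toContinuousLinearMap.comp (fderiv ℝ f y) :=
    (Complex.conjCLE.toContinuousLinearMap.hasFDerivAt.comp y hf.hasFDerivAt).fderiv
  rw [wirt, wirt, h]
  have h2 : (starRingEnd ℂ) 2 = 2 := map_ofNat _ 2
  cases c <;> simp [coordIndex, coordUnit, h2, sub_eq_add_neg]

lemma _root_.ContDiffAt.wirt {a : Cn n → V} {y : Cn n} (ha : ContDiffAt ℝ ∞ a y)
    (c : Fin n ⊕ Fin n) : ContDiffAt ℝ ∞ (wirt c a) y := by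
  have h : ContDiffAt ℝ ∞ (fderiv ℝ a) y := ha.fderiv_right (by simp)
  have h2 : ∀ u : Cn n, ContDiffAt ℝ ∞ (fun z => fderiv ℝ a z u) y := fun u =>
    h.clm_apply contDiffAt_const
  have h3 : ∀ t : ℂ, ∀ {b : Cn n → V}, ContDiffAt ℝ ∞ b y → ContDiffAt ℝ ∞ (fun z => t • b z) y :=
    fun t b hb => ((t • ContinuousLinearMap.id ℂ V).restrictScalars ℝ).contDiff.contDiffAt.comp y hb
  exact h3 _ ((h2 _).sub (h3 _ (h2 _)))

/-- Wirtinger derivatives commute. -/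
lemma wirt_comm {a : Cn n → V} {y : Cn n} (ha : ContDiffAt ℝ ∞ a y) (c d : Fin n ⊕ Fin n) :
    wirt c (wirt d a) y = wirt d (wirt c a) y := by
  have h : DifferentiableAt ℝ (fderiv ℝ a) y :=
    (ha.fderiv_right (m := ∞) (by simp)).differentiableAt (by simp)
  have hsymm : ∀ u v, fderiv ℝ (fderiv ℝ a) y u v = fderiv ℝ (fderiv ℝ a) y v u :=
    ha.isSymmSndFDerivAt (by simpa using WithTop.coe_le_coe.2 (le_top (a := (2 : ℕ∞))))
  have key : ∀ (e : Fin n ⊕ Fin n) (u : Cn n), fderiv ℝ (wirt e a) y u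
      = (2⁻¹ : ℂ) • (fderiv ℝ (fderiv ℝ a) y u (EuclideanSpace.single (coordIndex e) 1)
        - coordUnit e • fderiv ℝ (fderiv ℝ a) y u
          (EuclideanSpace.single (coordIndex e) Complex.I)) := by
    intro e u
    have hap : ∀ v : Cn n, HasFDerivAt (fun z => fderiv ℝ a z v)
        ((ContinuousLinearMap.apply ℝ V v).comp (fderiv ℝ (fderiv ℝ a) y)) y := fun v =>
      (ContinuousLinearMap.apply ℝ V v).hasFDerivAt.comp y h.hasFDerivAt
    have hs : ∀ (t : ℂ) {b : Cn n → V} {L : Cn n →L[ℝ] V}, HasFDerivAt b L y →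
        HasFDerivAt (fun z => t • b z)
          (((t • ContinuousLinearMap.id ℂ V).restrictScalars ℝ).comp L) y := fun t b L hb =>
      ((t • ContinuousLinearMap.id ℂ V).restrictScalars ℝ).hasFDerivAt.comp y hb
    have := (hs 2⁻¹ ((hap (EuclideanSpace.single (coordIndex e) 1)).sub
      (hs (coordUnit e) (hap (EuclideanSpace.single (coordIndex e) Complex.I))))).fderiv
    have h2 : fderiv ℝ (wirt e a) y = _ := this
    rw [h2]
    simp [smul_sub]
  rw [wirt, wirt, key, key, key, key, hsymm (EuclideanSpace.single (coordIndex d) 1),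
    hsymm (EuclideanSpace.single (coordIndex d) Complex.I),
    hsymm (EuclideanSpace.single (coordIndex d) 1),
    hsymm (EuclideanSpace.single (coordIndex d) Complex.I)]
  module

end Wirtinger

/-! ### The operators `∂` and `∂̄` in coordinates -/

section CoordinateOperators

variable {n k : ℕ}

/-- The operator `∂` on forms on an open subset of `ℂⁿ`. -/
def coordDel (a : Cn n → Alt n k) (y : Cn n) : Alt n (k + 1) :=
  ContinuousAlternatingMap.alternatizeUncurryFin (linPart (fderiv ℝ a y))

/-- The operator `∂̄` on forms on an open subset of `ℂⁿ`. -/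
def coordDelBar (a : Cn n → Alt n k) (y : Cn n) : Alt n (k + 1) :=
  ContinuousAlternatingMap.alternatizeUncurryFin (antilinPart (fderiv ℝ a y))

lemma alternatizeUncurryFin_sum_smulRight {ι : Type*} (s : Finset ι) (φ : ι → CoVec n)
    (β : ι → Alt n k) (L : Cn n →L[ℝ] Alt n k) (h : ∀ v, L v = ∑ i ∈ s, φ i v • β i) :
    ContinuousAlternatingMap.alternatizeUncurryFin L = ∑ i ∈ s, extMul (φ i) (β i) := by
  have h1 : L = ∑ i ∈ s, (φ i).smulRight (β i) := by
    ext1 v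
    rw [h, sum_apply]
    rfl
  rw [h1]
  exact map_sum (ContinuousAlternatingMap.alternatizeUncurryFinCLM ℝ (Cn n) ℂ) _ _

lemma linPart_eq_sum (a : Cn n → Alt n k) (y v : Cn n) : linPart (fderiv ℝ a y) v
    = ∑ l, coframe (.inl l) v • wirt (.inl l) a y := by
  have hP : ∀ u, linPart (fderiv ℝ a y) (mulI n u) = Complex.I • linPart (fderiv ℝ a y) u := by
    intro u
    ext u'
    simp only [linPart, smul_apply, sub_apply, ContinuousLinearMap.comp_apply, mulI_mulI, map_neg,
      ContinuousAlternatingMap.smul_apply, ContinuousAlternatingMap.sub_apply,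
      ContinuousAlternatingMap.neg_apply, smul_eq_mul]
    linear_combination (2⁻¹ * fderiv ℝ a y (mulI n u) u') * Complex.I_mul_I
  have hsingle : ∀ j, linPart (fderiv ℝ a y) (EuclideanSpace.single j 1) = wirt (.inl j) a y := by
    intro j
    rw [wirt, coordIndex, coordUnit, ← mulI_single]
    rfl
  rw [apply_eq_sum_coframe (linPart (fderiv ℝ a y)) v]
  simp only [← mulI_single, hP, smul_smul, hsingle, Complex.I_mul_I]
  rw [Finset.sum_eq_zero (s := Finset.univ) (f := fun j => (coframe (.inr j) v *
    (2⁻¹ : ℂ)) • (wirt (.inl j) a y + (-1 : ℂ) • wirt (.inl j) a y)), add_zero]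
  · refine Finset.sum_congr rfl fun j _ => ?_
    module
  · intro j _
    module

lemma coordDel_eq_sum (a : Cn n → Alt n k) (y : Cn n) :
    coordDel a y = ∑ l, extMul (coframe (.inl l)) (wirt (.inl l) a y) :=
  alternatizeUncurryFin_sum_smulRight _ _ _ _ fun v => linPart_eq_sum a y v

lemma coordDelBar_eq_sum (a : Cn n → Alt n k) (y : Cn n) :
    coordDelBar a y = ∑ l, extMul (coframe (.inr l)) (wirt (.inr l) a y) := by
  refine alternatizeUncurryFin_sum_smulRight _ _ _ _ fun v => ?_
  have h : antilinPart (fderiv ℝ a y) v = fderiv ℝ a y v - linPart (fderiv ℝ a y) v := by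
    simp only [linPart, antilinPart, smul_apply, sub_apply, add_apply]
    module
  rw [h, linPart_eq_sum, fderiv_eq_sum_wirt, Fintype.sum_sum_type, add_sub_cancel_left]

lemma extDeriv_eq_sum (a : Cn n → Alt n k) (y : Cn n) :
    extDeriv a y = ∑ c, extMul (coframe c) (wirt c a y) :=
  alternatizeUncurryFin_sum_smulRight _ _ _ _ fun v => fderiv_eq_sum_wirt a y v

end CoordinateOperators

/-! ### Smoothness of form-valued maps -/

section SmoothForms

variable {n k : ℕ} {E : Type*} [NormedAddCommGroup E] [NormedSpace ℝ E] {s : Set E} {p : E}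

/-- A form-valued map is smooth if its values on the vectors of the real basis are. -/
lemma contDiffWithinAt_alt {a : E → Alt n k}
    (h : ∀ b : Fin k → Fin (n + n), ContDiffWithinAt ℝ ∞ (fun z => a z fun i => realBasis n (b i)) s p) :
    ContDiffWithinAt ℝ ∞ a s p := by
  let f : Alt n k →ₗ[ℝ] ((Fin k → Fin (n + n)) → ℂ) :=
    { toFun := fun α b => α fun i => realBasis n (b i)
      map_add' := fun _ _ => rfl
      map_smul' := fun _ _ => rfl }
  have hf : Function.Injective f := fun α β h => ext_realBasis fun b => congrFun h b
  obtain ⟨g, hg⟩ := f.exists_leftInverse_of_injective (LinearMap.ker_eq_bot.2 hf)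
  have h1 : ContDiffWithinAt ℝ ∞ (fun z => f (a z)) s p := contDiffWithinAt_pi.2 h
  have h2 : a = fun z => g.toContinuousLinearMap (f (a z)) := by
    funext z
    exact (LinearMap.congr_fun hg (a z)).symm
  rw [h2]
  exact g.toContinuousLinearMap.contDiff.contDiffAt.comp_contDiffWithinAt p h1

lemma _root_.ContDiffWithinAt.alt_apply {a : E → Alt n k} (ha : ContDiffWithinAt ℝ ∞ a s p)
    (v : Fin k → Cn n) : ContDiffWithinAt ℝ ∞ (fun z => a z v) s p :=
  (ContinuousAlternatingMap.apply ℝ (Cn n) ℂ v).contDiff.contDiffAt.comp_contDiffWithinAt p ha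

lemma alt_apply_eq_sum (α : Alt n k) (v : Fin k → Cn n) :
    α v = ∑ c : Fin k → Fin (n + n), (∏ i, (stdRealBasis n).coord (c i) (v i)) •
      α fun i => realBasis n (c i) := by
  have h : v = fun i => ∑ c, (stdRealBasis n).coord c (v i) • realBasis n c := by
    funext i
    simpa using ((stdRealBasis n).sum_repr (v i)).symm
  have h2 := α.toMultilinearMap.map_sum fun i c => (stdRealBasis n).coord c (v i) • realBasis n c
  conv_lhs => rw [h]
  refine h2.trans (Finset.sum_congr rfl fun c _ => ?_)
  exact α.toMultilinearMap.map_smul_univ _ _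

lemma _root_.ContDiffWithinAt.alt_comp {a : E → Alt n k} {A : E → Cn n →L[ℝ] Cn n}
    (ha : ContDiffWithinAt ℝ ∞ a s p) (hA : ContDiffWithinAt ℝ ∞ A s p) :
    ContDiffWithinAt ℝ ∞ (fun z => (a z).compContinuousLinearMap (A z)) s p := by
  refine contDiffWithinAt_alt fun b => ?_
  have h : (fun z => (a z).compContinuousLinearMap (A z) fun i => realBasis n (b i))
      = fun z => ∑ c : Fin k → Fin (n + n), (∏ i, (stdRealBasis n).coord (c i)
          (A z (realBasis n (b i)))) • a z fun i => realBasis n (c i) :=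
    funext fun z => alt_apply_eq_sum (a z) _
  rw [h]
  refine ContDiffWithinAt.sum fun c _ => ContDiffWithinAt.fun_smul ?_ (ha.alt_apply _)
  refine contDiffWithinAt_prod fun i _ => ?_
  have h2 := ((stdRealBasis n).coord (c i)).toContinuousLinearMap.contDiff (n := ∞)
  exact h2.contDiffAt.comp_contDiffWithinAt p (hA.clm_apply contDiffWithinAt_const)

end SmoothForms

/-! ### Pullback of forms by holomorphic maps -/

section Pullback

variable {n k : ℕ} {τ : Cn n → Cn n} {y : Cn n}

/-- The pullback of a form on `ℂⁿ`. -/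
def pullForm (τ : Cn n → Cn n) (a : Cn n → Alt n k) (y : Cn n) : Alt n k :=
  (a (τ y)).compContinuousLinearMap (fderiv ℝ τ y)

lemma _root_.ContDiffAt.fderiv_mulI (hτ : ContDiffAt ℂ ∞ τ y) (v : Cn n) :
    fderiv ℝ τ y (mulI n v) = mulI n (fderiv ℝ τ y v) := by
  have h : fderiv ℝ τ y = (fderiv ℂ τ y).restrictScalars ℝ :=
    ((hτ.differentiableAt (by simp)).hasFDerivAt.restrictScalars ℝ).fderiv
  rw [h]
  exact (fderiv ℂ τ y).map_smul Complex.I v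

lemma _root_.ContDiffAt.eventually_fderiv_mulI (hτ : ContDiffAt ℂ ∞ τ y) :
    ∀ᶠ z in nhds y, ∀ v, fderiv ℝ τ z (mulI n v) = mulI n (fderiv ℝ τ z v) := by
  have h1 : ContDiffAt ℂ 1 τ y := hτ.of_le (by simp)
  filter_upwards [h1.eventually (by simp)] with z hz v
  have h : fderiv ℝ τ z = (fderiv ℂ τ z).restrictScalars ℝ :=
    ((hz.differentiableAt (by simp)).hasFDerivAt.restrictScalars ℝ).fderiv
  rw [h]
  exact (fderiv ℂ τ z).map_smul Complex.I v

lemma _root_.ContDiffAt.differentiableAt_fderiv (hτ : ContDiffAt ℂ ∞ τ y) :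
    DifferentiableAt ℝ (fderiv ℝ τ) y :=
  ((hτ.restrict_scalars ℝ).fderiv_right (m := ∞) (by simp)).differentiableAt (by simp)

lemma fderiv_fderiv_mulI (hτ : ContDiffAt ℂ ∞ τ y) (u v : Cn n) :
    fderiv ℝ (fderiv ℝ τ) y u (mulI n v) = mulI n (fderiv ℝ (fderiv ℝ τ) y u v) := by
  have h := hτ.differentiableAt_fderiv.hasFDerivAt
  have h1 : HasFDerivAt (fun z => fderiv ℝ τ z (mulI n v))
      ((ContinuousLinearMap.apply ℝ (Cn n) (mulI n v)).comp (fderiv ℝ (fderiv ℝ τ) y)) y :=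
    (ContinuousLinearMap.apply ℝ (Cn n) (mulI n v)).hasFDerivAt.comp y h
  have h2 : HasFDerivAt (fun z => mulI n (fderiv ℝ τ z v))
      (((mulI n).comp (ContinuousLinearMap.apply ℝ (Cn n) v)).comp (fderiv ℝ (fderiv ℝ τ) y)) y :=
    ((mulI n).comp (ContinuousLinearMap.apply ℝ (Cn n) v)).hasFDerivAt.comp y h
  have h3 := h2.congr_of_eventuallyEq (hτ.eventually_fderiv_mulI.mono fun z hz => hz v)
  exact congrArg (fun L : Cn n →L[ℝ] Cn n => L u) (h1.unique h3)

/-- The alternatization of `L + t L ∘ J`, where `L` is the derivative of a form, is natural under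
holomorphic maps: the second derivative `D²τ` of the map enters through `D²τ` and `D²τ ∘ J`, which
are both symmetric, and so it does not contribute. -/
lemma alternatize_fderiv_pullForm (t : ℂ) {a : Cn n → Alt n k} (ha : DifferentiableAt ℝ a (τ y))
    (hτ : ContDiffAt ℂ ∞ τ y) :
    ContinuousAlternatingMap.alternatizeUncurryFin
      (fderiv ℝ (pullForm τ a) y + t • (fderiv ℝ (pullForm τ a) y).comp (mulI n))
    = (ContinuousAlternatingMap.alternatizeUncurryFin
      (fderiv ℝ a (τ y) + t • (fderiv ℝ a (τ y)).comp (mulI n))).compContinuousLinearMap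
        (fderiv ℝ τ y) := by
  have hd : DifferentiableAt ℝ τ y := (hτ.restrict_scalars ℝ).differentiableAt (by simp)
  have h1 : fderiv ℝ (pullForm τ a) y
      = (ContinuousAlternatingMap.compContinuousLinearMapCLM (fderiv ℝ τ y)).comp
          ((fderiv ℝ a (τ y)).comp (fderiv ℝ τ y))
        + ((a (τ y)).fderivCompContinuousLinearMap (fderiv ℝ τ y)).comp
          (fderiv ℝ (fderiv ℝ τ) y) := by
    have := fderiv_continuousAlternatingMapCompContinuousLinearMap (𝕜 := ℝ)
      (f := fun z => a (τ z)) (g := fderiv ℝ τ) (x := y) (ha.comp y hd) hτ.differentiableAt_fderiv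
    rw [fderiv_fun_comp y ha hd] at this
    exact this
  have hsymm : ∀ u v, fderiv ℝ (fderiv ℝ τ) y u v = fderiv ℝ (fderiv ℝ τ) y v u :=
    (hτ.restrict_scalars ℝ).isSymmSndFDerivAt
      (by simpa using WithTop.coe_le_coe.2 (le_top (a := (2 : ℕ∞))))
  have h2 : fderiv ℝ (pullForm τ a) y + t • (fderiv ℝ (pullForm τ a) y).comp (mulI n)
      = (ContinuousAlternatingMap.compContinuousLinearMapCLM (fderiv ℝ τ y)).comp
          ((fderiv ℝ a (τ y) + t • (fderiv ℝ a (τ y)).comp (mulI n)).comp (fderiv ℝ τ y))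
        + (((a (τ y)).fderivCompContinuousLinearMap (fderiv ℝ τ y)).comp
            (fderiv ℝ (fderiv ℝ τ) y)
          + t • ((a (τ y)).fderivCompContinuousLinearMap (fderiv ℝ τ y)).comp
            ((fderiv ℝ (fderiv ℝ τ) y).comp (mulI n))) := by
    rw [h1]
    ext u v
    simp [hτ.fderiv_mulI]
    ring
  rw [h2, ContinuousAlternatingMap.alternatizeUncurryFin_add,
    ContinuousAlternatingMap.alternatizeUncurryFin_add,
    ContinuousAlternatingMap.alternatizeUncurryFin_smul,
    ContinuousAlternatingMap.alternatizeUncurryFin_fderivCompContinuousLinearMap_eq_zero _ _ hsymm,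
    ContinuousAlternatingMap.alternatizeUncurryFin_fderivCompContinuousLinearMap_eq_zero _ _
      (fun u v => by
        rw [ContinuousLinearMap.comp_apply, ContinuousLinearMap.comp_apply, hsymm,
          fderiv_fderiv_mulI hτ, hsymm (mulI n v), fderiv_fderiv_mulI hτ, hsymm]),
    alt_smul_zero, add_zero, add_zero]
  ext v
  simp only [ContinuousAlternatingMap.alternatizeUncurryFin_apply,
    ContinuousAlternatingMap.compContinuousLinearMap_apply, ContinuousLinearMap.comp_apply,
    ContinuousAlternatingMap.compContinuousLinearMapCLM_apply]
  rfl

lemma coordDel_pullForm {a : Cn n → Alt n k} (ha : DifferentiableAt ℝ a (τ y))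
    (hτ : ContDiffAt ℂ ∞ τ y) :
    coordDel (pullForm τ a) y = (coordDel a (τ y)).compContinuousLinearMap (fderiv ℝ τ y) := by
  have h := alternatize_fderiv_pullForm (-Complex.I) ha hτ
  have h2 : ∀ L : Cn n →L[ℝ] Alt n k, linPart L
      = (2⁻¹ : ℂ) • (L + (-Complex.I) • L.comp (mulI n)) := fun L => by
    rw [linPart]
    congr 1
    module
  rw [coordDel, coordDel, h2, h2, ContinuousAlternatingMap.alternatizeUncurryFin_smul, h,
    ContinuousAlternatingMap.alternatizeUncurryFin_smul]
  rfl

lemma coordDelBar_pullForm {a : Cn n → Alt n k} (ha : DifferentiableAt ℝ a (τ y))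
    (hτ : ContDiffAt ℂ ∞ τ y) :
    coordDelBar (pullForm τ a) y
      = (coordDelBar a (τ y)).compContinuousLinearMap (fderiv ℝ τ y) := by
  have h := alternatize_fderiv_pullForm Complex.I ha hτ
  rw [coordDelBar, coordDelBar, antilinPart, antilinPart,
    ContinuousAlternatingMap.alternatizeUncurryFin_smul, h,
    ContinuousAlternatingMap.alternatizeUncurryFin_smul]
  rfl

lemma _root_.ContDiffAt.pullForm {a : Cn n → Alt n k} (ha : ContDiffAt ℝ ∞ a (τ y))
    (hτ : ContDiffAt ℂ ∞ τ y) : ContDiffAt ℝ ∞ (pullForm τ a) y := by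
  have h1 : ContDiffAt ℝ ∞ (fderiv ℝ τ) y := (hτ.restrict_scalars ℝ).fderiv_right (by simp)
  have h2 : ContDiffAt ℝ ∞ (fun z => a (τ z)) y := ha.comp y (hτ.restrict_scalars ℝ)
  rw [← contDiffWithinAt_univ] at h1 h2 ⊢
  exact h2.alt_comp h1

end Pullback

/-! ### Forms in holomorphic charts -/

section Charts

variable {n k : ℕ} {M : Type*} [TopologicalSpace M] [ChartedSpace (Cn n) M]

/-- The chart change from the chart at `x₁` to the chart at `x₀`. -/
def transition (x₀ x₁ : M) (y : Cn n) : Cn n :=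
  chartAt (Cn n) x₀ ((chartAt (Cn n) x₁).symm y)

lemma transition_self {x₀ : M} {y : Cn n} (hy : y ∈ (chartAt (Cn n) x₀).target) :
    transition x₀ x₀ y = y := (chartAt (Cn n) x₀).right_inv hy

lemma isOpen_overlap (x₀ x₁ : M) : IsOpen ((chartAt (Cn n) x₁).target ∩
    (chartAt (Cn n) x₁).symm ⁻¹' (chartAt (Cn n) x₀).source) :=
  (chartAt (Cn n) x₁).isOpen_inter_preimage_symm (chartAt (Cn n) x₀).open_source

lemma eventually_mem_overlap {x₀ x₁ : M} {y : Cn n} (hy : y ∈ (chartAt (Cn n) x₁).target)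
    (hx : (chartAt (Cn n) x₁).symm y ∈ (chartAt (Cn n) x₀).source) :
    ∀ᶠ z in nhds y, z ∈ (chartAt (Cn n) x₁).target ∧
      (chartAt (Cn n) x₁).symm z ∈ (chartAt (Cn n) x₀).source :=
  (isOpen_overlap x₀ x₁).mem_nhds ⟨hy, hx⟩

lemma transition_transition {x₀ x₁ x₂ : M} {y : Cn n}
    (hx : (chartAt (Cn n) x₂).symm y ∈ (chartAt (Cn n) x₁).source) :
    transition x₀ x₁ (transition x₁ x₂ y) = transition x₀ x₂ y := by
  rw [transition, transition, (chartAt (Cn n) x₁).left_inv hx, transition]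

lemma rep_apply (x₀ : M) (α : M → Alt n k) (y : Cn n) :
    rep x₀ α y = (α ((chartAt (Cn n) x₀).symm y)).compContinuousLinearMap
      (fderiv ℝ (transition ((chartAt (Cn n) x₀).symm y) x₀) y) := rfl

lemma fderiv_transition_self {x₀ : M} {y : Cn n} (hy : y ∈ (chartAt (Cn n) x₀).target) :
    fderiv ℝ (transition x₀ x₀) y = ContinuousLinearMap.id ℝ (Cn n) := by
  have h : transition x₀ x₀ =ᶠ[nhds y] id := by
    filter_upwards [(chartAt (Cn n) x₀).open_target.mem_nhds hy] with z hz
    exact transition_self hz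
  rw [h.fderiv_eq, fderiv_id]

lemma SmoothForm.contDiffAt {α : M → Alt n k} (h : SmoothForm α) {x₀ : M} {y : Cn n}
    (hy : y ∈ (chartAt (Cn n) x₀).target) : ContDiffAt ℝ ∞ (rep x₀ α) y :=
  (h x₀ y hy).contDiffAt ((chartAt (Cn n) x₀).open_target.mem_nhds hy)

lemma rep_congr {α β : M → Alt n k} {x : M} (h : α =ᶠ[nhds x] β) {x₀ : M}
    (hx : x ∈ (chartAt (Cn n) x₀).source) :
    rep x₀ α =ᶠ[nhds (chartAt (Cn n) x₀ x)] rep x₀ β := by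
  have h1 : Filter.Tendsto (chartAt (Cn n) x₀).symm (nhds (chartAt (Cn n) x₀ x)) (nhds x) := by
    have := (chartAt (Cn n) x₀).continuousAt_symm ((chartAt (Cn n) x₀).map_source hx)
    rwa [ContinuousAt, (chartAt (Cn n) x₀).left_inv hx] at this
  filter_upwards [h1.eventually h] with y hy
  rw [rep_apply, rep_apply, hy]

lemma del_eq (α : M → Alt n k) (x : M) : del α x = coordDel (rep x α) (chartAt (Cn n) x x) := rfl

lemma _root_.Filter.EventuallyEq.coordDel_eq {a b : Cn n → Alt n k} {y : Cn n}
    (h : a =ᶠ[nhds y] b) : coordDel a y = coordDel b y := by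
  rw [coordDel, coordDel, h.fderiv_eq]

lemma _root_.Filter.EventuallyEq.coordDelBar_eq {a b : Cn n → Alt n k} {y : Cn n}
    (h : a =ᶠ[nhds y] b) : coordDelBar a y = coordDelBar b y := by
  rw [coordDelBar, coordDelBar, h.fderiv_eq]

lemma _root_.ContDiffAt.coordDel {a : Cn n → Alt n k} {y : Cn n} (h : ContDiffAt ℝ ∞ a y) :
    ContDiffAt ℝ ∞ (coordDel a) y := by
  have h1 : ∀ c, ContDiffAt ℝ ∞ (fun z => extMul (coframe c) (wirt c a z)) y := fun c =>
    ((extMul (coframe c)).toContinuousLinearMap.restrictScalars ℝ).contDiff.contDiffAt.comp y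
      (h.wirt c)
  rw [show TypeIIB.coordDel a = fun z => ∑ l, extMul (coframe (.inl l)) (wirt (.inl l) a z) from
    funext fun z => coordDel_eq_sum a z]
  exact ContDiffAt.sum fun l _ => h1 _

lemma _root_.ContDiffAt.coordDelBar {a : Cn n → Alt n k} {y : Cn n} (h : ContDiffAt ℝ ∞ a y) :
    ContDiffAt ℝ ∞ (coordDelBar a) y := by
  have h1 : ∀ c, ContDiffAt ℝ ∞ (fun z => extMul (coframe c) (wirt c a z)) y := fun c =>
    ((extMul (coframe c)).toContinuousLinearMap.restrictScalars ℝ).contDiff.contDiffAt.comp y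
      (h.wirt c)
  rw [show TypeIIB.coordDelBar a = fun z => ∑ l, extMul (coframe (.inr l)) (wirt (.inr l) a z) from
    funext fun z => coordDelBar_eq_sum a z]
  exact ContDiffAt.sum fun l _ => h1 _

lemma rep_self (α : M → Alt n k) (x : M) : rep x α (chartAt (Cn n) x x) = α x := by
  have hx : (chartAt (Cn n) x).symm (chartAt (Cn n) x x) = x :=
    (chartAt (Cn n) x).left_inv (mem_chart_source _ _)
  rw [rep_apply, hx, fderiv_transition_self (mem_chart_target _ _)]
  rfl

/-- A form is smooth at a point `x` if its representative in the preferred chart at `x` is. -/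
def SmoothFormAt (α : M → Alt n k) (x : M) : Prop :=
  ContDiffAt ℝ ∞ (rep x α) (chartAt (Cn n) x x)

lemma SmoothFormAt.congr {α β : M → Alt n k} {x : M} (h : SmoothFormAt α x)
    (hαβ : β =ᶠ[nhds x] α) : SmoothFormAt β x :=
  ContDiffAt.congr_of_eventuallyEq h (rep_congr hαβ (mem_chart_source _ _))

variable [IsManifold 𝓘(ℂ, Cn n) ∞ M]

lemma contDiffAt_transition {x₀ x₁ : M} {y : Cn n} (hy : y ∈ (chartAt (Cn n) x₁).target)
    (hx : (chartAt (Cn n) x₁).symm y ∈ (chartAt (Cn n) x₀).source) :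
    ContDiffAt ℂ ∞ (transition x₀ x₁) y := by
  have h := HasGroupoid.compatible (G := contDiffGroupoid ∞ 𝓘(ℂ, Cn n))
    (chart_mem_atlas (Cn n) x₁) (chart_mem_atlas (Cn n) x₀)
  rw [contDiffGroupoid, mem_groupoid_of_pregroupoid, contDiffPregroupoid] at h
  have h2 : ContDiffOn ℂ ∞ (transition x₀ x₁) ((chartAt (Cn n) x₁).target ∩
      (chartAt (Cn n) x₁).symm ⁻¹' (chartAt (Cn n) x₀).source) := by
    have h3 := h.1
    simp at h3
    exact h3
  exact (h2 y ⟨hy, hx⟩).contDiffAt ((isOpen_overlap x₀ x₁).mem_nhds ⟨hy, hx⟩)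

lemma fderiv_transition_comp {x₀ x₁ x₂ : M} {y : Cn n} (hy : y ∈ (chartAt (Cn n) x₂).target)
    (hx : (chartAt (Cn n) x₂).symm y ∈ (chartAt (Cn n) x₁).source)
    (hx' : (chartAt (Cn n) x₂).symm y ∈ (chartAt (Cn n) x₀).source) :
    (fderiv ℝ (transition x₀ x₁) (transition x₁ x₂ y)).comp (fderiv ℝ (transition x₁ x₂) y)
      = fderiv ℝ (transition x₀ x₂) y := by
  have h1 : DifferentiableAt ℝ (transition x₁ x₂) y :=
    ((contDiffAt_transition hy hx).restrict_scalars ℝ).differentiableAt (by simp)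
  have h2 : DifferentiableAt ℝ (transition x₀ x₁) (transition x₁ x₂ y) := by
    refine ((contDiffAt_transition ((chartAt (Cn n) x₁).map_source hx) ?_).restrict_scalars
      ℝ).differentiableAt (by simp)
    rwa [(chartAt (Cn n) x₁).left_inv hx]
  rw [← fderiv_comp y h2 h1]
  refine Filter.EventuallyEq.fderiv_eq ?_
  filter_upwards [eventually_mem_overlap hy hx] with z hz
  exact transition_transition hz.2

lemma fderiv_transition_comp_symm {x₀ x₁ : M} {y : Cn n} (hy : y ∈ (chartAt (Cn n) x₁).target)
    (hx : (chartAt (Cn n) x₁).symm y ∈ (chartAt (Cn n) x₀).source) (v : Cn n) :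
    fderiv ℝ (transition x₁ x₀) (transition x₀ x₁ y) (fderiv ℝ (transition x₀ x₁) y v) = v := by
  have h := fderiv_transition_comp (x₀ := x₁) hy hx ((chartAt (Cn n) x₁).map_target hy)
  rw [fderiv_transition_self hy] at h
  exact congrArg (fun L : Cn n →L[ℝ] Cn n => L v) h

/-- The representatives of a form in different charts are pullbacks of each other. -/
lemma rep_eq_pullForm (α : M → Alt n k) {x₀ x₁ : M} {y : Cn n}
    (hy : y ∈ (chartAt (Cn n) x₁).target)
    (hx : (chartAt (Cn n) x₁).symm y ∈ (chartAt (Cn n) x₀).source) :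
    rep x₁ α y = pullForm (transition x₀ x₁) (rep x₀ α) y := by
  have hp : (chartAt (Cn n) x₀).symm (transition x₀ x₁ y) = (chartAt (Cn n) x₁).symm y :=
    (chartAt (Cn n) x₀).left_inv hx
  rw [pullForm, rep_apply, rep_apply, hp, ← fderiv_transition_comp hy hx (mem_chart_source _ _)]
  rfl

lemma eventually_rep_eq_pullForm (α : M → Alt n k) {x₀ x₁ : M} {y : Cn n}
    (hy : y ∈ (chartAt (Cn n) x₁).target)
    (hx : (chartAt (Cn n) x₁).symm y ∈ (chartAt (Cn n) x₀).source) :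
    rep x₁ α =ᶠ[nhds y] pullForm (transition x₀ x₁) (rep x₀ α) :=
  (eventually_mem_overlap hy hx).mono fun _ hz => rep_eq_pullForm α hz.1 hz.2

lemma contDiffAt_rep_of_mem {α : M → Alt n k} {x₀ x₁ x : M}
    (hx₀ : x ∈ (chartAt (Cn n) x₀).source) (hx₁ : x ∈ (chartAt (Cn n) x₁).source)
    (h : ContDiffAt ℝ ∞ (rep x₀ α) (chartAt (Cn n) x₀ x)) :
    ContDiffAt ℝ ∞ (rep x₁ α) (chartAt (Cn n) x₁ x) := by
  have hs := (chartAt (Cn n) x₁).left_inv hx₁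
  have hy := (chartAt (Cn n) x₁).map_source hx₁
  have hx₀' : (chartAt (Cn n) x₁).symm (chartAt (Cn n) x₁ x) ∈ (chartAt (Cn n) x₀).source := by
    rwa [hs]
  refine ContDiffAt.congr_of_eventuallyEq ?_ (eventually_rep_eq_pullForm α hy hx₀')
  refine ContDiffAt.pullForm ?_ (contDiffAt_transition hy hx₀')
  rwa [transition, hs]

lemma SmoothFormAt.contDiffAt {α : M → Alt n k} {x₀ x : M} (h : SmoothFormAt α x)
    (hx : x ∈ (chartAt (Cn n) x₀).source) :
    ContDiffAt ℝ ∞ (rep x₀ α) (chartAt (Cn n) x₀ x) :=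
  contDiffAt_rep_of_mem (mem_chart_source _ _) hx h

lemma smoothFormAt_of_contDiffAt {α : M → Alt n k} {x₀ x : M}
    (hx : x ∈ (chartAt (Cn n) x₀).source)
    (h : ContDiffAt ℝ ∞ (rep x₀ α) (chartAt (Cn n) x₀ x)) : SmoothFormAt α x :=
  contDiffAt_rep_of_mem hx (mem_chart_source _ _) h

lemma smoothForm_iff {α : M → Alt n k} : SmoothForm α ↔ ∀ x, SmoothFormAt α x := by
  refine ⟨fun h x => h.contDiffAt (mem_chart_target _ _), fun h x₀ y hy => ?_⟩
  have := (h ((chartAt (Cn n) x₀).symm y)).contDiffAt ((chartAt (Cn n) x₀).map_target hy)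
  rw [(chartAt (Cn n) x₀).right_inv hy] at this
  exact this.contDiffWithinAt

/-- The operator `∂` may be computed in any chart. -/
lemma rep_del {α : M → Alt n k} {x₀ : M} {y : Cn n} (hy : y ∈ (chartAt (Cn n) x₀).target)
    (hα : SmoothFormAt α ((chartAt (Cn n) x₀).symm y)) :
    rep x₀ (del α) y = coordDel (rep x₀ α) y := by
  have hx := mem_chart_source (Cn n) ((chartAt (Cn n) x₀).symm y)
  rw [(eventually_rep_eq_pullForm α hy hx).coordDel_eq,
    coordDel_pullForm (hα.differentiableAt (by simp)) (contDiffAt_transition hy hx)]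
  rfl

/-- The operator `∂̄` may be computed in any chart. -/
lemma rep_delBar {α : M → Alt n k} {x₀ : M} {y : Cn n} (hy : y ∈ (chartAt (Cn n) x₀).target)
    (hα : SmoothFormAt α ((chartAt (Cn n) x₀).symm y)) :
    rep x₀ (delBar α) y = coordDelBar (rep x₀ α) y := by
  have hx := mem_chart_source (Cn n) ((chartAt (Cn n) x₀).symm y)
  rw [(eventually_rep_eq_pullForm α hy hx).coordDelBar_eq,
    coordDelBar_pullForm (hα.differentiableAt (by simp)) (contDiffAt_transition hy hx)]
  rfl

lemma SmoothForm.smoothFormAt {α : M → Alt n k} (h : SmoothForm α) (x : M) : SmoothFormAt α x :=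
  smoothForm_iff.1 h x

lemma SmoothForm.eventually_rep_del {α : M → Alt n k} (h : SmoothForm α) {x₀ : M} {y : Cn n}
    (hy : y ∈ (chartAt (Cn n) x₀).target) :
    rep x₀ (del α) =ᶠ[nhds y] coordDel (rep x₀ α) := by
  filter_upwards [(chartAt (Cn n) x₀).open_target.mem_nhds hy] with z hz
  exact rep_del hz (h.smoothFormAt _)

lemma SmoothForm.eventually_rep_delBar {α : M → Alt n k} (h : SmoothForm α) {x₀ : M} {y : Cn n}
    (hy : y ∈ (chartAt (Cn n) x₀).target) :
    rep x₀ (delBar α) =ᶠ[nhds y] coordDelBar (rep x₀ α) := by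
  filter_upwards [(chartAt (Cn n) x₀).open_target.mem_nhds hy] with z hz
  exact rep_delBar hz (h.smoothFormAt _)

lemma SmoothForm.del {α : M → Alt n k} (h : SmoothForm α) : SmoothForm (del α) := fun _ _ hy =>
  ((h.contDiffAt hy).coordDel.congr_of_eventuallyEq (h.eventually_rep_del hy)).contDiffWithinAt

lemma SmoothForm.delBar {α : M → Alt n k} (h : SmoothForm α) : SmoothForm (delBar α) :=
  fun _ _ hy => ((h.contDiffAt hy).coordDelBar.congr_of_eventuallyEq
    (h.eventually_rep_delBar hy)).contDiffWithinAt

/-- The pointwise Hermitian product may be computed in any chart. -/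
lemma hermInner_rep (w : M → Alt n 2) (α β : M → Alt n k) {x₀ : M} {y : Cn n}
    (hy : y ∈ (chartAt (Cn n) x₀).target) :
    hermInner (rep x₀ w y) (rep x₀ α y) (rep x₀ β y)
      = hermInner (w ((chartAt (Cn n) x₀).symm y)) (α ((chartAt (Cn n) x₀).symm y))
        (β ((chartAt (Cn n) x₀).symm y)) := by
  have hx := mem_chart_source (Cn n) ((chartAt (Cn n) x₀).symm y)
  have hx₀ := (chartAt (Cn n) x₀).map_target hy
  refine hermInner_comp (w ((chartAt (Cn n) x₀).symm y)) (B := fderiv ℝ (transition x₀ ((chartAt (Cn n) x₀).symm y))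
    (transition ((chartAt (Cn n) x₀).symm y) x₀ y)) (fun v => ?_)
    (fun v => (contDiffAt_transition hy hx).fderiv_mulI v) _ _
  have hs := (chartAt (Cn n) ((chartAt (Cn n) x₀).symm y)).left_inv hx
  have h := fderiv_transition_comp_symm (x₀ := x₀) (x₁ := (chartAt (Cn n) x₀).symm y)
    (y := transition ((chartAt (Cn n) x₀).symm y) x₀ y) (mem_chart_target _ _)
    (by rw [transition, hs]; exact hx₀) v
  rwa [transition_transition hx, transition_self hy] at h

end Charts

/-! ### Smooth dependence of the pointwise operations -/

section SmoothOperations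

variable {n k l : ℕ} {E : Type*} [NormedAddCommGroup E] [NormedSpace ℝ E] {s : Set E} {p : E}

section Matrices

variable {ι 𝕜 : Type*} [Fintype ι] [DecidableEq ι] [NormedField 𝕜] [NormedAlgebra ℝ 𝕜]

lemma contDiffWithinAt_det {A : E → Matrix ι ι 𝕜}
    (h : ∀ i j, ContDiffWithinAt ℝ ∞ (fun z => A z i j) s p) :
    ContDiffWithinAt ℝ ∞ (fun z => (A z).det) s p := by
  simp only [Matrix.det_apply']
  exact ContDiffWithinAt.sum fun σ _ => contDiffWithinAt_const.mul
    (contDiffWithinAt_prod fun i _ => h _ _)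

lemma contDiffWithinAt_matrix_inv {A : E → Matrix ι ι 𝕜}
    (h : ∀ i j, ContDiffWithinAt ℝ ∞ (fun z => A z i j) s p) (h0 : (A p).det ≠ 0) (i j : ι) :
    ContDiffWithinAt ℝ ∞ (fun z => (A z)⁻¹ i j) s p := by
  have h1 : (fun z => (A z)⁻¹ i j)
      = fun z => ((A z).det)⁻¹ * ((A z).updateRow j (Pi.single i 1)).det := by
    funext z
    rw [Matrix.inv_def, Matrix.smul_apply, smul_eq_mul, Matrix.adjugate_apply,
      Ring.inverse_eq_inv']
  rw [h1]
  refine ((contDiffWithinAt_det h).inv h0).mul (contDiffWithinAt_det fun a b => ?_)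
  by_cases ha : a = j
  · subst ha
    simp only [Matrix.updateRow_self]
    exact contDiffWithinAt_const
  · simp only [Matrix.updateRow_ne ha]
    exact h a b

end Matrices

variable {w : E → Alt n 2}

lemma _root_.ContDiffWithinAt.hMat (hw : ContDiffWithinAt ℝ ∞ w s p) (j k : Fin n) :
    ContDiffWithinAt ℝ ∞ (fun z => hMat (w z) j k) s p :=
  contDiffWithinAt_const.mul ((hw.alt_apply _).sub (contDiffWithinAt_const.mul (hw.alt_apply _)))

lemma _root_.ContDiffWithinAt.hMat_inv (hw : ContDiffWithinAt ℝ ∞ w s p)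
    (hp : IsHermitianForm (w p)) (j k : Fin n) :
    ContDiffWithinAt ℝ ∞ (fun z => (TypeIIB.hMat (w z))⁻¹ j k) s p :=
  contDiffWithinAt_matrix_inv (fun i j => hw.hMat i j) hp.isUnit_det.ne_zero j k

lemma _root_.ContDiffWithinAt.conj {f : E → ℂ} (hf : ContDiffWithinAt ℝ ∞ f s p) :
    ContDiffWithinAt ℝ ∞ (fun z => (starRingEnd ℂ) (f z)) s p :=
  Complex.conjCLE.toContinuousLinearMap.contDiff.contDiffAt.comp_contDiffWithinAt p hf

lemma _root_.ContDiffWithinAt.ofReal {f : E → ℝ} (hf : ContDiffWithinAt ℝ ∞ f s p) :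
    ContDiffWithinAt ℝ ∞ (fun z => (f z : ℂ)) s p :=
  Complex.ofRealCLM.contDiff.contDiffAt.comp_contDiffWithinAt p hf

lemma _root_.ContDiffWithinAt.hermInner (hw : ContDiffWithinAt ℝ ∞ w s p)
    (hp : IsHermitianForm (w p)) {α β : E → Alt n k} (hα : ContDiffWithinAt ℝ ∞ α s p)
    (hβ : ContDiffWithinAt ℝ ∞ β s p) :
    ContDiffWithinAt ℝ ∞ (fun z => hermInner (w z) (α z) (β z)) s p := by
  have hg : ∀ a b, ContDiffWithinAt ℝ ∞ (fun z => (gram (w z))⁻¹ a b) s p := fun a b =>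
    contDiffWithinAt_matrix_inv (fun i j =>
      Complex.reCLM.contDiff.contDiffAt.comp_contDiffWithinAt p (hw.alt_apply _))
      hp.isUnit_det_gram.ne_zero a b
  exact contDiffWithinAt_const.mul (ContDiffWithinAt.sum fun a _ => ContDiffWithinAt.sum fun b _ =>
    (((contDiffWithinAt_prod fun i _ => hg _ _).ofReal).mul (hα.alt_apply _)).mul
      (hβ.alt_apply _).conj)

lemma _root_.ContDiffWithinAt.normSq (hw : ContDiffWithinAt ℝ ∞ w s p)
    (hp : IsHermitianForm (w p)) {Θ : E → Alt n n} (hΘ : ContDiffWithinAt ℝ ∞ Θ s p) :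
    ContDiffWithinAt ℝ ∞ (fun z => normSq (w z) (Θ z)) s p :=
  Complex.reCLM.contDiff.contDiffAt.comp_contDiffWithinAt p (hw.hermInner hp hΘ hΘ)

lemma _root_.ContDiffWithinAt.wedge {α : E → Alt n k} {β : E → Alt n l}
    (hα : ContDiffWithinAt ℝ ∞ α s p) (hβ : ContDiffWithinAt ℝ ∞ β s p) :
    ContDiffWithinAt ℝ ∞ (fun z => wedge (α z) (β z)) s p := by
  refine contDiffWithinAt_alt fun b => ?_
  simp only [wedge_apply]
  exact contDiffWithinAt_const.mul (ContDiffWithinAt.sum fun σ _ => contDiffWithinAt_const.mul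
    ((hα.alt_apply _).mul (hβ.alt_apply _)))

lemma _root_.ContDiffWithinAt.wedgePow (hw : ContDiffWithinAt ℝ ∞ w s p) (k : ℕ) :
    ContDiffWithinAt ℝ ∞ (fun z => wedgePow (w z) k) s p := by
  induction k with
  | zero => exact contDiffWithinAt_const
  | succ k ih => exact ih.wedge hw

lemma _root_.ContDiffWithinAt.alt_smul {f : E → ℂ} (hf : ContDiffWithinAt ℝ ∞ f s p)
    {α : E → Alt n k} (hα : ContDiffWithinAt ℝ ∞ α s p) :
    ContDiffWithinAt ℝ ∞ (fun z => f z • α z) s p :=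
  contDiffWithinAt_alt fun _ => hf.mul (hα.alt_apply _)

end SmoothOperations

/-! ### Pullback of the pointwise operations -/

section PullbackOperations

variable {n k l : ℕ}

lemma wedge_comp (α : Alt n k) (β : Alt n l) (A : Cn n →L[ℝ] Cn n) :
    (wedge α β).compContinuousLinearMap A
      = wedge (α.compContinuousLinearMap A) (β.compContinuousLinearMap A) := by
  ext v
  rw [ContinuousAlternatingMap.compContinuousLinearMap_apply, wedge_apply, wedge_apply]
  rfl

lemma wedgePow_comp (w : Alt n 2) (A : Cn n →L[ℝ] Cn n) (k : ℕ) :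
    (wedgePow w k).compContinuousLinearMap A = wedgePow (w.compContinuousLinearMap A) k := by
  induction k with
  | zero => rfl
  | succ k ih => rw [wedgePow, wedge_comp, ih]; rfl

lemma IsHermitianForm.comp {w : Alt n 2} (hw : IsHermitianForm w) {A : Cn n →L[ℝ] Cn n}
    (hA : ∀ v, A (mulI n v) = mulI n (A v)) (hinj : Function.Injective A) :
    IsHermitianForm (w.compContinuousLinearMap A) := by
  have h2 : ∀ u v, w.compContinuousLinearMap A ![u, v] = w ![A u, A v] := fun u v => by
    rw [ContinuousAlternatingMap.compContinuousLinearMap_apply]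
    congr 1
    funext i
    fin_cases i <;> rfl
  refine ⟨?_, fun u v => ?_, fun v hv => ?_⟩
  · conv_rhs => rw [← hw.real]
    rfl
  · rw [h2, h2, hA, hA, hw.type_one_one]
  · rw [h2, hA]
    exact hw.pos _ fun h => hv (hinj (by rw [h, map_zero]))

lemma IsTypeNZero.comp {Θ : Alt n n} (h : IsTypeNZero Θ) {A : Cn n →L[ℝ] Cn n}
    (hA : ∀ v, A (mulI n v) = mulI n (A v)) : IsTypeNZero (Θ.compContinuousLinearMap A) := by
  intro v i
  rw [ContinuousAlternatingMap.compContinuousLinearMap_apply,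
    ContinuousAlternatingMap.compContinuousLinearMap_apply, Function.comp_update, hA]
  exact h (A ∘ v) i

lemma comp_ne_zero {Θ : Alt n k} (h : Θ ≠ 0) {A B : Cn n →L[ℝ] Cn n} (hAB : ∀ v, A (B v) = v) :
    Θ.compContinuousLinearMap A ≠ 0 := by
  intro h0
  apply h
  ext v
  have := congrArg (fun a : Alt n k => a fun i => B (v i)) h0
  simpa [Function.comp_def, hAB] using this

end PullbackOperations

/-! ### Metrics and volume forms in charts -/

section ChartData

variable {n k : ℕ} {M : Type*} [TopologicalSpace M] [ChartedSpace (Cn n) M]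
  {w : M → Alt n 2} {Θ : M → Alt n n} {x₀ : M} {y : Cn n}

lemma IsHermitianMetric.isHermitianForm (hw : IsHermitianMetric w) (x : M) :
    IsHermitianForm (w x) := ⟨hw.real x, hw.type_one_one x, hw.pos x⟩

lemma IsHolomorphicVolumeForm.isTypeNZero (hΘ : IsHolomorphicVolumeForm Θ) (x : M) :
    IsTypeNZero (Θ x) := hΘ.type_n_zero x

lemma rep_wedgePow (w : M → Alt n 2) (k : ℕ) (x₀ : M) (y : Cn n) :
    rep x₀ (fun x => wedgePow (w x) k) y = wedgePow (rep x₀ w y) k :=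
  wedgePow_comp _ _ _

lemma rep_volForm (Θ : M → Alt n n) (x₀ : M) (y : Cn n) : rep x₀ (volForm Θ) y
    = Complex.I ^ (n ^ 2) • wedge (rep x₀ Θ y) (conjAlt (rep x₀ Θ y)) := by
  have h := wedge_comp (Θ ((chartAt (Cn n) x₀).symm y))
    (conjAlt (Θ ((chartAt (Cn n) x₀).symm y)))
    (fderiv ℝ (transition ((chartAt (Cn n) x₀).symm y) x₀) y)
  exact congrArg (fun a => Complex.I ^ (n ^ 2) • a) h

variable [IsManifold 𝓘(ℂ, Cn n) ∞ M]

lemma fderiv_transition_center_mulI (hy : y ∈ (chartAt (Cn n) x₀).target) (v : Cn n) :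
    fderiv ℝ (transition ((chartAt (Cn n) x₀).symm y) x₀) y (mulI n v)
      = mulI n (fderiv ℝ (transition ((chartAt (Cn n) x₀).symm y) x₀) y v) :=
  (contDiffAt_transition hy (mem_chart_source _ _)).fderiv_mulI v

lemma exists_rightInverse_fderiv_transition (hy : y ∈ (chartAt (Cn n) x₀).target) :
    ∃ B : Cn n →L[ℝ] Cn n, ∀ v,
      fderiv ℝ (transition ((chartAt (Cn n) x₀).symm y) x₀) y (B v) = v := by
  have hx := mem_chart_source (Cn n) ((chartAt (Cn n) x₀).symm y)
  have hx₀ := (chartAt (Cn n) x₀).map_target hy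
  refine ⟨fderiv ℝ (transition x₀ ((chartAt (Cn n) x₀).symm y))
    (transition ((chartAt (Cn n) x₀).symm y) x₀ y), fun v => ?_⟩
  have hs := (chartAt (Cn n) ((chartAt (Cn n) x₀).symm y)).left_inv hx
  have h := fderiv_transition_comp_symm (x₀ := x₀) (x₁ := (chartAt (Cn n) x₀).symm y)
    (y := transition ((chartAt (Cn n) x₀).symm y) x₀ y) (mem_chart_target _ _)
    (by rw [transition, hs]; exact hx₀) v
  rwa [transition_transition hx, transition_self hy] at h

lemma IsHermitianMetric.rep (hw : IsHermitianMetric w) (hy : y ∈ (chartAt (Cn n) x₀).target) :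
    IsHermitianForm (rep x₀ w y) :=
  (hw.isHermitianForm _).comp (fderiv_transition_center_mulI hy)
    (Function.LeftInverse.injective (fderiv_transition_comp_symm hy (mem_chart_source _ _)))

lemma IsHolomorphicVolumeForm.isTypeNZero_rep (hΘ : IsHolomorphicVolumeForm Θ)
    (hy : y ∈ (chartAt (Cn n) x₀).target) : IsTypeNZero (rep x₀ Θ y) :=
  (hΘ.isTypeNZero _).comp (fderiv_transition_center_mulI hy)

lemma IsHolomorphicVolumeForm.rep_ne_zero (hΘ : IsHolomorphicVolumeForm Θ)
    (hy : y ∈ (chartAt (Cn n) x₀).target) : rep x₀ Θ y ≠ 0 := by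
  obtain ⟨B, hB⟩ := exists_rightInverse_fderiv_transition hy
  exact comp_ne_zero (hΘ.ne_zero _) hB

lemma IsHolomorphicVolumeForm.volCoeff_ne_zero (hΘ : IsHolomorphicVolumeForm Θ)
    (hy : y ∈ (chartAt (Cn n) x₀).target) : volCoeff (rep x₀ Θ y) ≠ 0 := by
  intro h
  apply hΘ.rep_ne_zero hy
  rw [(hΘ.isTypeNZero_rep hy).eq_smul_extWord, h]
  module

lemma normSq_rep (w : M → Alt n 2) (Θ : M → Alt n n) (hy : y ∈ (chartAt (Cn n) x₀).target) :
    normSq (w ((chartAt (Cn n) x₀).symm y)) (Θ ((chartAt (Cn n) x₀).symm y))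
      = normSq (rep x₀ w y) (rep x₀ Θ y) := by
  rw [normSq, normSq, hermInner_rep w Θ Θ hy]

lemma rep_weightedPow (w : M → Alt n 2) (Θ : M → Alt n n) (k : ℕ)
    (hy : y ∈ (chartAt (Cn n) x₀).target) : rep x₀ (weightedPow w Θ k) y
      = normSq (rep x₀ w y) (rep x₀ Θ y) • wedgePow (rep x₀ w y) k := by
  rw [← normSq_rep w Θ hy, ← rep_wedgePow]
  rfl

/-- The density of the volume form in a chart. -/
def volDensity (Θ : M → Alt n n) (x₀ : M) (y : Cn n) : ℝ :=
  ‖rep x₀ (volForm Θ) y (realBasis n)‖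

lemma IsHolomorphicVolumeForm.volDensity_eq (hΘ : IsHolomorphicVolumeForm Θ)
    (hy : y ∈ (chartAt (Cn n) x₀).target) :
    volDensity Θ x₀ y = volConst n * Complex.normSq (volCoeff (rep x₀ Θ y)) := by
  rw [volDensity, rep_volForm, norm_volForm_apply (hΘ.isTypeNZero_rep hy)]

lemma IsHolomorphicVolumeForm.volDensity_pos (hΘ : IsHolomorphicVolumeForm Θ)
    (hy : y ∈ (chartAt (Cn n) x₀).target) : 0 < volDensity Θ x₀ y := by
  rw [hΘ.volDensity_eq hy]
  exact mul_pos volConst_pos (Complex.normSq_pos.2 (hΘ.volCoeff_ne_zero hy))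

lemma IsHolomorphicVolumeForm.contDiffAt_volDensity (hΘ : IsHolomorphicVolumeForm Θ)
    (hy : y ∈ (chartAt (Cn n) x₀).target) : ContDiffAt ℝ ∞ (volDensity Θ x₀) y := by
  have h : volDensity Θ x₀ =ᶠ[nhds y]
      fun z => volConst n * ((volCoeff (rep x₀ Θ z)).re * (volCoeff (rep x₀ Θ z)).re
        + (volCoeff (rep x₀ Θ z)).im * (volCoeff (rep x₀ Θ z)).im) := by
    filter_upwards [(chartAt (Cn n) x₀).open_target.mem_nhds hy] with z hz
    rw [hΘ.volDensity_eq hz, Complex.normSq_apply]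
  refine ContDiffAt.congr_of_eventuallyEq ?_ h
  have h1 : ContDiffAt ℝ ∞ (fun z => volCoeff (rep x₀ Θ z)) y := by
    have := hΘ.smooth.contDiffAt hy
    rw [← contDiffWithinAt_univ] at this ⊢
    exact this.alt_apply _
  have hre := Complex.reCLM.contDiff.contDiffAt.comp y h1
  have him := Complex.imCLM.contDiff.contDiffAt.comp y h1
  exact contDiffAt_const.mul ((hre.mul hre).add (him.mul him))

/-- `‖Ω‖²_ω det(g)` is the volume density, up to a constant. -/
lemma volConst_mul_normSq_mul_det (hw : IsHermitianMetric w) (hΘ : IsHolomorphicVolumeForm Θ)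
    (hy : y ∈ (chartAt (Cn n) x₀).target) :
    (volConst n : ℂ) * (normSq (rep x₀ w y) (rep x₀ Θ y) * (hMat (rep x₀ w y)).det)
      = volDensity Θ x₀ y := by
  rw [(hw.rep hy).normSq_mul_det (hΘ.isTypeNZero_rep hy), hΘ.volDensity_eq hy]
  push_cast
  rfl

end ChartData

/-! ### The measure defined by the volume form -/

section Measure

variable {n k : ℕ}

/-- Forms of top degree are pulled back by the real determinant. -/
lemma top_comp_apply (α : Alt n (n + n)) (A : Cn n →L[ℝ] Cn n) :
    α.compContinuousLinearMap A (realBasis n) = (A.det : ℂ) * α (realBasis n) := by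
  have h : ∀ (L : ℂ →ₗ[ℝ] ℝ) v, L (α v) = L (α (realBasis n)) * (stdRealBasis n).det v := by
    intro L v
    have h := (L.compAlternatingMap α.toAlternatingMap).eq_smul_basis_det (stdRealBasis n)
    have h2 : ⇑(stdRealBasis n) = realBasis n := funext fun i => stdRealBasis_apply i
    rw [h2] at h
    exact congrArg (fun a : Cn n [⋀^Fin (n + n)]→ₗ[ℝ] ℝ => a v) h
  have h1 : ∀ v, α v = (stdRealBasis n).det v • α (realBasis n) := fun v => by
    apply Complex.ext
    · have := h Complex.reLm v
      simp only [Complex.reLm_coe] at this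
      rw [this, Complex.smul_re, smul_eq_mul, mul_comm]
    · have := h Complex.imLm v
      simp only [Complex.imLm_coe] at this
      rw [this, Complex.smul_im, smul_eq_mul, mul_comm]
  rw [ContinuousAlternatingMap.compContinuousLinearMap_apply, h1]
  have h2 : (A ∘ realBasis n) = (A : Cn n →ₗ[ℝ] Cn n) ∘ stdRealBasis n := by
    funext i
    simp
  rw [h2, Module.Basis.det_comp, Module.Basis.det_self, mul_one, Complex.real_smul]

variable {M : Type*} [TopologicalSpace M] [ChartedSpace (Cn n) M] {Θ : M → Alt n n}

lemma image_transition_overlap (x₀ x₁ : M) :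
    transition x₀ x₁ '' ((chartAt (Cn n) x₁).target ∩
      (chartAt (Cn n) x₁).symm ⁻¹' (chartAt (Cn n) x₀).source)
    = (chartAt (Cn n) x₀).target ∩
      (chartAt (Cn n) x₀).symm ⁻¹' (chartAt (Cn n) x₁).source := by
  have h := ((chartAt (Cn n) x₁).symm.trans (chartAt (Cn n) x₀)).image_source_eq_target
  rw [OpenPartialHomeomorph.trans_source, OpenPartialHomeomorph.trans_target] at h
  simp only [OpenPartialHomeomorph.symm_source, OpenPartialHomeomorph.symm_target] at h
  exact h

lemma injOn_transition_overlap (x₀ x₁ : M) :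
    InjOn (transition x₀ x₁) ((chartAt (Cn n) x₁).target ∩
      (chartAt (Cn n) x₁).symm ⁻¹' (chartAt (Cn n) x₀).source) := by
  have h := ((chartAt (Cn n) x₁).symm.trans (chartAt (Cn n) x₀)).injOn
  rw [OpenPartialHomeomorph.trans_source] at h
  exact h

section

variable [IsManifold 𝓘(ℂ, Cn n) ∞ M]

lemma volDensity_transition {x₀ x₁ : M} {y : Cn n} (hy : y ∈ (chartAt (Cn n) x₁).target)
    (hx : (chartAt (Cn n) x₁).symm y ∈ (chartAt (Cn n) x₀).source) :
    volDensity Θ x₁ y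
      = |(fderiv ℝ (transition x₀ x₁) y).det| * volDensity Θ x₀ (transition x₀ x₁ y) := by
  rw [volDensity, rep_eq_pullForm _ hy hx, pullForm, top_comp_apply, norm_mul, Complex.norm_real]
  rfl

lemma IsHolomorphicVolumeForm.continuousOn_volDensity (hΘ : IsHolomorphicVolumeForm Θ) (x₀ : M) :
    ContinuousOn (volDensity Θ x₀) (chartAt (Cn n) x₀).target := fun _ hy =>
  (hΘ.contDiffAt_volDensity hy).continuousAt.continuousWithinAt

lemma IsHolomorphicVolumeForm.aemeasurable_volDensity (hΘ : IsHolomorphicVolumeForm Θ) (x₀ : M) :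
    AEMeasurable (fun y => ENNReal.ofReal (volDensity Θ x₀ y))
      (volume.restrict (chartAt (Cn n) x₀).target) :=
  ((hΘ.continuousOn_volDensity x₀).aemeasurable
    (chartAt (Cn n) x₀).open_target.measurableSet).ennreal_ofReal

end

variable [MeasurableSpace M]

/-- The measure defined by the volume form in a chart. -/
def chartMeasure (Θ : M → Alt n n) (x₀ : M) : Measure M :=
  Measure.map (chartAt (Cn n) x₀).symm
    ((volume.restrict (chartAt (Cn n) x₀).target).withDensity
      fun y => ENNReal.ofReal (volDensity Θ x₀ y))

variable [BorelSpace M]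

lemma aemeasurable_chart_symm (Θ : M → Alt n n) (x₀ : M) :
    AEMeasurable (chartAt (Cn n) x₀).symm
      ((volume.restrict (chartAt (Cn n) x₀).target).withDensity
        fun y => ENNReal.ofReal (volDensity Θ x₀ y)) :=
  ((chartAt (Cn n) x₀).continuousOn_symm.aemeasurable
    (chartAt (Cn n) x₀).open_target.measurableSet).mono_ac (withDensity_absolutelyContinuous _ _)

variable [IsManifold 𝓘(ℂ, Cn n) ∞ M]

lemma lintegral_chartMeasure (hΘ : IsHolomorphicVolumeForm Θ) (x₀ : M) {f : M → ENNReal}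
    (hf : Measurable f) : ∫⁻ x, f x ∂chartMeasure Θ x₀
      = ∫⁻ y in (chartAt (Cn n) x₀).target,
        ENNReal.ofReal (volDensity Θ x₀ y) * f ((chartAt (Cn n) x₀).symm y) := by
  rw [chartMeasure, lintegral_map' hf.aemeasurable (aemeasurable_chart_symm Θ x₀),
    lintegral_withDensity_eq_lintegral_mul₀ (hΘ.aemeasurable_volDensity x₀)
      (g := fun y => f ((chartAt (Cn n) x₀).symm y)) (hf.comp_aemeasurable ((chartAt (Cn n) x₀).continuousOn_symm.aemeasurable
        (chartAt (Cn n) x₀).open_target.measurableSet))]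
  rfl

/-- The measures defined by the volume form in two charts agree on the overlap. -/
lemma chartMeasure_apply_eq (hΘ : IsHolomorphicVolumeForm Θ) (x₀ x₁ : M) {s : Set M}
    (hs : MeasurableSet s) (hs₀ : s ⊆ (chartAt (Cn n) x₀).source)
    (hs₁ : s ⊆ (chartAt (Cn n) x₁).source) :
    chartMeasure Θ x₁ s = chartMeasure Θ x₀ s := by
  have key : ∀ x₀ x₁ : M, s ⊆ (chartAt (Cn n) x₀).source → chartMeasure Θ x₁ s
      = ∫⁻ y in (chartAt (Cn n) x₁).target ∩
          (chartAt (Cn n) x₁).symm ⁻¹' (chartAt (Cn n) x₀).source,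
        ENNReal.ofReal (volDensity Θ x₁ y) * s.indicator 1 ((chartAt (Cn n) x₁).symm y) := by
    intro x₀ x₁ h
    rw [← lintegral_indicator_one hs, lintegral_chartMeasure hΘ x₁ (measurable_one.indicator hs)]
    have hm := (isOpen_overlap (n := n) x₀ x₁).measurableSet
    rw [← lintegral_indicator (chartAt (Cn n) x₁).open_target.measurableSet,
      ← lintegral_indicator hm]
    refine lintegral_congr fun y => ?_
    by_cases hy : y ∈ (chartAt (Cn n) x₁).target
    · by_cases hy' : (chartAt (Cn n) x₁).symm y ∈ s
      · rw [indicator_of_mem hy, indicator_of_mem (show y ∈ _ ∩ _ from ⟨hy, h hy'⟩)]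
      · rw [indicator_of_mem hy]
        simp [indicator, hy']
    · rw [indicator_of_notMem hy, indicator_of_notMem (fun h => hy h.1)]
  rw [key x₀ x₁ hs₀, key x₁ x₀ hs₁, ← image_transition_overlap x₀ x₁,
    lintegral_image_eq_lintegral_abs_det_fderiv_mul volume (isOpen_overlap x₀ x₁).measurableSet
      (fun y hy => (((contDiffAt_transition hy.1 hy.2).restrict_scalars ℝ).differentiableAt
        (by simp)).hasFDerivAt.hasFDerivWithinAt) (injOn_transition_overlap x₀ x₁)]
  refine setLIntegral_congr_fun (isOpen_overlap x₀ x₁).measurableSet fun y hy => ?_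
  rw [volDensity_transition hy.1 hy.2, ENNReal.ofReal_mul (abs_nonneg _), mul_assoc]
  have : (chartAt (Cn n) x₀).symm (transition x₀ x₁ y) = (chartAt (Cn n) x₁).symm y :=
    (chartAt (Cn n) x₀).left_inv hy.2
  rw [this]

lemma chartMeasure_compl_source (hΘ : IsHolomorphicVolumeForm Θ) (x₀ : M) :
    chartMeasure Θ x₀ (chartAt (Cn n) x₀).sourceᶜ = 0 := by
  have hm : MeasurableSet (chartAt (Cn n) x₀).sourceᶜ :=
    (chartAt (Cn n) x₀).open_source.measurableSet.compl
  rw [← lintegral_indicator_one hm, lintegral_chartMeasure hΘ x₀ (measurable_one.indicator hm)]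
  rw [setLIntegral_eq_zero (chartAt (Cn n) x₀).open_target.measurableSet]
  intro y hy
  simp [(chartAt (Cn n) x₀).map_target hy]

/-- On the domain of a chart, the measure of the volume form is given by its density. -/
lemma volMeasure_restrict_source (hΘ : IsHolomorphicVolumeForm Θ) (x₀ : M) :
    (volMeasure Θ).restrict (chartAt (Cn n) x₀).source = chartMeasure Θ x₀ := by
  have hS : MeasurableSet (chartAt (Cn n) x₀).source :=
    (chartAt (Cn n) x₀).open_source.measurableSet
  refine le_antisymm ?_ ?_
  -- The least upper bound is bounded by any measure above all chart measures; outside the chart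
  -- domain the largest measure serves, and it does not contribute to the restriction.
  · have h : volMeasure Θ ≤ chartMeasure Θ x₀
        + (⊤ : Measure M).restrict (chartAt (Cn n) x₀).sourceᶜ := by
      refine iSup_le fun x₁ => ?_
      change chartMeasure Θ x₁ ≤ _
      refine Measure.le_iff.2 fun s hs => ?_
      have h1 : chartMeasure Θ x₁ (s ∩ (chartAt (Cn n) x₀).source) ≤ chartMeasure Θ x₀ s := by
        have hS₁ := (chartAt (Cn n) x₁).open_source.measurableSet
        have h2 : chartMeasure Θ x₁ ((s ∩ (chartAt (Cn n) x₀).source) \ (chartAt (Cn n) x₁).source)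
            = 0 := measure_mono_null (fun x hx => hx.2) (chartMeasure_compl_source hΘ x₁)
        rw [← measure_inter_add_sdiff _ hS₁, h2, add_zero, chartMeasure_apply_eq hΘ x₀ x₁
          ((hs.inter hS).inter hS₁) (fun x hx => hx.1.2) (fun x hx => hx.2)]
        exact measure_mono fun x hx => hx.1.1
      rw [← measure_inter_add_sdiff s hS, Measure.add_apply, Measure.restrict_apply hs]
      exact add_le_add h1 ((le_top : chartMeasure Θ x₁ ≤ ⊤) _)
    refine (Measure.restrict_mono subset_rfl h).trans ?_
    rw [Measure.restrict_add, Measure.restrict_restrict hS, inter_compl_self,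
      Measure.restrict_empty, add_zero]
    exact Measure.restrict_le_self
  · have h : chartMeasure Θ x₀ = (chartMeasure Θ x₀).restrict (chartAt (Cn n) x₀).source :=
      (Measure.restrict_eq_self_of_ae_mem (by
        rw [ae_iff]; exact chartMeasure_compl_source hΘ x₀)).symm
    rw [h]
    exact Measure.restrict_mono subset_rfl (le_iSup (chartMeasure Θ) x₀)

/-- The integral of a function supported in the domain of a chart. -/
lemma integral_volMeasure_eq (hΘ : IsHolomorphicVolumeForm Θ) (x₀ : M) {f : M → ℂ}
    (hf : ContinuousOn f (chartAt (Cn n) x₀).source)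
    (hsupp : ∀ x, x ∉ (chartAt (Cn n) x₀).source → f x = 0) :
    ∫ x, f x ∂volMeasure Θ = ∫ y in (chartAt (Cn n) x₀).target,
      (volDensity Θ x₀ y : ℂ) * f ((chartAt (Cn n) x₀).symm y) := by
  have hS : MeasurableSet (chartAt (Cn n) x₀).source :=
    (chartAt (Cn n) x₀).open_source.measurableSet
  have hm : AEStronglyMeasurable f (chartMeasure Θ x₀) := by
    rw [← volMeasure_restrict_source hΘ]
    exact hf.aestronglyMeasurable hS
  rw [← setIntegral_eq_integral_of_forall_compl_eq_zero hsupp, volMeasure_restrict_source hΘ,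
    chartMeasure, integral_map (aemeasurable_chart_symm Θ x₀) hm,
    integral_withDensity_eq_integral_toReal_smul₀ (hΘ.aemeasurable_volDensity x₀) (by simp)]
  refine integral_congr_ae (Filter.Eventually.of_forall fun y => ?_)
  simp only [Complex.real_smul]
  rw [ENNReal.toReal_ofReal (show 0 ≤ volDensity Θ x₀ y from norm_nonneg _)]

lemma isLocallyFiniteMeasure_volMeasure (hΘ : IsHolomorphicVolumeForm Θ) :
    IsLocallyFiniteMeasure (volMeasure Θ) := by
  refine ⟨fun x => ?_⟩
  have hc := (hΘ.continuousOn_volDensity x).continuousAt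
    ((chartAt (Cn n) x).open_target.mem_nhds (mem_chart_target _ _))
  obtain ⟨r, hr, hball⟩ := Metric.mem_nhds_iff.1 (Filter.inter_mem
    ((chartAt (Cn n) x).open_target.mem_nhds (mem_chart_target _ _))
    (hc.eventually (gt_mem_nhds (lt_add_one _))))
  set C := volDensity Θ x (chartAt (Cn n) x x) + 1 with hC
  set B := Metric.ball (chartAt (Cn n) x x) r with hB
  set U := (chartAt (Cn n) x).source ∩ chartAt (Cn n) x ⁻¹' B with hU
  have hUo : IsOpen U := (chartAt (Cn n) x).isOpen_inter_preimage Metric.isOpen_ball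
  refine ⟨U, hUo.mem_nhds ⟨mem_chart_source _ _, Metric.mem_ball_self hr⟩, ?_⟩
  have h1 : volMeasure Θ U = chartMeasure Θ x U := by
    rw [← volMeasure_restrict_source hΘ, Measure.restrict_apply hUo.measurableSet,
      inter_eq_left.2 inter_subset_left]
  rw [h1, ← lintegral_indicator_one hUo.measurableSet,
    lintegral_chartMeasure hΘ x (measurable_one.indicator hUo.measurableSet)]
  have h2 : ∫⁻ y in (chartAt (Cn n) x).target, ENNReal.ofReal (volDensity Θ x y)
      * U.indicator 1 ((chartAt (Cn n) x).symm y)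
      ≤ ∫⁻ y, B.indicator (fun _ => ENNReal.ofReal C) y := by
    refine (setLIntegral_mono' (chartAt (Cn n) x).open_target.measurableSet fun y hy => ?_).trans
      (setLIntegral_le_lintegral _ _)
    by_cases hyU : (chartAt (Cn n) x).symm y ∈ U
    · have hyB : y ∈ B := by
        have := hyU.2
        rwa [mem_preimage, (chartAt (Cn n) x).right_inv hy] at this
      rw [indicator_of_mem hyU, indicator_of_mem hyB, Pi.one_apply, mul_one]
      exact ENNReal.ofReal_le_ofReal (hball hyB).2.le
    · rw [indicator_of_notMem hyU, mul_zero]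
      exact zero_le
  refine h2.trans_lt ?_
  rw [lintegral_indicator_const Metric.isOpen_ball.measurableSet]
  exact ENNReal.mul_lt_top ENNReal.ofReal_lt_top measure_ball_lt_top

end Measure

/-! ### Integration by parts in a chart -/

section IntegrationByParts

variable {n k : ℕ}

lemma integral_fderiv_eq_zero {Q : Cn n → ℂ} (hQ : ContDiff ℝ ∞ Q) (hc : HasCompactSupport Q)
    (v : Cn n) : ∫ y, fderiv ℝ Q y v = 0 := by
  have h1 : Integrable (fun y => fderiv ℝ Q y v) :=
    ((hQ.continuous_fderiv (by simp)).clm_apply continuous_const).integrable_of_hasCompactSupport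
      (hc.fderiv_apply (𝕜 := ℝ) v)
  have h := integral_mul_fderiv_eq_neg_fderiv_mul_of_integrable (𝕜 := ℂ) (μ := volume)
    (f := fun _ : Cn n => (1 : ℂ)) (g := Q) (v := v) (by simp) (by simpa using h1)
    (by simpa using hQ.continuous.integrable_of_hasCompactSupport hc)
    (fun x _ => differentiableAt_const _) fun x _ => hQ.differentiable (by simp) x
  simpa using h

/-- The Wirtinger derivative of a function with compact support in `U` is integrable on `U` with
integral zero. -/
lemma integral_wirt_eq_zero {U K : Set (Cn n)} (hU : IsOpen U) (hK : IsCompact K) (hKU : K ⊆ U)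
    {P : Cn n → ℂ} (hP : ∀ y ∈ U, ContDiffAt ℝ ∞ P y) (h0 : ∀ y ∈ U, y ∉ K → P y = 0)
    (c : Fin n ⊕ Fin n) : IntegrableOn (wirt c P) U ∧ ∫ y in U, wirt c P y = 0 := by
  let Q : Cn n → ℂ := U.indicator P
  have hQU : ∀ y ∈ U, Q =ᶠ[nhds y] P := fun y hy => by
    filter_upwards [hU.mem_nhds hy] with z hz
    exact indicator_of_mem hz P
  have hQK : ∀ y, y ∉ K → Q =ᶠ[nhds y] fun _ => 0 := fun y hy => by
    filter_upwards [hK.isClosed.isOpen_compl.mem_nhds hy] with z hz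
    by_cases hzU : z ∈ U
    · exact (indicator_of_mem hzU P).trans (h0 z hzU hz)
    · exact indicator_of_notMem hzU P
  have hQ : ContDiff ℝ ∞ Q := contDiff_iff_contDiffAt.2 fun y => by
    by_cases hy : y ∈ K
    · exact (hP y (hKU hy)).congr_of_eventuallyEq (hQU y (hKU hy))
    · exact contDiffAt_const.congr_of_eventuallyEq (hQK y hy)
  have hc : HasCompactSupport Q := HasCompactSupport.intro hK fun y hy => (hQK y hy).eq_of_nhds
  have hw : wirt c Q = U.indicator (wirt c P) := by
    funext y
    by_cases hy : y ∈ U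
    · rw [indicator_of_mem hy, (hQU y hy).wirt_eq]
    · rw [indicator_of_notMem hy, (hQK y fun h => hy (hKU h)).wirt_eq, wirt_const]
  have hi : ∀ v, Integrable (fun y => fderiv ℝ Q y v) := fun v =>
    ((hQ.continuous_fderiv (by simp)).clm_apply continuous_const).integrable_of_hasCompactSupport
      (hc.fderiv_apply (𝕜 := ℝ) v)
  have hwi : Integrable (wirt c Q) := ((hi _).sub ((hi _).smul (coordUnit c))).smul (2⁻¹ : ℂ)
  constructor
  · rw [← integrable_indicator_iff hU.measurableSet, ← hw]
    exact hwi
  · rw [← integral_indicator hU.measurableSet, ← hw]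
    simp only [wirt]
    rw [integral_smul, integral_sub (hi _) ((hi _).fun_smul (coordUnit c)), integral_smul,
      integral_fderiv_eq_zero hQ hc, integral_fderiv_eq_zero hQ hc]
    simp

lemma integrableOn_of_isCompact {U K : Set (Cn n)} (hU : IsOpen U) (hK : IsCompact K) (hKU : K ⊆ U)
    {P : Cn n → ℂ} (hP : ContinuousOn P U) (h0 : ∀ y ∈ U, y ∉ K → P y = 0) : IntegrableOn P U :=
  ((hP.mono hKU).integrableOn_compact hK).of_forall_sdiff_eq_zero hU.measurableSet
    fun y hy => h0 y hy.1 hy.2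

/-- The pairing `ρ ⟨dzˡ ∧ A, B⟩_W` in a chart. -/
def delPairing (ρ : Cn n → ℝ) (W : Cn n → Alt n 2) (B : Cn n → Alt n (k + 1)) (l : Fin n)
    (A : Alt n k) (z : Cn n) : ℂ :=
  ρ z * hermInner (W z) (extMul (coframe (.inl l)) A) (B z)

/-- The Gram matrix of a basis of the space of `k`-forms. -/
def basisGram (n k : ℕ) (w : Alt n 2) : Matrix (Fin (Module.finrank ℂ (Alt n k)))
    (Fin (Module.finrank ℂ (Alt n k))) ℂ :=
  Matrix.of fun e f => hermInner w (Module.finBasis ℂ (Alt n k) e) (Module.finBasis ℂ (Alt n k) f)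

lemma IsHermitianForm.det_basisGram_ne_zero {w : Alt n 2} (hw : IsHermitianForm w) :
    (basisGram n k w).det ≠ 0 := by
  intro h0
  obtain ⟨v, hv, hvG⟩ := Matrix.exists_vecMul_eq_zero_iff.2 h0
  let α : Alt n k := ∑ e, v e • Module.finBasis ℂ (Alt n k) e
  have h1 : ∀ f, hermInner w α (Module.finBasis ℂ (Alt n k) f) = 0 := fun f => by
    have := congrFun hvG f
    rw [Matrix.vecMul, dotProduct] at this
    simp only [α, hermInner_sum_left, hermInner_smul_left]
    exact this
  have h2 : hermInner w α α = 0 := by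
    have h3 : hermInner w α (∑ e, v e • Module.finBasis ℂ (Alt n k) e) = 0 := by
      simp only [hermInner_sum_right, hermInner_smul_right, h1, mul_zero, Finset.sum_const_zero]
    exact h3
  have hα : α = 0 := by
    by_contra hne
    have := hw.hermInner_self_pos hne
    simp [h2] at this
  apply hv
  funext e
  exact Fintype.linearIndependent_iff.1 (Module.finBasis ℂ (Alt n k)).linearIndependent v hα e

/-- The form `G` with `ρ ⟨A, G⟩_W = - ∑ₗ ∂/∂zˡ (ρ ⟨dzˡ ∧ A, B⟩_W)` for all constant forms `A`, the
value at `B` of the adjoint of `∂` in a chart. -/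
def localAdjoint (ρ : Cn n → ℝ) (W : Cn n → Alt n 2) (B : Cn n → Alt n (k + 1)) (y : Cn n) :
    Alt n k :=
  ∑ e, (starRingEnd ℂ) (∑ f, (basisGram n k (W y))⁻¹ e f *
    ((ρ y : ℂ)⁻¹ * -∑ l, wirt (.inl l)
      (delPairing ρ W B l (Module.finBasis ℂ (Alt n k) f)) y)) • Module.finBasis ℂ (Alt n k) e

variable {ρ : Cn n → ℝ} {W : Cn n → Alt n 2} {B : Cn n → Alt n (k + 1)} {y : Cn n}

lemma contDiffAt_delPairing (hρ : ContDiffAt ℝ ∞ ρ y) (hW : ContDiffAt ℝ ∞ W y)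
    (hy : IsHermitianForm (W y)) (hB : ContDiffAt ℝ ∞ B y) (l : Fin n) (A : Alt n k) :
    ContDiffAt ℝ ∞ (delPairing ρ W B l A) y := by
  rw [← contDiffWithinAt_univ] at hρ hW hB ⊢
  exact hρ.ofReal.mul (hW.hermInner hy contDiffWithinAt_const hB)

lemma contDiffAt_localAdjoint (hρ : ContDiffAt ℝ ∞ ρ y) (hρ0 : ρ y ≠ 0) (hW : ContDiffAt ℝ ∞ W y)
    (hy : IsHermitianForm (W y)) (hB : ContDiffAt ℝ ∞ B y) :
    ContDiffAt ℝ ∞ (localAdjoint ρ W B) y := by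
  have h1 : ∀ l f, ContDiffAt ℝ ∞
      (wirt (.inl l) (delPairing ρ W B l (Module.finBasis ℂ (Alt n k) f))) y := fun l f =>
    (contDiffAt_delPairing hρ hW hy hB l _).wirt _
  rw [← contDiffWithinAt_univ] at hρ hW ⊢
  have h2 : ∀ e f, ContDiffWithinAt ℝ ∞ (fun z => (basisGram n k (W z))⁻¹ e f) univ y := fun e f =>
    contDiffWithinAt_matrix_inv (fun i j => hW.hermInner hy contDiffWithinAt_const
      contDiffWithinAt_const) hy.det_basisGram_ne_zero e f
  refine ContDiffWithinAt.sum fun e _ => ContDiffWithinAt.alt_smul (ContDiffWithinAt.conj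
    (ContDiffWithinAt.sum fun f _ => (h2 e f).mul ?_)) contDiffWithinAt_const
  exact (hρ.ofReal.inv (by exact_mod_cast hρ0)).mul
    (ContDiffWithinAt.sum fun l _ => (h1 l f).contDiffWithinAt).neg

/-- The characteristic property of the local adjoint. -/
lemma hermInner_localAdjoint (hρ : ContDiffAt ℝ ∞ ρ y) (hρ0 : ρ y ≠ 0) (hW : ContDiffAt ℝ ∞ W y)
    (hy : IsHermitianForm (W y)) (hB : ContDiffAt ℝ ∞ B y) (A : Alt n k) :
    (ρ y : ℂ) * hermInner (W y) A (localAdjoint ρ W B y)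
      = -∑ l, wirt (.inl l) (delPairing ρ W B l A) y := by
  have hρ0' : (ρ y : ℂ) ≠ 0 := by exact_mod_cast hρ0
  set E := Module.finBasis ℂ (Alt n k) with hE
  set F : Fin (Module.finrank ℂ (Alt n k)) → ℂ := fun f =>
    (ρ y : ℂ)⁻¹ * -∑ l, wirt (.inl l) (delPairing ρ W B l (E f)) y with hF
  have hbasis : ∀ f, hermInner (W y) (E f) (localAdjoint ρ W B y) = F f := by
    intro f
    simp only [localAdjoint, hermInner_sum_right, hermInner_smul_right, Complex.conj_conj]
    have h1 : (basisGram n k (W y)).mulVec ((basisGram n k (W y))⁻¹.mulVec F) = F := by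
      rw [Matrix.mulVec_mulVec, Matrix.mul_nonsing_inv _ hy.det_basisGram_ne_zero.isUnit,
        Matrix.one_mulVec]
    have h2 := congrFun h1 f
    rw [← h2]
    refine Finset.sum_congr rfl fun e _ => ?_
    rw [mul_comm]
    rfl
  have hd : ∀ l f, DifferentiableAt ℝ (delPairing ρ W B l (E f)) y := fun l f =>
    (contDiffAt_delPairing hρ hW hy hB l _).differentiableAt (by simp)
  have hA : A = ∑ f, E.repr A f • E f := (E.sum_repr A).symm
  have hp : ∀ l, delPairing ρ W B l A
      = fun z => ∑ f, E.repr A f • delPairing ρ W B l (E f) z := fun l => by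
    funext z
    conv_lhs => rw [hA]
    simp only [delPairing, map_sum, map_smul, hermInner_sum_left, hermInner_smul_left,
      Finset.mul_sum, smul_eq_mul]
    exact Finset.sum_congr rfl fun f _ => by ring
  have hw : ∀ l, wirt (.inl l) (delPairing ρ W B l A) y
      = ∑ f, E.repr A f * wirt (.inl l) (delPairing ρ W B l (E f)) y := fun l => by
    rw [hp, wirt_sum _ fun f _ => (hd l f).fun_const_smul (E.repr A f)]
    exact Finset.sum_congr rfl fun f _ => wirt_const_smul _ (hd l f) _
  conv_lhs => rw [hA]
  simp only [hw, hermInner_sum_left, hermInner_smul_left, hbasis, hF]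
  rw [Finset.sum_comm, Finset.mul_sum, ← Finset.sum_neg_distrib]
  refine Finset.sum_congr rfl fun f _ => ?_
  rw [← Finset.mul_sum]
  field_simp

/-- The difference of the two sides of the adjunction is a divergence. -/
lemma hermInner_coordDel (hρ : ContDiffAt ℝ ∞ ρ y) (hρ0 : ρ y ≠ 0) (hW : ContDiffAt ℝ ∞ W y)
    (hy : IsHermitianForm (W y)) (hB : ContDiffAt ℝ ∞ B y) {a : Cn n → Alt n k}
    (ha : ContDiffAt ℝ ∞ a y) :
    (ρ y : ℂ) * hermInner (W y) (coordDel a y) (B y)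
      = (ρ y : ℂ) * hermInner (W y) (a y) (localAdjoint ρ W B y)
        + ∑ l, wirt (.inl l) (fun z => delPairing ρ W B l (a z) z) y := by
  set E := Module.finBasis ℂ (Alt n k) with hE
  have hd : ∀ l f, DifferentiableAt ℝ (delPairing ρ W B l (E f)) y := fun l f =>
    (contDiffAt_delPairing hρ hW hy hB l _).differentiableAt (by simp)
  have had := ha.differentiableAt (by simp : (∞ : ℕ∞ω) ≠ 0)
  have hc : ∀ f, DifferentiableAt ℝ (fun z => E.coord f (a z)) y := fun f =>
    ((E.coord f).toContinuousLinearMap.restrictScalars ℝ).differentiableAt.comp y had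
  have hexp : ∀ l (A : Alt n k) z, delPairing ρ W B l A z
      = ∑ f, E.coord f A * delPairing ρ W B l (E f) z := fun l A z => by
    conv_lhs => rw [← E.sum_repr A]
    simp only [delPairing, map_sum, map_smul, hermInner_sum_left, hermInner_smul_left,
      Finset.mul_sum, Module.Basis.coord_apply]
    exact Finset.sum_congr rfl fun f _ => by ring
  have hw : ∀ l, wirt (.inl l) (fun z => delPairing ρ W B l (a z) z) y
      = delPairing ρ W B l (wirt (.inl l) a y) y
        + wirt (.inl l) (delPairing ρ W B l (a y)) y := fun l => by
    have e1 : (fun z => delPairing ρ W B l (a z) z)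
        = fun z => ∑ f, E.coord f (a z) * delPairing ρ W B l (E f) z :=
      funext fun z => hexp l (a z) z
    have e2 : delPairing ρ W B l (a y) = fun z => ∑ f, E.coord f (a y) • delPairing ρ W B l (E f) z :=
      funext fun z => hexp l (a y) z
    rw [e1, wirt_sum _ fun f _ => (hc f).fun_mul (hd l f), hexp l (wirt (.inl l) a y), e2,
      wirt_sum _ fun f _ => (hd l f).fun_const_smul (E.coord f (a y)), ← Finset.sum_add_distrib]
    refine Finset.sum_congr rfl fun f _ => ?_
    rw [wirt_mul (hc f) (hd l f), wirt_linear (E.coord f) had, wirt_const_smul _ (hd l f),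
      smul_eq_mul]
  rw [hermInner_localAdjoint hρ hρ0 hW hy hB]
  rw [Finset.sum_congr rfl fun l _ => hw l, Finset.sum_add_distrib, coordDel_eq_sum,
    hermInner_sum_left, Finset.mul_sum, add_comm (∑ l, delPairing ρ W B l _ _), neg_add_cancel_left]
  rfl

end IntegrationByParts

/-! ### The adjoint of `∂` -/

section Adjoint

variable {n k : ℕ} {M : Type*} [TopologicalSpace M] [ChartedSpace (Cn n) M]
  {w : M → Alt n 2} {Θ : M → Alt n n}

lemma SmoothFormAt.zero (x : M) : SmoothFormAt (fun _ => 0 : M → Alt n k) x := by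
  have : rep x (fun _ => 0 : M → Alt n k) = fun _ => 0 := by
    funext y
    rw [rep_apply]
    rfl
  rw [SmoothFormAt, this]
  exact contDiffAt_const

lemma SmoothFormAt.sub {α β : M → Alt n k} {x : M} (hα : SmoothFormAt α x)
    (hβ : SmoothFormAt β x) : SmoothFormAt (fun x => α x - β x) x :=
  ContDiffAt.sub hα hβ

section SmoothFunctions

variable [IsManifold 𝓘(ℂ, Cn n) ∞ M]

/-- The smooth real manifold underlying a complex manifold. -/
lemma isManifold_real : IsManifold 𝓘(ℝ, Cn n) ∞ M := by
  refine isManifold_of_contDiffOn 𝓘(ℝ, Cn n) ∞ M fun e e' he he' => ?_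
  have h := HasGroupoid.compatible (G := contDiffGroupoid ∞ 𝓘(ℂ, Cn n)) he he'
  rw [contDiffGroupoid, mem_groupoid_of_pregroupoid, contDiffPregroupoid] at h
  exact ContDiffOn.restrict_scalars ℝ h.1

lemma contDiffAt_comp_chart_symm {f : M → ℝ} (hf : ContMDiff 𝓘(ℝ, Cn n) 𝓘(ℝ, ℝ) ∞ f) {x₀ : M}
    {y : Cn n} (hy : y ∈ (chartAt (Cn n) x₀).target) :
    ContDiffAt ℝ ∞ (fun z => f ((chartAt (Cn n) x₀).symm z)) y := by
  have : IsManifold 𝓘(ℝ, Cn n) ∞ M := isManifold_real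
  have h1 : ContMDiffOn 𝓘(ℝ, Cn n) 𝓘(ℝ, Cn n) ∞ (chartAt (Cn n) x₀).symm
    (chartAt (Cn n) x₀).target := contMDiffOn_chart_symm
  have h2 := (hf.comp_contMDiffOn h1).contDiffOn
  exact (h2 y hy).contDiffAt ((chartAt (Cn n) x₀).open_target.mem_nhds hy)

lemma SmoothFormAt.smul {f : M → ℝ} (hf : ContMDiff 𝓘(ℝ, Cn n) 𝓘(ℝ, ℝ) ∞ f) {α : M → Alt n k}
    {x : M} (hα : SmoothFormAt α x) : SmoothFormAt (fun x => f x • α x) x :=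
  (contDiffAt_comp_chart_symm hf (mem_chart_target _ _)).smul hα

lemma smoothForm_smul {f : M → ℝ} (hf : ContMDiff 𝓘(ℝ, Cn n) 𝓘(ℝ, ℝ) ∞ f) {α : M → Alt n k}
    (hα : ∀ x ∈ tsupport f, SmoothFormAt α x) : SmoothForm (fun x => f x • α x) := by
  refine smoothForm_iff.2 fun x => ?_
  by_cases hx : x ∈ tsupport f
  · exact (hα x hx).smul hf
  · refine (SmoothFormAt.zero x).congr ?_
    filter_upwards [(isClosed_tsupport f).isOpen_compl.mem_nhds hx] with z hz
    rw [image_eq_zero_of_notMem_tsupport hz]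
    module

end SmoothFunctions

lemma continuousAt_hermInner [IsManifold 𝓘(ℂ, Cn n) ∞ M] (hw : IsHermitianMetric w)
    {α β : M → Alt n k} {x : M} (hα : SmoothFormAt α x) (hβ : SmoothFormAt β x) :
    ContinuousAt (fun x => hermInner (w x) (α x) (β x)) x := by
  have hW : ContDiffAt ℝ ∞ (rep x w) (chartAt (Cn n) x x) := hw.smooth.smoothFormAt x
  have hy := hw.rep (mem_chart_target (Cn n) x)
  have h1 : ContinuousAt (fun y => hermInner (rep x w y) (rep x α y) (rep x β y))
      (chartAt (Cn n) x x) := by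
    rw [SmoothFormAt, ← contDiffWithinAt_univ] at hα hβ
    rw [← contDiffWithinAt_univ] at hW
    have := hW.hermInner hy hα hβ
    rw [contDiffWithinAt_univ] at this
    exact this.continuousAt
  have h2 : ContinuousAt (fun z => hermInner (rep x w (chartAt (Cn n) x z))
      (rep x α (chartAt (Cn n) x z)) (rep x β (chartAt (Cn n) x z))) x :=
    ContinuousAt.comp (f := chartAt (Cn n) x)
      (g := fun y => hermInner (rep x w y) (rep x α y) (rep x β y)) h1
      ((chartAt (Cn n) x).continuousAt (mem_chart_source _ _))
  refine h2.congr ?_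
  filter_upwards [(chartAt (Cn n) x).open_source.mem_nhds (mem_chart_source _ _)] with z hz
  rw [hermInner_rep _ _ _ ((chartAt (Cn n) x).map_source hz), (chartAt (Cn n) x).left_inv hz]

lemma del_eq_zero_of_notMem_tsupport {α : M → Alt n k} {x : M} (hx : x ∉ tsupport α) :
    del α x = 0 := by
  have h : α =ᶠ[nhds x] fun _ => 0 := by
    filter_upwards [(isClosed_tsupport α).isOpen_compl.mem_nhds hx] with z hz
    exact image_eq_zero_of_notMem_tsupport hz
  rw [del_eq, (rep_congr h (mem_chart_source _ _)).coordDel_eq, coordDel_eq_sum]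
  refine Finset.sum_eq_zero fun l _ => ?_
  have : rep x (fun _ => 0 : M → Alt n k) = fun _ => 0 := by
    funext y
    rw [rep_apply]
    rfl
  rw [this, wirt_const, map_zero]

section Integrals

variable [MeasurableSpace M] [BorelSpace M] [IsManifold 𝓘(ℂ, Cn n) ∞ M]

/-- The scalar product of forms, one of which is supported in the domain of a chart. -/
lemma L2_eq_setIntegral (hw : IsHermitianMetric w) (hΘ : IsHolomorphicVolumeForm Θ) (x₀ : M)
    {α β : M → Alt n k} (hα : ∀ x ∈ (chartAt (Cn n) x₀).source, SmoothFormAt α x)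
    (hβ : ∀ x ∈ (chartAt (Cn n) x₀).source, SmoothFormAt β x)
    (hsupp : ∀ x, x ∉ (chartAt (Cn n) x₀).source → α x = 0) :
    L2 w Θ α β = ∫ y in (chartAt (Cn n) x₀).target, (volDensity Θ x₀ y : ℂ) *
      hermInner (rep x₀ w y) (rep x₀ α y) (rep x₀ β y) := by
  rw [L2, integral_volMeasure_eq hΘ x₀ (fun x hx =>
    (continuousAt_hermInner hw (hα x hx) (hβ x hx)).continuousWithinAt)
    fun x hx => by rw [hsupp x hx, hermInner_zero_left]]
  refine setIntegral_congr_fun (chartAt (Cn n) x₀).open_target.measurableSet fun y hy => ?_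
  simp only [hermInner_rep w α β hy]

lemma integrable_hermInner (hw : IsHermitianMetric w) (hΘ : IsHolomorphicVolumeForm Θ)
    {α β : M → Alt n k} (hα : SmoothForm α) {K : Set M} (hK : IsCompact K) (hKc : IsClosed K)
    (h0 : ∀ x, x ∉ K → α x = 0) (hβ : ∀ x ∈ K, SmoothFormAt β x) :
    Integrable (fun x => hermInner (w x) (α x) (β x)) (volMeasure Θ) := by
  have := isLocallyFiniteMeasure_volMeasure hΘ
  refine Continuous.integrable_of_hasCompactSupport ?_ (HasCompactSupport.intro' hK hKc
    fun x hx => by rw [h0 x hx, hermInner_zero_left])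
  refine continuous_iff_continuousAt.2 fun x => ?_
  by_cases hx : x ∈ K
  · exact continuousAt_hermInner hw (hα.smoothFormAt x) (hβ x hx)
  · have : (fun x => hermInner (w x) (α x) (β x)) =ᶠ[nhds x] fun _ => 0 := by
      filter_upwards [hKc.isOpen_compl.mem_nhds hx] with z hz
      rw [h0 z hz, hermInner_zero_left]
    exact (continuousAt_congr this).2 continuousAt_const

lemma isOpenPosMeasure_volMeasure (hΘ : IsHolomorphicVolumeForm Θ) :
    (volMeasure Θ).IsOpenPosMeasure := by
  refine ⟨fun V hV ⟨p, hp⟩ h0 => ?_⟩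
  have h1 : chartMeasure Θ p V = 0 :=
    le_antisymm ((Measure.le_iff'.1 (le_iSup (chartMeasure Θ) p) V).trans h0.le) zero_le
  rw [chartMeasure, Measure.map_apply_of_aemeasurable (aemeasurable_chart_symm Θ p)
    hV.measurableSet, withDensity_apply_eq_zero' (hΘ.aemeasurable_volDensity p)] at h1
  have h2 := (chartAt (Cn n) p).isOpen_inter_preimage_symm hV
  have h3 : volume ((chartAt (Cn n) p).target ∩ (chartAt (Cn n) p).symm ⁻¹' V) = 0 := by
    rw [Measure.restrict_apply₀' (chartAt (Cn n) p).open_target.nullMeasurableSet] at h1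
    refine measure_mono_null ?_ h1
    rintro y ⟨hy, hyV⟩
    exact ⟨⟨(ENNReal.ofReal_pos.2 (hΘ.volDensity_pos hy)).ne', hyV⟩, hy⟩
  refine h2.measure_ne_zero volume ⟨chartAt (Cn n) p p, mem_chart_target _ _, ?_⟩ h3
  rw [mem_preimage, (chartAt (Cn n) p).left_inv (mem_chart_source _ _)]
  exact hp

/-- Fields of forms with the same scalar products with all test forms supported in an open set agree
there. -/
lemma eqOn_of_L2_eq [T2Space M] (hw : IsHermitianMetric w) (hΘ : IsHolomorphicVolumeForm Θ)
    {O : Set M} (hO : IsOpen O) {δ₁ δ₂ : M → Alt n k} (h₁ : ∀ x ∈ O, SmoothFormAt δ₁ x)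
    (h₂ : ∀ x ∈ O, SmoothFormAt δ₂ x)
    (h : ∀ α : M → Alt n k, SmoothForm α → HasCompactSupport α → tsupport α ⊆ O →
      L2 w Θ α δ₁ = L2 w Θ α δ₂) : EqOn δ₁ δ₂ O := by
  have : IsManifold 𝓘(ℝ, Cn n) ∞ M := isManifold_real
  have := isLocallyFiniteMeasure_volMeasure hΘ
  have := isOpenPosMeasure_volMeasure hΘ
  intro p hp
  by_contra hne
  obtain ⟨f, hfO⟩ : ∃ f : SmoothBumpFunction 𝓘(ℝ, Cn n) p, tsupport f ⊆ O := by
    obtain ⟨f, -, hf⟩ := (SmoothBumpFunction.nhds_basis_tsupport (I := 𝓘(ℝ, Cn n)) p).mem_iff.1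
      (hO.mem_nhds hp)
    exact ⟨f, hf⟩
  set δ : M → Alt n k := fun x => δ₁ x - δ₂ x with hδ
  set α : M → Alt n k := fun x => f x • δ x with hαdef
  have hδs : ∀ x ∈ tsupport f, SmoothFormAt δ x := fun x hx => (h₁ x (hfO hx)).sub (h₂ x (hfO hx))
  have hα : SmoothForm α := smoothForm_smul f.contMDiff hδs
  have h0 : ∀ x, x ∉ tsupport f → α x = 0 := fun x hx => by
    rw [hαdef]
    simp only [image_eq_zero_of_notMem_tsupport hx]
    module
  have hcomp : IsCompact (tsupport f) := f.hasCompactSupport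
  have hαc : HasCompactSupport α := HasCompactSupport.intro' hcomp (isClosed_tsupport _) h0
  have hαO : tsupport α ⊆ O := (closure_minimal (fun x hx => by
    by_contra hx'
    exact hx (h0 x hx')) (isClosed_tsupport f)).trans hfO
  have hint : ∀ δ' : M → Alt n k, (∀ x ∈ tsupport f, SmoothFormAt δ' x) →
      Integrable (fun x => hermInner (w x) (α x) (δ' x)) (volMeasure Θ) := fun δ' hδ' =>
    integrable_hermInner hw hΘ hα hcomp (isClosed_tsupport _) h0 hδ'
  have hzero : ∫ x, hermInner (w x) (α x) (δ x) ∂volMeasure Θ = 0 := by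
    simp only [hδ, hermInner_sub_right]
    rw [integral_sub (hint δ₁ fun x hx => h₁ x (hfO hx)) (hint δ₂ fun x hx => h₂ x (hfO hx))]
    exact sub_eq_zero.2 (h α hα hαc hαO)
  set g : M → ℝ := fun x => (hermInner (w x) (α x) (δ x)).re with hg
  have hgf : ∀ x, g x = f x * (hermInner (w x) (δ x) (δ x)).re := fun x => by
    have : α x = (f x : ℂ) • δ x := rfl
    rw [hg]
    simp only [this, hermInner_smul_left, Complex.re_ofReal_mul]
  have hg0 : ∀ x, 0 ≤ g x := fun x => by
    rw [hgf]
    refine mul_nonneg f.nonneg ?_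
    by_cases hx : δ x = 0
    · rw [hx, hermInner_zero_left]; rfl
    · exact ((hw.isHermitianForm x).hermInner_self_pos hx).le
  have hgp : g p ≠ 0 := by
    rw [hgf, f.eq_one, one_mul]
    exact ((hw.isHermitianForm p).hermInner_self_pos (sub_ne_zero.2 hne)).ne'
  have hgc : Continuous g := by
    refine continuous_iff_continuousAt.2 fun x => ?_
    by_cases hx : x ∈ tsupport f
    · exact Complex.continuous_re.continuousAt.comp
        (continuousAt_hermInner hw (hα.smoothFormAt x) (hδs x hx))
    · have : g =ᶠ[nhds x] fun _ => 0 := by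
        filter_upwards [(isClosed_tsupport f).isOpen_compl.mem_nhds hx] with z hz
        rw [hg]
        simp only [h0 z hz, hermInner_zero_left, Complex.zero_re]
      exact (continuousAt_congr this).2 continuousAt_const
  have hgs : HasCompactSupport g := HasCompactSupport.intro' hcomp (isClosed_tsupport _)
    fun x hx => by rw [hg]; simp only [h0 x hx, hermInner_zero_left, Complex.zero_re]
  have hpos := hgc.integral_pos_of_hasCompactSupport_nonneg_nonzero (μ := volMeasure Θ) hgs hg0 hgp
  have hre : ∫ x, g x ∂volMeasure Θ = 0 := by
    have := integral_re (hint δ hδs)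
    simp only [hzero] at this
    simpa using this
  exact hpos.ne' hre

end Integrals

end Adjoint

/-! ### Existence and uniqueness of the adjoint -/

section AdjointExistence

variable {n k : ℕ} {M : Type*} [TopologicalSpace M] [ChartedSpace (Cn n) M]
  {w : M → Alt n 2} {Θ : M → Alt n n} {β : M → Alt n (k + 1)}

/-- The field of forms whose representative in the chart at `x₀` is the local adjoint. -/
def chartAdjoint (w : M → Alt n 2) (Θ : M → Alt n n) (β : M → Alt n (k + 1)) (x₀ x : M) :
    Alt n k :=
  (localAdjoint (volDensity Θ x₀) (rep x₀ w) (rep x₀ β) (chartAt (Cn n) x₀ x)).compContinuousLinearMap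
    (fderiv ℝ (transition x₀ x) (chartAt (Cn n) x x))

lemma rep_sum {ι : Type*} (s : Finset ι) (α : ι → M → Alt n k) (x₀ : M) (y : Cn n) :
    rep x₀ (fun x => ∑ i ∈ s, α i x) y = ∑ i ∈ s, rep x₀ (α i) y := by
  simp only [rep_apply]
  ext v
  simp [ContinuousAlternatingMap.sum_apply]

lemma del_sum {ι : Type*} (s : Finset ι) {α : ι → M → Alt n k} [IsManifold 𝓘(ℂ, Cn n) ∞ M]
    (h : ∀ i ∈ s, SmoothForm (α i)) (x : M) : del (fun x => ∑ i ∈ s, α i x) x = ∑ i ∈ s, del (α i) x := by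
  simp only [del_eq, coordDel_eq_sum]
  have h1 : rep x (fun x => ∑ i ∈ s, α i x) = fun y => ∑ i ∈ s, rep x (α i) y :=
    funext fun y => rep_sum s α x y
  rw [h1, Finset.sum_comm]
  refine Finset.sum_congr rfl fun l _ => ?_
  rw [wirt_sum s (fun i hi => ((h i hi).smoothFormAt x).differentiableAt (by simp)), map_sum]

lemma L2_congr_right [MeasurableSpace M] {α β₁ β₂ : M → Alt n k} (h : ∀ x, α x ≠ 0 → β₁ x = β₂ x) :
    L2 w Θ α β₁ = L2 w Θ α β₂ := by
  refine integral_congr_ae (Filter.Eventually.of_forall fun x => ?_)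
  by_cases hx : α x = 0
  · simp only [hx, hermInner_zero_left]
  · simp only [h x hx]

variable [IsManifold 𝓘(ℂ, Cn n) ∞ M]

lemma rep_chartAdjoint {x₀ : M} {y : Cn n} (hy : y ∈ (chartAt (Cn n) x₀).target) :
    rep x₀ (chartAdjoint w Θ β x₀) y
      = localAdjoint (volDensity Θ x₀) (rep x₀ w) (rep x₀ β) y := by
  have h := fderiv_transition_comp (x₀ := x₀) hy (mem_chart_source (Cn n) _)
    ((chartAt (Cn n) x₀).map_target hy)
  rw [fderiv_transition_self hy] at h
  rw [rep_apply, chartAdjoint, (chartAt (Cn n) x₀).right_inv hy]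
  ext v
  simp only [ContinuousAlternatingMap.compContinuousLinearMap_apply, Function.comp_def]
  congr 1
  funext i
  exact congrArg (fun L : Cn n →L[ℝ] Cn n => L (v i)) h

lemma contDiffAt_localAdjoint_chart (hw : IsHermitianMetric w) (hΘ : IsHolomorphicVolumeForm Θ)
    (hβ : SmoothForm β) {x₀ : M} {y : Cn n} (hy : y ∈ (chartAt (Cn n) x₀).target) :
    ContDiffAt ℝ ∞ (localAdjoint (volDensity Θ x₀) (rep x₀ w) (rep x₀ β)) y :=
  contDiffAt_localAdjoint (hΘ.contDiffAt_volDensity hy) (hΘ.volDensity_pos hy).ne'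
    (hw.smooth.contDiffAt hy) (hw.rep hy) (hβ.contDiffAt hy)

lemma smoothFormAt_chartAdjoint (hw : IsHermitianMetric w) (hΘ : IsHolomorphicVolumeForm Θ)
    (hβ : SmoothForm β) {x₀ x : M} (hx : x ∈ (chartAt (Cn n) x₀).source) :
    SmoothFormAt (chartAdjoint w Θ β x₀) x := by
  refine smoothFormAt_of_contDiffAt hx ?_
  refine (contDiffAt_localAdjoint_chart hw hΘ hβ
    ((chartAt (Cn n) x₀).map_source hx)).congr_of_eventuallyEq ?_
  filter_upwards [(chartAt (Cn n) x₀).open_target.mem_nhds ((chartAt (Cn n) x₀).map_source hx)]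
    with z hz
  exact rep_chartAdjoint hz

variable [MeasurableSpace M] [BorelSpace M]

/-- The adjunction for test forms supported in the domain of a chart. -/
lemma L2_del_eq_chartAdjoint [T2Space M] (hw : IsHermitianMetric w)
    (hΘ : IsHolomorphicVolumeForm Θ) (hβ : SmoothForm β) (x₀ : M) {α : M → Alt n k}
    (hα : SmoothForm α) (hc : HasCompactSupport α) (hs : tsupport α ⊆ (chartAt (Cn n) x₀).source) :
    L2 w Θ (del α) β = L2 w Θ α (chartAdjoint w Θ β x₀) := by
  have hU := (chartAt (Cn n) x₀).open_target
  set K := chartAt (Cn n) x₀ '' tsupport α with hK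
  have hKc : IsCompact K := IsCompact.image_of_continuousOn hc
    ((chartAt (Cn n) x₀).continuousOn.mono hs)
  have hKU : K ⊆ (chartAt (Cn n) x₀).target := by
    rintro _ ⟨x, hx, rfl⟩
    exact (chartAt (Cn n) x₀).map_source (hs hx)
  have h0 : ∀ y ∈ (chartAt (Cn n) x₀).target, y ∉ K → rep x₀ α y = 0 := by
    intro y hy hyK
    rw [rep_apply, image_eq_zero_of_notMem_tsupport (f := α) (x := (chartAt (Cn n) x₀).symm y)]
    · rfl
    · intro hx
      exact hyK ⟨_, hx, (chartAt (Cn n) x₀).right_inv hy⟩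
  rw [L2_eq_setIntegral hw hΘ x₀ (fun x _ => hα.del.smoothFormAt x) (fun x _ => hβ.smoothFormAt x)
      (fun x hx => del_eq_zero_of_notMem_tsupport fun h => hx (hs h)),
    L2_eq_setIntegral hw hΘ x₀ (fun x _ => hα.smoothFormAt x)
      (fun x hx => smoothFormAt_chartAdjoint hw hΘ hβ hx)
      (fun x hx => image_eq_zero_of_notMem_tsupport fun h => hx (hs h))]
  have hdata : ∀ y ∈ (chartAt (Cn n) x₀).target, (volDensity Θ x₀ y : ℂ) *
      hermInner (rep x₀ w y) (rep x₀ (del α) y) (rep x₀ β y)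
      = (volDensity Θ x₀ y : ℂ) * hermInner (rep x₀ w y) (rep x₀ α y)
          (rep x₀ (chartAdjoint w Θ β x₀) y)
        + ∑ l, wirt (.inl l)
          (fun z => delPairing (volDensity Θ x₀) (rep x₀ w) (rep x₀ β) l (rep x₀ α z) z) y := by
    intro y hy
    rw [rep_del hy (hα.smoothFormAt _), rep_chartAdjoint hy]
    exact hermInner_coordDel (hΘ.contDiffAt_volDensity hy) (hΘ.volDensity_pos hy).ne'
      (hw.smooth.contDiffAt hy) (hw.rep hy) (hβ.contDiffAt hy) (hα.contDiffAt hy)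
  have hP : ∀ l, ∀ y ∈ (chartAt (Cn n) x₀).target, ContDiffAt ℝ ∞
      (fun z => delPairing (volDensity Θ x₀) (rep x₀ w) (rep x₀ β) l (rep x₀ α z) z) y := by
    intro l y hy
    have h1 := hΘ.contDiffAt_volDensity hy
    have h2 := hw.smooth.contDiffAt hy
    have h3 := hβ.contDiffAt hy
    have h4 : ContDiffAt ℝ ∞ (fun z => extMul (coframe (.inl l)) (rep x₀ α z)) y :=
      ((extMul (coframe (.inl l))).toContinuousLinearMap.restrictScalars ℝ).contDiff.contDiffAt.comp
        y (hα.contDiffAt hy)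
    rw [← contDiffWithinAt_univ] at h1 h2 h3 h4 ⊢
    exact h1.ofReal.mul (h2.hermInner (hw.rep hy) h4 h3)
  have hP0 : ∀ l, ∀ y ∈ (chartAt (Cn n) x₀).target, y ∉ K →
      delPairing (volDensity Θ x₀) (rep x₀ w) (rep x₀ β) l (rep x₀ α y) y = 0 := by
    intro l y hy hyK
    rw [delPairing, h0 y hy hyK, map_zero, hermInner_zero_left, mul_zero]
  have hI := fun l => integral_wirt_eq_zero hU hKc hKU (hP l) (hP0 l) (.inl l)
  rw [setIntegral_congr_fun hU.measurableSet hdata, integral_add,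
    integral_finsetSum _ fun l _ => (hI l).1, Finset.sum_eq_zero fun l _ => (hI l).2, add_zero]
  · refine integrableOn_of_isCompact hU hKc hKU (fun y hy => ContinuousAt.continuousWithinAt ?_)
      fun y hy hyK => by rw [h0 y hy hyK, hermInner_zero_left, mul_zero]
    have h1 := hΘ.contDiffAt_volDensity hy
    have h2 := hw.smooth.contDiffAt hy
    have h3 := hα.contDiffAt hy
    have h4 : ContDiffAt ℝ ∞ (rep x₀ (chartAdjoint w Θ β x₀)) y := by
      have := (smoothFormAt_chartAdjoint hw hΘ hβ ((chartAt (Cn n) x₀).map_target hy)).contDiffAt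
        ((chartAt (Cn n) x₀).map_target hy)
      rwa [(chartAt (Cn n) x₀).right_inv hy] at this
    rw [← contDiffWithinAt_univ] at h1 h2 h3 h4
    have := h1.ofReal.mul (h2.hermInner (hw.rep hy) h3 h4)
    rw [contDiffWithinAt_univ] at this
    exact this.continuousAt
  · exact integrable_finsetSum _ fun l _ => (hI l).1

/-- The local adjoints in different charts agree, since both represent the adjoint of `∂`. -/
lemma chartAdjoint_eq [T2Space M] (hw : IsHermitianMetric w) (hΘ : IsHolomorphicVolumeForm Θ)
    (hβ : SmoothForm β) {x₀ x₁ x : M} (hx₀ : x ∈ (chartAt (Cn n) x₀).source)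
    (hx₁ : x ∈ (chartAt (Cn n) x₁).source) :
    chartAdjoint w Θ β x₀ x = chartAdjoint w Θ β x₁ x := by
  refine eqOn_of_L2_eq hw hΘ ((chartAt (Cn n) x₀).open_source.inter (chartAt (Cn n) x₁).open_source)
    (fun x hx => smoothFormAt_chartAdjoint hw hΘ hβ hx.1)
    (fun x hx => smoothFormAt_chartAdjoint hw hΘ hβ hx.2) (fun α hα hc hs => ?_) ⟨hx₀, hx₁⟩
  rw [← L2_del_eq_chartAdjoint hw hΘ hβ x₀ hα hc (hs.trans inter_subset_left),
    ← L2_del_eq_chartAdjoint hw hΘ hβ x₁ hα hc (hs.trans inter_subset_right)]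

/-- The image of `β` under the adjoint of `∂`, glued from the local adjoints. -/
def adjointForm (w : M → Alt n 2) (Θ : M → Alt n n) (β : M → Alt n (k + 1)) (x : M) : Alt n k :=
  chartAdjoint w Θ β x x

lemma adjointForm_eq [T2Space M] (hw : IsHermitianMetric w) (hΘ : IsHolomorphicVolumeForm Θ)
    (hβ : SmoothForm β) {x₀ x : M} (hx : x ∈ (chartAt (Cn n) x₀).source) :
    adjointForm w Θ β x = chartAdjoint w Θ β x₀ x :=
  chartAdjoint_eq hw hΘ hβ (mem_chart_source _ _) hx

lemma smoothForm_adjointForm [T2Space M] (hw : IsHermitianMetric w)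
    (hΘ : IsHolomorphicVolumeForm Θ) (hβ : SmoothForm β) : SmoothForm (adjointForm w Θ β) := by
  refine smoothForm_iff.2 fun x => ?_
  refine (smoothFormAt_chartAdjoint hw hΘ hβ (mem_chart_source _ x)).congr ?_
  filter_upwards [(chartAt (Cn n) x).open_source.mem_nhds (mem_chart_source _ x)] with z hz
  exact adjointForm_eq hw hΘ hβ hz

lemma rep_adjointForm [T2Space M] (hw : IsHermitianMetric w) (hΘ : IsHolomorphicVolumeForm Θ)
    (hβ : SmoothForm β) {x₀ : M} {y : Cn n} (hy : y ∈ (chartAt (Cn n) x₀).target) :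
    rep x₀ (adjointForm w Θ β) y
      = localAdjoint (volDensity Θ x₀) (rep x₀ w) (rep x₀ β) y := by
  rw [← rep_chartAdjoint hy, rep_apply, rep_apply,
    adjointForm_eq hw hΘ hβ ((chartAt (Cn n) x₀).map_target hy)]

/-- The adjunction formula holds for test forms supported in one chart; a general test form is cut
by a partition of unity subordinate to the charts, of which only finitely many members meet its
support. -/
lemma isDelAdjoint_adjointForm [T2Space M] [SecondCountableTopology M] (hw : IsHermitianMetric w)
    (hΘ : IsHolomorphicVolumeForm Θ) (hβ : SmoothForm β) :
    IsDelAdjoint w Θ β (adjointForm w Θ β) := by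
  intro α hα hc
  have : IsManifold 𝓘(ℝ, Cn n) ∞ M := isManifold_real
  have : LocallyCompactSpace M := ChartedSpace.locallyCompactSpace (Cn n) M
  obtain ⟨f, hf⟩ := SmoothPartitionOfUnity.exists_isSubordinate (I := 𝓘(ℝ, Cn n)) (s := univ)
    isClosed_univ (fun x : M => (chartAt (Cn n) x).source) (fun x => (chartAt (Cn n) x).open_source)
    fun x _ => mem_iUnion_of_mem x (mem_chart_source _ x)
  have hfin := f.locallyFinite.finite_nonempty_inter_compact hc
  set s := hfin.toFinset with hs
  set a : M → M → Alt n k := fun i x => f i x • α x with ha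
  have hsum : α = fun x => ∑ i ∈ s, a i x := by
    funext x
    by_cases hx : x ∈ tsupport α
    · have h1 : ∑ᶠ i, f i x = 1 := f.sum_eq_one (mem_univ x)
      rw [finsum_eq_sum_of_support_subset _ (s := s)] at h1
      · rw [ha]
        simp only
        rw [← Finset.sum_smul, h1, one_smul]
      · intro i hi
        rw [hs, Finite.coe_toFinset]
        exact ⟨x, hi, hx⟩
    · have h0 := image_eq_zero_of_notMem_tsupport hx
      rw [h0]
      refine (Finset.sum_eq_zero fun i _ => ?_).symm
      rw [ha]
      simp only [h0]
      module
  have hsm : ∀ i, SmoothForm (a i) := fun i =>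
    smoothForm_smul (f i).contMDiff fun x _ => hα.smoothFormAt x
  have hzero : ∀ i x, x ∉ tsupport α → a i x = 0 := fun i x hx => by
    rw [ha]
    simp only [image_eq_zero_of_notMem_tsupport hx]
    module
  have hcs : ∀ i, HasCompactSupport (a i) := fun i =>
    HasCompactSupport.intro' hc (isClosed_tsupport α) (hzero i)
  have hts : ∀ i, tsupport (a i) ⊆ (chartAt (Cn n) i).source := fun i =>
    (closure_mono fun x hx => by
      rw [Function.mem_support] at hx ⊢
      intro hx'
      refine hx ?_
      rw [ha]
      simp only [hx']
      module).trans (hf i)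
  have hγ := smoothForm_adjointForm hw hΘ hβ
  clear_value a
  have hloc : ∀ i, L2 w Θ (del (a i)) β = L2 w Θ (a i) (adjointForm w Θ β) := by
    intro i
    refine (L2_del_eq_chartAdjoint hw hΘ hβ i (hsm i) (hcs i) (hts i)).trans
      (L2_congr_right fun x hx => ?_)
    exact (adjointForm_eq hw hΘ hβ (hts i (subset_tsupport _ hx))).symm
  have h1 : L2 w Θ (del α) β = ∑ i ∈ s, L2 w Θ (del (a i)) β := by
    simp only [L2]
    rw [← integral_finsetSum]
    · congr 1
      funext x
      conv_lhs => rw [hsum, del_sum s fun i _ => hsm i, hermInner_sum_left]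
    · intro i _
      refine integrable_hermInner hw hΘ (hsm i).del (hcs i) (isClosed_tsupport _)
        (fun x hx => del_eq_zero_of_notMem_tsupport hx) fun x _ => hβ.smoothFormAt x
  have h2 : L2 w Θ α (adjointForm w Θ β) = ∑ i ∈ s, L2 w Θ (a i) (adjointForm w Θ β) := by
    simp only [L2]
    rw [← integral_finsetSum]
    · congr 1
      funext x
      conv_lhs => rw [hsum, hermInner_sum_left]
    · intro i _
      exact integrable_hermInner hw hΘ (hsm i) hc (isClosed_tsupport _) (hzero i)
        fun x _ => hγ.smoothFormAt x
  rw [h1, h2]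
  exact Finset.sum_congr rfl fun i _ => hloc i

lemma IsDelAdjoint.unique [T2Space M] (hw : IsHermitianMetric w) (hΘ : IsHolomorphicVolumeForm Θ)
    {γ₁ γ₂ : M → Alt n k} (h₁ : SmoothForm γ₁) (h₂ : SmoothForm γ₂) (ha₁ : IsDelAdjoint w Θ β γ₁)
    (ha₂ : IsDelAdjoint w Θ β γ₂) : γ₁ = γ₂ := by
  funext x
  exact eqOn_of_L2_eq hw hΘ isOpen_univ (fun x _ => h₁.smoothFormAt x)
    (fun x _ => h₂.smoothFormAt x) (fun α hα hc _ => (ha₁ α hα hc).symm.trans (ha₂ α hα hc))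
    (mem_univ x)

variable [T2Space M] [SecondCountableTopology M]

lemma delDagger_eq_adjointForm (hw : IsHermitianMetric w) (hΘ : IsHolomorphicVolumeForm Θ)
    (hβ : SmoothForm β) : delDagger w Θ β = adjointForm w Θ β := by
  have h : ∃ γ : M → Alt n k, SmoothForm γ ∧ IsDelAdjoint w Θ β γ :=
    ⟨_, smoothForm_adjointForm hw hΘ hβ, isDelAdjoint_adjointForm hw hΘ hβ⟩
  rw [delDagger, dif_pos h]
  exact IsDelAdjoint.unique hw hΘ h.choose_spec.1 (smoothForm_adjointForm hw hΘ hβ)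
    h.choose_spec.2 (isDelAdjoint_adjointForm hw hΘ hβ)

/-- The adjoint of `∂` is well defined. -/
lemma isDelAdjoint_iff (hw : IsHermitianMetric w) (hΘ : IsHolomorphicVolumeForm Θ)
    (hβ : SmoothForm β) (γ : M → Alt n k) :
    (SmoothForm γ ∧ IsDelAdjoint w Θ β γ) ↔ γ = delDagger w Θ β := by
  rw [delDagger_eq_adjointForm hw hΘ hβ]
  constructor
  · rintro ⟨h1, h2⟩
    exact IsDelAdjoint.unique hw hΘ h1 (smoothForm_adjointForm hw hΘ hβ) h2
      (isDelAdjoint_adjointForm hw hΘ hβ)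
  · rintro rfl
    exact ⟨smoothForm_adjointForm hw hΘ hβ, isDelAdjoint_adjointForm hw hΘ hβ⟩

/-- The adjoint of `∂` in a chart:
`ρ ⟨A, ∂†β⟩ = - ∑ₗ ∂/∂zˡ (ρ ⟨dzˡ ∧ A, β⟩)` for all constant forms `A`. -/
lemma hermInner_rep_delDagger (hw : IsHermitianMetric w) (hΘ : IsHolomorphicVolumeForm Θ)
    (hβ : SmoothForm β) {x₀ : M} {y : Cn n} (hy : y ∈ (chartAt (Cn n) x₀).target) (A : Alt n k) :
    (volDensity Θ x₀ y : ℂ) * hermInner (rep x₀ w y) A (rep x₀ (delDagger w Θ β) y)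
      = -∑ l, wirt (.inl l) (delPairing (volDensity Θ x₀) (rep x₀ w) (rep x₀ β) l A) y := by
  rw [delDagger_eq_adjointForm hw hΘ hβ, rep_adjointForm hw hΘ hβ hy]
  exact hermInner_localAdjoint (hΘ.contDiffAt_volDensity hy) (hΘ.volDensity_pos hy).ne'
    (hw.smooth.contDiffAt hy) (hw.rep hy) (hβ.contDiffAt hy) A

end AdjointExistence

/-! ### Conformally balanced metrics -/

section FormCoefficients

variable {n k : ℕ}

lemma alt_coe_smul (r : ℝ) (α : Alt n k) : (r : ℂ) • α = r • α := by
  ext v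
  simp

lemma extMul_extWord_one (φ ψ : CoVec n) : extMul φ (extWord 1 ![ψ]) = extWord 2 ![φ, ψ] :=
  extMul_extWord _ _

lemma extMul_extWord_two (φ ψ χ : CoVec n) :
    extMul φ (extWord 2 ![ψ, χ]) = extWord 3 ![φ, ψ, χ] :=
  extMul_extWord _ _

/-- If a linear map takes the values of a form `a` to multiples `g τ` of a fixed element, it takes
the Wirtinger derivatives of `a` to the multiples by those of `g`. The target carries no topology:
it is tested by its linear functionals. -/
lemma map_wirt_eq_smul {N : Type*} [AddCommGroup N] [Module ℂ N] (L : Alt n k →ₗ[ℂ] N) (τ : N)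
    {a : Cn n → Alt n k} {g : Cn n → ℂ} {y : Cn n} (ha : DifferentiableAt ℝ a y)
    (hg : DifferentiableAt ℝ g y) (h : ∀ᶠ z in nhds y, L (a z) = g z • τ) (c : Fin n ⊕ Fin n) :
    L (wirt c a y) = wirt c g y • τ := by
  rw [← sub_eq_zero, ← Module.forall_dual_apply_eq_zero_iff ℂ]
  intro f
  have hd : FiniteDimensional ℂ (Alt n k) := inferInstance
  have h1 := wirt_linear (f ∘ₗ L) ha c
  have h2 : (fun z => (f ∘ₗ L) (a z)) =ᶠ[nhds y] fun z => f τ • g z := by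
    filter_upwards [h] with z hz
    rw [LinearMap.comp_apply, hz, map_smul, smul_eq_mul, smul_eq_mul, mul_comm]
  rw [h2.wirt_eq, wirt_const_smul (f τ) hg c, LinearMap.comp_apply] at h1
  rw [map_sub, ← h1, map_smul, smul_eq_mul, smul_eq_mul, mul_comm, sub_self]

lemma map_wirt_eq_zero {N : Type*} [AddCommGroup N] [Module ℂ N] (L : Alt n k →ₗ[ℂ] N)
    {a : Cn n → Alt n k} {y : Cn n} (ha : DifferentiableAt ℝ a y)
    (h : ∀ᶠ z in nhds y, L (a z) = 0) (c : Fin n ⊕ Fin n) : L (wirt c a y) = 0 := by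
  have := map_wirt_eq_smul L (0 : N) ha (differentiableAt_const (0 : ℂ))
    (h.mono fun z hz => by rw [hz, smul_zero]) c
  rwa [smul_zero] at this

/-- The coefficients of `‖Ω‖²_ω ωⁿ⁻¹` are those of `ρ g^{k̄ l}` up to this constant, where `ρ` is
the density of the volume form. -/
def powConst (n : ℕ) : ℂ := (volConst n : ℂ)⁻¹ * (((n - 1).factorial : ℂ) * -Complex.I * Complex.I ^ n)

lemma powConst_ne_zero : powConst n ≠ 0 := by
  have h1 : (volConst n : ℂ) ≠ 0 := Complex.ofReal_ne_zero.2 volConst_pos.ne'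
  have h2 : ((n - 1).factorial : ℂ) ≠ 0 := Nat.cast_ne_zero.2 (Nat.factorial_ne_zero _)
  exact mul_ne_zero (inv_ne_zero h1) (mul_ne_zero (mul_ne_zero h2 (neg_ne_zero.2 Complex.I_ne_zero))
    (pow_ne_zero _ Complex.I_ne_zero))

variable {w : Alt n 2} {r d : ℝ}

lemma IsHermitianForm.inv_mul (hw : IsHermitianForm w) :
    (-Complex.I • (hMat w)⁻¹) * (Complex.I • hMat w) = 1 := by
  rw [Matrix.smul_mul, Matrix.mul_smul, hw.inv_mul_hMat, smul_smul, neg_mul, Complex.I_mul_I,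
    neg_neg, one_smul]

lemma IsHermitianForm.incl_wedgePow (hw : IsHermitianForm w) (m : ℕ) :
    incl n (2 * m) (wedgePow w m) = (oneOneOp (Complex.I • hMat w) ^ m) (unitForm n) := by
  rw [← TypeIIB.incl_wedgePow, ← hw.eq_oneOne]

lemma IsHermitianForm.hermInner_inl_inl_self (hw : IsHermitianForm w) (l k : Fin n) :
    hermInner w (extWord 2 ![coframe (.inl l), coframe (.inl k)]) w = 0 :=
  (congrArg (hermInner w _) hw.eq_oneOne).trans (hw.hermInner_inl_inl l k _)

lemma det_I_smul (w : Alt n 2) : (Complex.I • hMat w).det = Complex.I ^ n * (hMat w).det := by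
  rw [Matrix.det_smul, Fintype.card_fin]

/-- `dzˡ ∧ dz̄ᵏ ∧ r ωⁿ⁻¹ = const · d g^{k̄ l} dz¹ ∧ dz̄¹ ∧ ⋯`, where `d = vol · r det g`. -/
lemma IsHermitianForm.xyOp_smul_wedgePow (hw : IsHermitianForm w)
    (hd : (volConst n : ℂ) * (r * (hMat w).det) = d) (l k : Fin n) :
    xyOp n l k (incl n _ (r • wedgePow w (n - 1)))
      = (powConst n * (d * (hMat w)⁻¹ k l)) • topForm n := by
  have h1 : (volConst n : ℂ) ≠ 0 := Complex.ofReal_ne_zero.2 volConst_pos.ne'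
  rw [← alt_coe_smul r, map_smul, map_smul, hw.incl_wedgePow,
    xyOp_oneOneOp_pow hw.inv_mul, smul_smul, det_I_smul, Matrix.smul_apply, smul_eq_mul, ← hd,
    powConst]
  congr 1
  field_simp

lemma IsHermitianForm.inl_inl_smul_wedgePow (hw : IsHermitianForm w) (l k : Fin n) :
    extOp (coframe (.inl l)) (extOp (coframe (.inl k)) (incl n _ (r • wedgePow w (n - 1)))) = 0 := by
  rw [← alt_coe_smul r, map_smul, map_smul, map_smul, hw.incl_wedgePow, inl_inl_oneOneOp_pow,
    smul_zero]

lemma IsHermitianForm.inr_inr_smul_wedgePow (hw : IsHermitianForm w) (l k : Fin n) :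
    extOp (coframe (.inr l)) (extOp (coframe (.inr k)) (incl n _ (r • wedgePow w (n - 1)))) = 0 := by
  rw [← alt_coe_smul r, map_smul, map_smul, map_smul, hw.incl_wedgePow, inr_inr_oneOneOp_pow,
    smul_zero]

end FormCoefficients

section Divergence

variable {n k : ℕ}

/-- The divergence `∑ₗ ∂/∂zˡ (ρ g^{k̄ l})`, for a metric `W` and a density `ρ` on an open subset
of `ℂⁿ`. -/
def divergence (ρ : Cn n → ℝ) (W : Cn n → Alt n 2) (k : Fin n) (y : Cn n) : ℂ :=
  ∑ l, wirt (.inl l) (fun z => (ρ z : ℂ) * (hMat (W z))⁻¹ k l) y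

variable {ρ : Cn n → ℝ} {W : Cn n → Alt n 2} {y : Cn n}

lemma _root_.ContDiffAt.hMat_inv (hW : ContDiffAt ℝ ∞ W y) (hy : IsHermitianForm (W y))
    (j k : Fin n) : ContDiffAt ℝ ∞ (fun z => (TypeIIB.hMat (W z))⁻¹ j k) y := by
  rw [← contDiffWithinAt_univ] at hW ⊢
  exact hW.hMat_inv hy j k

lemma _root_.ContDiffAt.ofReal (hρ : ContDiffAt ℝ ∞ ρ y) :
    ContDiffAt ℝ ∞ (fun z => (ρ z : ℂ)) y :=
  Complex.ofRealCLM.contDiff.contDiffAt.comp y hρ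

lemma contDiffAt_mul_hMat_inv (hρ : ContDiffAt ℝ ∞ ρ y) (hW : ContDiffAt ℝ ∞ W y)
    (hy : IsHermitianForm (W y)) (j k : Fin n) :
    ContDiffAt ℝ ∞ (fun z => (ρ z : ℂ) * (hMat (W z))⁻¹ j k) y :=
  hρ.ofReal.mul (hW.hMat_inv hy j k)

lemma conj_divergence (hρ : ContDiffAt ℝ ∞ ρ y) (hW : ContDiffAt ℝ ∞ W y)
    (hy : ∀ᶠ z in nhds y, IsHermitianForm (W z)) (k : Fin n) :
    (starRingEnd ℂ) (divergence ρ W k y)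
      = ∑ l, wirt (.inr l) (fun z => (ρ z : ℂ) * (hMat (W z))⁻¹ l k) y := by
  rw [divergence, map_sum]
  refine Finset.sum_congr rfl fun l _ => ?_
  have h := wirt_conj ((contDiffAt_mul_hMat_inv hρ hW hy.self_of_nhds k l).differentiableAt
    (by simp)) (.inr l)
  refine h.symm.trans (Filter.EventuallyEq.wirt_eq ?_ _)
  filter_upwards [hy] with z hz
  rw [map_mul, Complex.conj_ofReal, hz.conj_inv]

variable {r : Cn n → ℝ} {Φ : Cn n → Alt n (2 * (n - 1))}

/-- The form `r ωⁿ⁻¹` is closed if and only if the divergence vanishes, `ρ` being the product of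
`r` and the volume density of `ω`. -/
lemma extDeriv_eq_zero_iff (hn : 1 ≤ n) (hρ : ContDiffAt ℝ ∞ ρ y) (hW : ContDiffAt ℝ ∞ W y)
    (hy : ∀ᶠ z in nhds y, IsHermitianForm (W z)) (hΦ : DifferentiableAt ℝ Φ y)
    (hd : ∀ᶠ z in nhds y, (volConst n : ℂ) * (r z * (hMat (W z)).det) = ρ z)
    (hΦW : ∀ᶠ z in nhds y, Φ z = r z • wedgePow (W z) (n - 1)) :
    extDeriv Φ y = 0 ↔ ∀ k, divergence ρ W k y = 0 := by
  have hu : ∀ k l, DifferentiableAt ℝ (fun z => (ρ z : ℂ) * (hMat (W z))⁻¹ k l) y := fun k l =>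
    (contDiffAt_mul_hMat_inv hρ hW hy.self_of_nhds k l).differentiableAt (by simp)
  have hxy : ∀ (l k : Fin n) c, xyOp n l k (incl n _ (wirt c Φ y))
      = (powConst n * wirt c (fun z => (ρ z : ℂ) * (hMat (W z))⁻¹ k l) y) • topForm n := by
    intro l k c
    have h := map_wirt_eq_smul (xyOp n l k ∘ₗ incl n _) (topForm n) hΦ
      ((hu k l).const_mul (powConst n)) (by
        filter_upwards [hy, hd, hΦW] with z h1 h2 h3
        rw [LinearMap.comp_apply, h3, h1.xyOp_smul_wedgePow h2]) c
    rw [LinearMap.comp_apply] at h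
    rw [h]
    congr 1
    exact wirt_const_smul (powConst n) (hu k l) c
  have hxx : ∀ (l k : Fin n) c, extOp (coframe (.inl l)) (extOp (coframe (.inl k))
      (incl n _ (wirt c Φ y))) = 0 := fun l k c =>
    map_wirt_eq_zero (extOp (coframe (.inl l)) ∘ₗ extOp (coframe (.inl k)) ∘ₗ incl n _) hΦ (by
      filter_upwards [hy, hΦW] with z h1 h3
      rw [LinearMap.comp_apply, LinearMap.comp_apply, h3, h1.inl_inl_smul_wedgePow]) c
  have hyy : ∀ (l k : Fin n) c, extOp (coframe (.inr l)) (extOp (coframe (.inr k))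
      (incl n _ (wirt c Φ y))) = 0 := fun l k c =>
    map_wirt_eq_zero (extOp (coframe (.inr l)) ∘ₗ extOp (coframe (.inr k)) ∘ₗ incl n _) hΦ (by
      filter_upwards [hy, hΦW] with z h1 h3
      rw [LinearMap.comp_apply, LinearMap.comp_apply, h3, h1.inr_inr_smul_wedgePow]) c
  have hdr : ∀ k, incl n _ (extMul (coframe (.inr k)) (extDeriv Φ y))
      = (-(powConst n * divergence ρ W k y)) • topForm n := by
    intro k
    rw [← extOp_incl, extDeriv_eq_sum, map_sum, map_sum, Fintype.sum_sum_type]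
    simp only [← extOp_incl, hyy, Finset.sum_const_zero, add_zero]
    rw [divergence, Finset.mul_sum, ← Finset.sum_neg_distrib, Finset.sum_smul]
    refine Finset.sum_congr rfl fun l _ => ?_
    rw [neg_smul, ← hxy, xyOp, ← LinearMap.neg_apply, ← extOp_anticomm]
    rfl
  have hdl : ∀ k, incl n _ (extMul (coframe (.inl k)) (extDeriv Φ y))
      = (powConst n * (starRingEnd ℂ) (divergence ρ W k y)) • topForm n := by
    intro k
    rw [← extOp_incl, extDeriv_eq_sum, map_sum, map_sum, Fintype.sum_sum_type]
    simp only [← extOp_incl, hxx, Finset.sum_const_zero, zero_add]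
    rw [conj_divergence hρ hW hy, Finset.mul_sum, Finset.sum_smul]
    exact Finset.sum_congr rfl fun l _ => hxy k l _
  constructor
  · intro h k
    have := hdr k
    rw [h, map_zero, map_zero, eq_comm, smul_eq_zero] at this
    rcases this with h0 | h0
    · exact (mul_eq_zero.1 (neg_eq_zero.1 h0)).resolve_left powConst_ne_zero
    · exact absurd h0 topForm_ne_zero
  · intro h
    refine eq_zero_of_extMul_coframe_eq_zero (by omega) _ fun c => incl_injective ?_
    rcases c with k | k
    · rw [hdl, h, map_zero, mul_zero, zero_smul, map_zero]
    · rw [hdr, h, mul_zero, neg_zero, zero_smul, map_zero]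

end Divergence

lemma rep_zero_form {n k : ℕ} {M : Type*} [TopologicalSpace M] [ChartedSpace (Cn n) M] (x₀ : M)
    (y : Cn n) : rep x₀ (0 : M → Alt n k) y = 0 := by
  rw [rep_apply]
  rfl

section Balanced

variable {n : ℕ} {M : Type*} [TopologicalSpace M] [ChartedSpace (Cn n) M]
  [IsManifold 𝓘(ℂ, Cn n) ∞ M] {w : M → Alt n 2} {Θ : M → Alt n n} {x₀ : M} {y : Cn n}

lemma IsHermitianMetric.eventually_rep (hw : IsHermitianMetric w)
    (hy : y ∈ (chartAt (Cn n) x₀).target) : ∀ᶠ z in nhds y, IsHermitianForm (TypeIIB.rep x₀ w z) := by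
  filter_upwards [(chartAt (Cn n) x₀).open_target.mem_nhds hy] with z hz using hw.rep hz

lemma contDiffAt_rep_weightedPow (hw : IsHermitianMetric w) (hΘ : IsHolomorphicVolumeForm Θ) (m : ℕ)
    (hy : y ∈ (chartAt (Cn n) x₀).target) : ContDiffAt ℝ ∞ (rep x₀ (weightedPow w Θ m)) y := by
  have h : rep x₀ (weightedPow w Θ m) =ᶠ[nhds y]
      fun z => ((normSq (rep x₀ w z) (rep x₀ Θ z) : ℝ) : ℂ) • wedgePow (rep x₀ w z) m := by
    filter_upwards [(chartAt (Cn n) x₀).open_target.mem_nhds hy] with z hz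
    rw [rep_weightedPow w Θ m hz, alt_coe_smul]
  refine ContDiffAt.congr_of_eventuallyEq ?_ h
  have h1 := hw.smooth.contDiffAt hy
  have h2 := hΘ.smooth.contDiffAt hy
  rw [← contDiffWithinAt_univ] at h1 h2 ⊢
  exact (h1.normSq (hw.rep hy) h2).ofReal.alt_smul (h1.wedgePow m)

/-- `d(‖Ω‖²_ω ωⁿ⁻¹) = 0` says that `ρ g^{k̄ l}` is divergence free, because the coefficients of
`‖Ω‖²_ω ωⁿ⁻¹` are constant multiples of `ρ g^{k̄ l}`. -/
lemma extDeriv_rep_weightedPow_eq_zero_iff (hn : 1 ≤ n) (hw : IsHermitianMetric w)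
    (hΘ : IsHolomorphicVolumeForm Θ) (hy : y ∈ (chartAt (Cn n) x₀).target) :
    extDeriv (rep x₀ (weightedPow w Θ (n - 1))) y = 0
      ↔ ∀ k, divergence (volDensity Θ x₀) (rep x₀ w) k y = 0 := by
  have hU := (chartAt (Cn n) x₀).open_target.mem_nhds hy
  refine extDeriv_eq_zero_iff (r := fun z => normSq (rep x₀ w z) (rep x₀ Θ z)) hn
    (hΘ.contDiffAt_volDensity hy) (hw.smooth.contDiffAt hy) (hw.eventually_rep hy)
    ((contDiffAt_rep_weightedPow hw hΘ _ hy).differentiableAt (by simp)) ?_ ?_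
  · filter_upwards [hU] with z hz using volConst_mul_normSq_mul_det hw hΘ hz
  · filter_upwards [hU] with z hz using rep_weightedPow w Θ _ hz

variable [MeasurableSpace M] [BorelSpace M] [T2Space M] [SecondCountableTopology M]

/-- `∂†ω = 0` says that `ρ g^{k̄ l}` is divergence free, because `⟨dzˡ ∧ dz̄ᵏ, ω⟩` is a constant
multiple of `g^{k̄ l}`. -/
lemma rep_delDagger_self_eq_zero_iff (hw : IsHermitianMetric w) (hΘ : IsHolomorphicVolumeForm Θ)
    (hy : y ∈ (chartAt (Cn n) x₀).target) : rep x₀ (delDagger w Θ w) y = 0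
      ↔ ∀ k, divergence (volDensity Θ x₀) (rep x₀ w) k y = 0 := by
  have hρ : (volDensity Θ x₀ y : ℂ) ≠ 0 := Complex.ofReal_ne_zero.2 (hΘ.volDensity_pos hy).ne'
  have hU := hw.eventually_rep hy
  have hr : ∀ k, (volDensity Θ x₀ y : ℂ) * hermInner (rep x₀ w y) (extWord 1 ![coframe (.inr k)])
      (rep x₀ (delDagger w Θ w) y)
        = Complex.I * divergence (volDensity Θ x₀) (rep x₀ w) k y := by
    intro k
    rw [hermInner_rep_delDagger hw hΘ hw.smooth hy, divergence, Finset.mul_sum,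
      ← Finset.sum_neg_distrib]
    refine Finset.sum_congr rfl fun l _ => ?_
    have h1 : delPairing (volDensity Θ x₀) (rep x₀ w) (rep x₀ w) l (extWord 1 ![coframe (.inr k)])
        =ᶠ[nhds y] fun z => (-Complex.I) • ((volDensity Θ x₀ z : ℂ) * (hMat (rep x₀ w z))⁻¹ k l) := by
      filter_upwards [hU] with z hz
      rw [delPairing, extMul_extWord_one, hz.hermInner_self, smul_eq_mul]
      ring
    rw [h1.wirt_eq, wirt_const_smul _ ((contDiffAt_mul_hMat_inv (hΘ.contDiffAt_volDensity hy)
      (hw.smooth.contDiffAt hy) (hw.rep hy) k l).differentiableAt (by simp)), smul_eq_mul]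
    ring
  have hl : ∀ k, hermInner (rep x₀ w y) (extWord 1 ![coframe (.inl k)])
      (rep x₀ (delDagger w Θ w) y) = 0 := by
    intro k
    refine (mul_eq_zero.1 ?_).resolve_left hρ
    rw [hermInner_rep_delDagger hw hΘ hw.smooth hy, neg_eq_zero]
    refine Finset.sum_eq_zero fun l _ => ?_
    have h1 : delPairing (volDensity Θ x₀) (rep x₀ w) (rep x₀ w) l (extWord 1 ![coframe (.inl k)])
        =ᶠ[nhds y] fun z => 0 := by
      filter_upwards [hU] with z hz
      rw [delPairing, extMul_extWord_one, hz.hermInner_inl_inl_self, mul_zero]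
    rw [h1.wirt_eq, wirt_const]
  constructor
  · intro h k
    have := hr k
    rw [h, hermInner_zero_right, mul_zero, eq_comm] at this
    exact (mul_eq_zero.1 this).resolve_left Complex.I_ne_zero
  · intro h
    refine (hw.rep hy).eq_of_hermInner_extWord_eq fun e => ?_
    rw [hermInner_zero_right]
    have he : (fun i => coframe (n := n) (e i)) = ![coframe (e 0)] := by
      funext i
      fin_cases i
      rfl
    rw [he]
    rcases e 0 with k | k
    · exact hl k
    · refine (mul_eq_zero.1 ?_).resolve_left hρ
      rw [hr, h, mul_zero]

lemma conformallyBalanced_iff_delDagger (hn : 1 ≤ n) (hw : IsHermitianMetric w)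
    (hΘ : IsHolomorphicVolumeForm Θ) : ConformallyBalanced w Θ ↔ delDagger w Θ w = 0 := by
  have h : ∀ x, extD (weightedPow w Θ (n - 1)) x = 0 ↔ delDagger w Θ w x = 0 := fun x => by
    rw [← rep_self (delDagger w Θ w) x,
      rep_delDagger_self_eq_zero_iff hw hΘ (mem_chart_target _ _),
      ← extDeriv_rep_weightedPow_eq_zero_iff hn hw hΘ (mem_chart_target _ _), extD]
  exact ⟨fun hb => funext fun x => (h x).1 (hb x), fun h0 x => (h x).2 (congrFun h0 x)⟩

lemma conformallyBalanced_iff_divergence (hn : 1 ≤ n) (hw : IsHermitianMetric w)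
    (hΘ : IsHolomorphicVolumeForm Θ) : ConformallyBalanced w Θ ↔
      ∀ x₀ : M, ∀ y ∈ (chartAt (Cn n) x₀).target, ∀ k,
        divergence (volDensity Θ x₀) (rep x₀ w) k y = 0 := by
  constructor
  · intro h x₀ y hy
    rw [← rep_delDagger_self_eq_zero_iff hw hΘ hy,
      (conformallyBalanced_iff_delDagger hn hw hΘ).1 h, rep_zero_form]
  · intro h x
    exact (extDeriv_rep_weightedPow_eq_zero_iff hn hw hΘ (mem_chart_target _ _)).2
      (h x _ (mem_chart_target _ _))

end Balanced

/-! ### Preservation of the balanced condition along the flows -/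

section TimeDependence

variable {n : ℕ} {J : Set ℝ} {U : Set (Cn n)} {F : ℝ × Cn n → ℂ} {t : ℝ} {y : Cn n}

lemma interior_nonempty_of_ordConnected (hJ : J.OrdConnected) (hJ' : J.Nontrivial) :
    (interior J).Nonempty := by
  obtain ⟨a, ha, b, hb, hab⟩ := hJ'.exists_lt
  have h : Ioo a b ⊆ interior J :=
    interior_maximal (Ioo_subset_Icc_self.trans (hJ.out ha hb)) isOpen_Ioo
  exact (nonempty_Ioo.2 hab).mono h

lemma uniqueDiffOn_of_ordConnected (hJ : J.OrdConnected) (hJ' : J.Nontrivial) :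
    UniqueDiffOn ℝ J :=
  uniqueDiffOn_convex hJ.convex (interior_nonempty_of_ordConnected hJ hJ')

lemma hasDerivWithinAt_slice (hF : ContDiffOn ℝ ∞ F (J ×ˢ U)) (ht : t ∈ J) (hy : y ∈ U) :
    HasDerivWithinAt (fun s => F (s, y)) (fderivWithin ℝ F (J ×ˢ U) (t, y) (1, 0)) J t := by
  have h := (hF.differentiableOn (by simp) (t, y) ⟨ht, hy⟩).hasFDerivWithinAt
  have h1 : HasDerivWithinAt (fun s : ℝ => (s, y)) ((1 : ℝ), (0 : Cn n)) J t :=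
    (hasDerivAt_id t).hasDerivWithinAt.prodMk (hasDerivWithinAt_const _ _ _)
  exact h.comp_hasDerivWithinAt t h1 fun s hs => mk_mem_prod hs hy

lemma hasFDerivAt_slice (hU : IsOpen U) (hF : ContDiffOn ℝ ∞ F (J ×ˢ U)) (ht : t ∈ J) (hy : y ∈ U) :
    HasFDerivAt (fun z => F (t, z))
      ((fderivWithin ℝ F (J ×ˢ U) (t, y)).comp (ContinuousLinearMap.inr ℝ ℝ (Cn n))) y := by
  have h := (hF.differentiableOn (by simp) (t, y) ⟨ht, hy⟩).hasFDerivWithinAt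
  have h1 : HasFDerivWithinAt (fun z : Cn n => (t, z)) (ContinuousLinearMap.inr ℝ ℝ (Cn n)) U y :=
    (hasFDerivAt_prodMk_right t y).hasFDerivWithinAt
  exact (h.comp y h1 fun z hz => mk_mem_prod ht hz).hasFDerivAt (hU.mem_nhds hy)

/-- Time derivatives and Wirtinger derivatives commute. -/
lemma hasDerivWithinAt_wirt (hJ : J.OrdConnected) (hJ' : J.Nontrivial) (hU : IsOpen U)
    (hF : ContDiffOn ℝ ∞ F (J ×ˢ U)) (ht : t ∈ J) (hy : y ∈ U) (c : Fin n ⊕ Fin n) :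
    HasDerivWithinAt (fun s => wirt c (fun z => F (s, z)) y)
      (wirt c (fun z => derivWithin (fun s => F (s, z)) J t) y) J t := by
  have hJu := uniqueDiffOn_of_ordConnected hJ hJ'
  have hSu : UniqueDiffOn ℝ (J ×ˢ U) := hJu.prod hU.uniqueDiffOn
  set D := fderivWithin ℝ F (J ×ˢ U) with hD
  have hD' : HasFDerivWithinAt D (fderivWithin ℝ D (J ×ˢ U) (t, y)) (J ×ˢ U) (t, y) := by
    have : ContDiffOn ℝ ∞ D (J ×ˢ U) := hF.fderivWithin hSu (by simp)
    exact (this.differentiableOn (by simp) (t, y) ⟨ht, hy⟩).hasFDerivWithinAt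
  have hsymm : IsSymmSndFDerivWithinAt ℝ F (J ×ˢ U) (t, y) := by
    refine (hF (t, y) ⟨ht, hy⟩).isSymmSndFDerivWithinAt
      (by simpa using WithTop.coe_le_coe.2 (le_top (a := (2 : ℕ∞)))) hSu ?_ ⟨ht, hy⟩
    rw [interior_prod_eq, closure_prod_eq, hU.interior_eq,
      (hJ.convex (𝕜 := ℝ)).closure_interior_eq_closure_of_nonempty_interior
        (interior_nonempty_of_ordConnected hJ hJ')]
    exact ⟨subset_closure ht, subset_closure hy⟩
  have h1 : ∀ v : Cn n, HasDerivWithinAt (fun s => D (s, y) (0, v))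
      (fderivWithin ℝ D (J ×ˢ U) (t, y) (1, 0) (0, v)) J t := by
    intro v
    have h2 : HasDerivWithinAt (fun s : ℝ => (s, y)) ((1 : ℝ), (0 : Cn n)) J t :=
      (hasDerivAt_id t).hasDerivWithinAt.prodMk (hasDerivWithinAt_const _ _ _)
    have h3 := hD'.comp_hasDerivWithinAt t h2 fun s hs => mk_mem_prod hs hy
    exact (ContinuousLinearMap.apply ℝ ℂ ((0 : ℝ), v)).hasFDerivAt.comp_hasDerivWithinAt t h3
  have h2 : ∀ v : Cn n, fderiv ℝ (fun z => derivWithin (fun s => F (s, z)) J t) y v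
      = fderivWithin ℝ D (J ×ˢ U) (t, y) (0, v) (1, 0) := by
    intro v
    have h3 : (fun z => derivWithin (fun s => F (s, z)) J t) =ᶠ[nhds y]
        fun z => D (t, z) (1, 0) := by
      filter_upwards [hU.mem_nhds hy] with z hz
      exact (hasDerivWithinAt_slice hF ht hz).derivWithin (hJu t ht)
    have h4 : HasFDerivWithinAt (fun z : Cn n => (t, z)) (ContinuousLinearMap.inr ℝ ℝ (Cn n)) U y :=
      (hasFDerivAt_prodMk_right t y).hasFDerivWithinAt
    have h5 := (hD'.comp y h4 fun z hz => mk_mem_prod ht hz).hasFDerivAt (hU.mem_nhds hy)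
    have h6 := (ContinuousLinearMap.apply ℝ ℂ ((1 : ℝ), (0 : Cn n))).hasFDerivAt.comp y h5
    rw [h3.fderiv_eq]
    exact congrArg (fun L : Cn n →L[ℝ] ℂ => L v) h6.fderiv
  have h3 : ∀ s ∈ J, wirt c (fun z => F (s, z)) y
      = (2⁻¹ : ℂ) * (D (s, y) (0, EuclideanSpace.single (coordIndex c) 1)
        - coordUnit c * D (s, y) (0, EuclideanSpace.single (coordIndex c) Complex.I)) := by
    intro s hs
    rw [wirt, (hasFDerivAt_slice hU hF hs hy).fderiv]
    rfl
  have h4 : wirt c (fun z => derivWithin (fun s => F (s, z)) J t) y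
      = (2⁻¹ : ℂ) * (fderivWithin ℝ D (J ×ˢ U) (t, y) (1, 0)
          (0, EuclideanSpace.single (coordIndex c) 1)
        - coordUnit c * fderivWithin ℝ D (J ×ˢ U) (t, y) (1, 0)
          (0, EuclideanSpace.single (coordIndex c) Complex.I)) := by
    rw [wirt, h2, h2, hsymm (1, 0), hsymm (1, 0)]
    rfl
  rw [h4]
  exact (((h1 _).sub ((h1 _).const_mul _)).const_mul _).congr h3 (h3 t ht)

end TimeDependence

section Preservation

variable {n : ℕ} {ρ : Cn n → ℝ} {y : Cn n}

/-- The divergence of an antisymmetric field of coefficients has divergence zero. -/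
lemma sum_wirt_sum_wirt_eq_zero {S : Fin n → Fin n → Cn n → ℂ}
    (hS : ∀ l j, ContDiffAt ℝ ∞ (S l j) y)
    (hanti : ∀ l j, ∀ᶠ z in nhds y, S l j z = -S j l z) :
    ∑ j, wirt (.inl j) (fun z => ∑ l, wirt (.inl l) (S l j) z) y = 0 := by
  have h1 : ∀ j, wirt (.inl j) (fun z => ∑ l, wirt (.inl l) (S l j) z) y
      = ∑ l, wirt (.inl j) (wirt (.inl l) (S l j)) y := fun j =>
    wirt_sum _ (fun l _ => ((hS l j).wirt _).differentiableAt (by simp)) _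
  have h2 : ∀ l j, wirt (.inl j) (wirt (.inl l) (S l j)) y
      = -wirt (.inl l) (wirt (.inl j) (S j l)) y := by
    intro l j
    have h3 : wirt (.inl l) (S l j) =ᶠ[nhds y] fun z => (-1 : ℂ) • wirt (.inl l) (S j l) z := by
      have h4 : S l j =ᶠ[nhds y] fun z => (-1 : ℂ) • S j l z := by
        filter_upwards [hanti l j] with z hz
        rw [hz, neg_one_smul]
      refine (h4.wirt _).trans ?_
      have h5 := ((hS j l).of_le (m := 1) (by simp)).eventually (by simp)
      filter_upwards [h5] with z hz
      exact wirt_const_smul _ (hz.differentiableAt (by simp)) _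
    rw [h3.wirt_eq, wirt_const_smul _ (((hS j l).wirt _).differentiableAt (by simp)),
      wirt_comm (hS j l), neg_one_smul]
  simp only [h1]
  have h3 : ∑ j, ∑ l, wirt (.inl j) (wirt (.inl l) (S l j)) y
      = -∑ j, ∑ l, wirt (.inl j) (wirt (.inl l) (S l j)) y := by
    conv_lhs => rw [Finset.sum_comm]
    rw [← Finset.sum_neg_distrib]
    refine Finset.sum_congr rfl fun l _ => ?_
    rw [← Finset.sum_neg_distrib]
    exact Finset.sum_congr rfl fun j _ => h2 l j
  exact self_eq_neg.1 h3

variable {J : Set ℝ} {U : Set (Cn n)} {W : ℝ → Cn n → Alt n 2}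

lemma contDiffOn_mul_hMat_inv (hρ : ContDiffOn ℝ ∞ ρ U)
    (hW : ContDiffOn ℝ ∞ (fun p : ℝ × Cn n => W p.1 p.2) (J ×ˢ U))
    (hpos : ∀ t ∈ J, ∀ z ∈ U, IsHermitianForm (W t z)) (k j : Fin n) :
    ContDiffOn ℝ ∞ (fun p : ℝ × Cn n => (ρ p.2 : ℂ) * (hMat (W p.1 p.2))⁻¹ k j) (J ×ˢ U) := by
  intro p hp
  have h1 : ContDiffWithinAt ℝ ∞ (fun p : ℝ × Cn n => ρ p.2) (J ×ˢ U) p :=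
    (hρ p.2 hp.2).comp p contDiff_snd.contDiffWithinAt fun q hq => hq.2
  exact h1.ofReal.mul ((hW p hp).hMat_inv (hpos _ hp.1 _ hp.2) k j)

/-- If the density `ρ g^{k̄ j}` evolves by the divergence of an antisymmetric field, then its own
divergence is constant in time. -/
lemma divergence_eq_zero_of_evolution (hJ : J.OrdConnected) (hJ' : J.Nontrivial) (hU : IsOpen U)
    (hρ : ContDiffOn ℝ ∞ ρ U)
    (hW : ContDiffOn ℝ ∞ (fun p : ℝ × Cn n => W p.1 p.2) (J ×ˢ U))
    (hpos : ∀ t ∈ J, ∀ z ∈ U, IsHermitianForm (W t z)) {c : ℂ} {k : Fin n}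
    {S : ℝ → Fin n → Fin n → Cn n → ℂ}
    (hS : ∀ t ∈ J, ∀ z ∈ U, ∀ l j, ContDiffAt ℝ ∞ (S t l j) z)
    (hanti : ∀ t ∈ J, ∀ z ∈ U, ∀ l j, S t l j z = -S t j l z)
    (hev : ∀ t ∈ J, ∀ z ∈ U, ∀ j, (ρ z : ℂ) * derivWithin (fun s => (hMat (W s z))⁻¹ k j) J t
      = c * ∑ l, wirt (.inl l) (S t l j) z)
    {t₀ : ℝ} (ht₀ : t₀ ∈ J) (hy : y ∈ U) (h0 : divergence ρ (W t₀) k y = 0) {t : ℝ} (ht : t ∈ J) :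
    divergence ρ (W t) k y = 0 := by
  have hJu := uniqueDiffOn_of_ordConnected hJ hJ'
  have hder : ∀ t ∈ J, HasDerivWithinAt (fun s => divergence ρ (W s) k y) 0 J t := by
    intro t ht
    have h1 := HasDerivWithinAt.fun_sum (u := Finset.univ) fun l _ =>
      hasDerivWithinAt_wirt hJ hJ' hU (contDiffOn_mul_hMat_inv hρ hW hpos k l) ht hy (.inl l)
    refine h1.congr_deriv ?_
    have h2 : ∀ l, (fun z => derivWithin (fun s => (ρ z : ℂ) * (hMat (W s z))⁻¹ k l) J t)
        =ᶠ[nhds y] fun z => c • ∑ m, wirt (.inl m) (S t m l) z := by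
      intro l
      filter_upwards [hU.mem_nhds hy] with z hz
      rw [derivWithin_const_mul_field, hev t ht z hz, smul_eq_mul]
    have h3 : ∀ l, DifferentiableAt ℝ (fun z => ∑ m, wirt (.inl m) (S t m l) z) y := fun l =>
      DifferentiableAt.fun_sum fun m _ => ((hS t ht y hy m l).wirt _).differentiableAt (by simp)
    calc _ = ∑ l, c • wirt (.inl l) (fun z => ∑ m, wirt (.inl m) (S t m l) z) y :=
          Finset.sum_congr rfl fun l _ => by rw [(h2 l).wirt_eq, wirt_const_smul c (h3 l)]
      _ = 0 := by
          rw [← Finset.smul_sum, sum_wirt_sum_wirt_eq_zero (hS t ht y hy) fun l j => by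
            filter_upwards [hU.mem_nhds hy] with z hz using hanti t ht z hz l j, smul_zero]
  rw [← h0]
  refine (hJ.convex (𝕜 := ℝ)).is_const_of_fderivWithin_eq_zero (𝕜 := ℝ)
    (fun t ht => (hder t ht).differentiableWithinAt) (fun t ht => ?_) ht ht₀
  have := (hder t ht).hasFDerivWithinAt.fderivWithin (hJu t ht)
  rw [this]
  ext
  simp

end Preservation

/-! ### The right-hand sides of the flows in coordinates -/

section Fluxes

variable {n : ℕ}

/-- The coefficients `ρ (g^{p̄ l} ∂_p̄ g^{k̄ j} - g^{p̄ j} ∂_p̄ g^{k̄ l})`, whose divergence in `l` gives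
the coefficients of `∂†∂ω`. -/
def laplacianFlux (ρ : Cn n → ℝ) (W : Cn n → Alt n 2) (k l j : Fin n) (y : Cn n) : ℂ :=
  (ρ y : ℂ) * ∑ p, ((hMat (W y))⁻¹ p l * wirt (.inr p) (fun z => (hMat (W z))⁻¹ k j) y
    - (hMat (W y))⁻¹ p j * wirt (.inr p) (fun z => (hMat (W z))⁻¹ k l) y)

/-- The coefficients `∂_m̄ (ρ (g^{m̄ l} g^{k̄ j} - g^{m̄ j} g^{k̄ l}))`, whose divergence in `l` gives
the coefficients of `∂∂̄(‖Ω‖²_ω ωⁿ⁻²)`. -/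
def typeIIBFlux (ρ : Cn n → ℝ) (W : Cn n → Alt n 2) (k l j : Fin n) (y : Cn n) : ℂ :=
  ∑ m, wirt (.inr m) (fun z => (ρ z : ℂ) * ((hMat (W z))⁻¹ m l * (hMat (W z))⁻¹ k j
    - (hMat (W z))⁻¹ m j * (hMat (W z))⁻¹ k l)) y

variable {ρ : Cn n → ℝ} {W : Cn n → Alt n 2} {y : Cn n}

lemma laplacianFlux_antisymm (k l j : Fin n) :
    laplacianFlux ρ W k l j y = -laplacianFlux ρ W k j l y := by
  rw [laplacianFlux, laplacianFlux, ← mul_neg, ← Finset.sum_neg_distrib]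
  simp only [neg_sub]

lemma contDiffAt_laplacianFlux (hρ : ContDiffAt ℝ ∞ ρ y) (hW : ContDiffAt ℝ ∞ W y)
    (hy : IsHermitianForm (W y)) (k l j : Fin n) : ContDiffAt ℝ ∞ (laplacianFlux ρ W k l j) y :=
  hρ.ofReal.mul (ContDiffAt.sum fun p _ =>
    ((hW.hMat_inv hy p l).mul ((hW.hMat_inv hy k j).wirt _)).sub
      ((hW.hMat_inv hy p j).mul ((hW.hMat_inv hy k l).wirt _)))

lemma contDiffAt_minor (hρ : ContDiffAt ℝ ∞ ρ y) (hW : ContDiffAt ℝ ∞ W y)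
    (hy : IsHermitianForm (W y)) (k l j m : Fin n) : ContDiffAt ℝ ∞ (fun z => (ρ z : ℂ) *
      ((hMat (W z))⁻¹ m l * (hMat (W z))⁻¹ k j - (hMat (W z))⁻¹ m j * (hMat (W z))⁻¹ k l)) y :=
  hρ.ofReal.mul (((hW.hMat_inv hy m l).mul (hW.hMat_inv hy k j)).sub
    ((hW.hMat_inv hy m j).mul (hW.hMat_inv hy k l)))

lemma contDiffAt_typeIIBFlux (hρ : ContDiffAt ℝ ∞ ρ y) (hW : ContDiffAt ℝ ∞ W y)
    (hy : IsHermitianForm (W y)) (k l j : Fin n) : ContDiffAt ℝ ∞ (typeIIBFlux ρ W k l j) y :=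
  ContDiffAt.sum fun m _ => (contDiffAt_minor hρ hW hy k l j m).wirt _

lemma typeIIBFlux_antisymm (hρ : ContDiffAt ℝ ∞ ρ y) (hW : ContDiffAt ℝ ∞ W y)
    (hy : IsHermitianForm (W y)) (k l j : Fin n) :
    typeIIBFlux ρ W k l j y = -typeIIBFlux ρ W k j l y := by
  rw [typeIIBFlux, typeIIBFlux, ← Finset.sum_neg_distrib]
  refine Finset.sum_congr rfl fun m _ => ?_
  rw [← neg_one_smul ℂ, ← wirt_const_smul _
    ((contDiffAt_minor hρ hW hy k j l m).differentiableAt (by simp))]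
  congr 1
  funext z
  rw [smul_eq_mul]
  ring

/-- For balanced metrics the two fluxes agree: the derivatives fall on the factors `g^{k̄ j}`
only. -/
lemma typeIIBFlux_eq_laplacianFlux (hρ : ContDiffAt ℝ ∞ ρ y) (hW : ContDiffAt ℝ ∞ W y)
    (hy : ∀ᶠ z in nhds y, IsHermitianForm (W z)) (hdiv : ∀ k, divergence ρ W k y = 0)
    (k l j : Fin n) : typeIIBFlux ρ W k l j y = laplacianFlux ρ W k l j y := by
  have hH : ∀ a b, DifferentiableAt ℝ (fun z => (hMat (W z))⁻¹ a b) y := fun a b =>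
    (hW.hMat_inv hy.self_of_nhds a b).differentiableAt (by simp)
  have hρH : ∀ a b, DifferentiableAt ℝ (fun z => (ρ z : ℂ) * (hMat (W z))⁻¹ a b) y := fun a b =>
    (contDiffAt_mul_hMat_inv hρ hW hy.self_of_nhds a b).differentiableAt (by simp)
  have hc : ∀ a, ∑ m, wirt (.inr m) (fun z => (ρ z : ℂ) * (hMat (W z))⁻¹ m a) y = 0 := fun a => by
    rw [← conj_divergence hρ hW hy, hdiv, map_zero]
  have h1 : ∀ m, wirt (.inr m) (fun z => (ρ z : ℂ) * ((hMat (W z))⁻¹ m l * (hMat (W z))⁻¹ k j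
      - (hMat (W z))⁻¹ m j * (hMat (W z))⁻¹ k l)) y
      = (wirt (.inr m) (fun z => (ρ z : ℂ) * (hMat (W z))⁻¹ m l) y * (hMat (W y))⁻¹ k j
        - wirt (.inr m) (fun z => (ρ z : ℂ) * (hMat (W z))⁻¹ m j) y * (hMat (W y))⁻¹ k l)
        + (ρ y : ℂ) * ((hMat (W y))⁻¹ m l * wirt (.inr m) (fun z => (hMat (W z))⁻¹ k j) y
    - (hMat (W y))⁻¹ m j * wirt (.inr m) (fun z => (hMat (W z))⁻¹ k l) y) := by
    intro m
    have h2 : (fun z => (ρ z : ℂ) * ((hMat (W z))⁻¹ m l * (hMat (W z))⁻¹ k j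
        - (hMat (W z))⁻¹ m j * (hMat (W z))⁻¹ k l))
        = fun z => ((ρ z : ℂ) * (hMat (W z))⁻¹ m l) * (hMat (W z))⁻¹ k j
          + (-1 : ℂ) • (((ρ z : ℂ) * (hMat (W z))⁻¹ m j) * (hMat (W z))⁻¹ k l) := by
      funext z
      rw [smul_eq_mul]
      ring
    rw [h2, wirt_add ((hρH m l).fun_mul (hH k j))
        (((hρH m j).fun_mul (hH k l)).fun_const_smul (-1 : ℂ)),
      wirt_const_smul _ ((hρH m j).fun_mul (hH k l)), wirt_mul (hρH m l) (hH k j),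
      wirt_mul (hρH m j) (hH k l), smul_eq_mul]
    ring
  rw [typeIIBFlux, laplacianFlux]
  simp only [h1]
  rw [Finset.sum_add_distrib, Finset.sum_sub_distrib, ← Finset.sum_mul, ← Finset.sum_mul, hc, hc,
    Finset.mul_sum]
  ring

end Fluxes

/-! ### Derivatives of Hermitian forms -/

section TimeDerivatives

variable {n k : ℕ} {J : Set ℝ} {t : ℝ}

lemma eq_neg_mul_mul_of_mul_add_mul_eq_zero {h H h' H' : Matrix (Fin n) (Fin n) ℂ}
    (hH : h * H = 1) (h0 : H' * h + H * h' = 0) : H' = -(H * h' * H) := by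
  have h1 : H' * h = -(H * h') := eq_neg_of_add_eq_zero_left h0
  calc H' = H' * h * H := by rw [Matrix.mul_assoc, hH, Matrix.mul_one]
    _ = -(H * h' * H) := by rw [h1, Matrix.neg_mul]

lemma _root_.HasDerivWithinAt.alt_apply {a : ℝ → Alt n k} {a' : Alt n k}
    (h : HasDerivWithinAt a a' J t) (v : Fin k → Cn n) :
    HasDerivWithinAt (fun s => a s v) (a' v) J t :=
  (ContinuousAlternatingMap.apply ℝ (Cn n) ℂ v).hasFDerivAt.comp_hasDerivWithinAt t h

/-- If a linear map takes the values of a form `a` to multiples `g τ` of a fixed element, it takes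
the time derivative of `a` to the multiple by that of `g`. -/
lemma map_hasDerivWithinAt_eq_smul {N : Type*} [AddCommGroup N] [Module ℂ N] (L : Alt n k →ₗ[ℂ] N)
    (τ : N) {a : ℝ → Alt n k} {a' : Alt n k} {g : ℝ → ℂ} {g' : ℂ} (hJ : UniqueDiffWithinAt ℝ J t)
    (ht : t ∈ J) (ha : HasDerivWithinAt a a' J t) (hg : HasDerivWithinAt g g' J t)
    (h : ∀ s ∈ J, L (a s) = g s • τ) : L a' = g' • τ := by
  rw [← sub_eq_zero, ← Module.forall_dual_apply_eq_zero_iff ℂ]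
  intro f
  have h1 : HasDerivWithinAt (fun s => (f ∘ₗ L) (a s)) ((f ∘ₗ L) a') J t :=
    ((f ∘ₗ L).toContinuousLinearMap.restrictScalars ℝ).hasFDerivAt.comp_hasDerivWithinAt t ha
  have h2 : HasDerivWithinAt (fun s => (f ∘ₗ L) (a s)) (g' * f τ) J t :=
    (hg.mul_const (f τ)).congr (fun s hs => by
      rw [LinearMap.comp_apply, h s hs, map_smul, smul_eq_mul])
      (by rw [LinearMap.comp_apply, h t ht, map_smul, smul_eq_mul])
  rw [map_sub, map_smul, smul_eq_mul, ← LinearMap.comp_apply, hJ.eq_deriv J h1 h2, sub_self]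

variable {w : ℝ → Alt n 2} {w' : Alt n 2}

lemma _root_.HasDerivWithinAt.hMat (h : HasDerivWithinAt w w' J t) (j k : Fin n) :
    HasDerivWithinAt (fun s => TypeIIB.hMat (w s) j k) (TypeIIB.hMat w' j k) J t :=
  ((h.alt_apply _).sub ((h.alt_apply _).const_mul _)).const_mul _

/-- The time derivative of a family of Hermitian forms is a real form of type `(1,1)`. -/
lemma derivative_real_type_one_one (hJ : UniqueDiffWithinAt ℝ J t) (ht : t ∈ J)
    (h : HasDerivWithinAt w w' J t) (hw : ∀ s ∈ J, IsHermitianForm (w s)) :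
    conjAlt w' = w' ∧ ∀ u v, w' ![mulI n u, mulI n v] = w' ![u, v] := by
  constructor
  · ext v
    have h1 := h.alt_apply v
    have h2 : HasDerivWithinAt (fun s => (starRingEnd ℂ) (w s v)) ((starRingEnd ℂ) (w' v)) J t :=
      Complex.conjCLE.toContinuousLinearMap.hasFDerivAt.comp_hasDerivWithinAt t h1
    refine hJ.eq_deriv J (h2.congr (fun s hs => ?_) ?_) h1
    · rw [← conjAlt_apply, (hw s hs).real]
    · rw [← conjAlt_apply, (hw t ht).real]
  · intro u v
    exact hJ.eq_deriv J (h.alt_apply _) ((h.alt_apply ![u, v]).congr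
      (fun s hs => (hw s hs).type_one_one u v) ((hw t ht).type_one_one u v))

lemma deriv_hMat_inv {H' : Matrix (Fin n) (Fin n) ℂ} (hJ : UniqueDiffWithinAt ℝ J t) (ht : t ∈ J)
    (h : HasDerivWithinAt w w' J t) (hw : ∀ s ∈ J, IsHermitianForm (w s))
    (hH : ∀ j k, HasDerivWithinAt (fun s => (hMat (w s))⁻¹ j k) (H' j k) J t) :
    H' = -((hMat (w t))⁻¹ * hMat w' * (hMat (w t))⁻¹) := by
  refine eq_neg_mul_mul_of_mul_add_mul_eq_zero (hw t ht).hMat_mul_inv ?_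
  ext j k
  have h1 := HasDerivWithinAt.fun_sum (u := Finset.univ) fun q _ => (hH j q).mul (h.hMat q k)
  have h2 : ∀ s ∈ J, ∑ q, (hMat (w s))⁻¹ j q * hMat (w s) q k = (1 : Matrix (Fin n) (Fin n) ℂ) j k :=
    fun s hs => by rw [← Matrix.mul_apply, (hw s hs).inv_mul_hMat]
  have h3 := hJ.eq_deriv J h1 ((hasDerivWithinAt_const t J _).congr h2 (h2 t ht))
  rw [Finset.sum_add_distrib] at h3
  rw [Matrix.add_apply, Matrix.mul_apply, Matrix.mul_apply, Matrix.zero_apply, ← h3]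

lemma IsHermitianForm.hermInner_inl_inr_of_isHermitian {w a : Alt n 2} (hw : IsHermitianForm w)
    (ha : conjAlt a = a ∧ ∀ u v, a ![mulI n u, mulI n v] = a ![u, v]) (j k : Fin n) :
    hermInner w (extWord 2 ![coframe (.inl j), coframe (.inr k)]) a
      = -Complex.I * ((hMat w)⁻¹ * hMat a * (hMat w)⁻¹) k j := by
  refine (congrArg (hermInner w _) (eq_oneOneForm ha.2)).trans ?_
  rw [hw.hermInner_inl_inr, Matrix.mul_apply, Finset.mul_sum]
  refine Finset.sum_congr rfl fun p _ => ?_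
  rw [Matrix.mul_apply, Finset.sum_mul, Finset.mul_sum]
  refine Finset.sum_congr rfl fun q _ => ?_
  have := (hMat_isHermitian ha.2 ha.1).apply q p
  rw [Matrix.smul_apply, smul_eq_mul, map_mul, Complex.conj_I, ← this]
  simp only [RCLike.star_def]
  ring

/-- The pairing `⟨dzʲ ∧ dz̄ᵏ, ∂_t ω⟩ = i ∂_t g^{k̄ j}`. -/
lemma hermInner_inl_inr_derivative {H' : ℂ} (hJ : UniqueDiffWithinAt ℝ J t) (ht : t ∈ J)
    (hws : ContDiffWithinAt ℝ ∞ w J t)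
    (h : HasDerivWithinAt w w' J t) (hw : ∀ s ∈ J, IsHermitianForm (w s)) (j k : Fin n)
    (hH : HasDerivWithinAt (fun s => (hMat (w s))⁻¹ k j) H' J t) :
    hermInner (w t) (extWord 2 ![coframe (.inl j), coframe (.inr k)]) w' = Complex.I * H' := by
  have h1 := deriv_hMat_inv (H' := Matrix.of fun a b => derivWithin (fun s => (hMat (w s))⁻¹ a b) J t)
    hJ ht h hw fun a b => ((hws.hMat_inv (hw t ht) a b).differentiableWithinAt
      (by simp)).hasDerivWithinAt
  have h2 : H' = -((hMat (w t))⁻¹ * hMat w' * (hMat (w t))⁻¹) k j := by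
    rw [← hH.derivWithin hJ, ← Matrix.neg_apply, ← h1]
    rfl
  rw [(hw t ht).hermInner_inl_inr_of_isHermitian (derivative_real_type_one_one hJ ht h hw), h2]
  ring

/-- Two-forms are determined by their products with the forms `dzʲ ∧ dzᵏ`, `dzʲ ∧ dz̄ᵏ` and
`dz̄ʲ ∧ dz̄ᵏ`. -/
lemma IsHermitianForm.two_form_ext {w β γ : Alt n 2} (hw : IsHermitianForm w)
    (h₁ : ∀ j k, hermInner w (extWord 2 ![coframe (.inl j), coframe (.inl k)]) β
      = hermInner w (extWord 2 ![coframe (.inl j), coframe (.inl k)]) γ)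
    (h₂ : ∀ j k, hermInner w (extWord 2 ![coframe (.inl j), coframe (.inr k)]) β
      = hermInner w (extWord 2 ![coframe (.inl j), coframe (.inr k)]) γ)
    (h₃ : ∀ j k, hermInner w (extWord 2 ![coframe (.inr j), coframe (.inr k)]) β
      = hermInner w (extWord 2 ![coframe (.inr j), coframe (.inr k)]) γ) : β = γ := by
  refine hw.eq_of_hermInner_extWord_eq fun e => ?_
  have he : (fun i => coframe (n := n) (e i)) = ![coframe (e 0), coframe (e 1)] := by
    funext i
    fin_cases i <;> rfl
  rw [he]
  rcases e 0 with j | j <;> rcases e 1 with k | k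
  · exact h₁ j k
  · exact h₂ j k
  · have hs : extWord 2 ![coframe (n := n) (.inr j), coframe (.inl k)]
        = (-1 : ℂ) • extWord 2 ![coframe (.inl k), coframe (.inr j)] := by
      rw [← extMul_extWord_one, ← extMul_extWord_one]
      have h1 : ∀ α : Alt n 2, -α = (-1 : ℂ) • α := fun α => by module
      exact (extMul_anticomm _ _ _).trans (h1 _)
    rw [hs, hermInner_smul_left, hermInner_smul_left, h₂]
  · exact h₃ j k

end TimeDerivatives

/-! ### The form `∂†∂ω` -/

section LaplacianCoefficients

variable {n : ℕ} {W : Cn n → Alt n 2} {y : Cn n}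

lemma _root_.ContDiffAt.hMat (hW : ContDiffAt ℝ ∞ W y) (j k : Fin n) :
    ContDiffAt ℝ ∞ (fun z => TypeIIB.hMat (W z) j k) y := by
  rw [← contDiffWithinAt_univ] at hW ⊢
  exact hW.hMat j k

/-- The derivative `∂(g⁻¹) = -g⁻¹ (∂g) g⁻¹`. -/
lemma wirt_hMat_inv (hW : ContDiffAt ℝ ∞ W y) (hy : ∀ᶠ z in nhds y, IsHermitianForm (W z))
    (c : Fin n ⊕ Fin n) :
    (Matrix.of fun j k => wirt c (fun z => (hMat (W z))⁻¹ j k) y)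
      = -((hMat (W y))⁻¹ * (Matrix.of fun j k => wirt c (fun z => hMat (W z) j k) y)
        * (hMat (W y))⁻¹) := by
  have hd : ∀ j k, DifferentiableAt ℝ (fun z => hMat (W z) j k) y := fun j k =>
    (hW.hMat j k).differentiableAt (by simp)
  have hdi : ∀ j k, DifferentiableAt ℝ (fun z => (hMat (W z))⁻¹ j k) y := fun j k =>
    (hW.hMat_inv hy.self_of_nhds j k).differentiableAt (by simp)
  refine eq_neg_mul_mul_of_mul_add_mul_eq_zero hy.self_of_nhds.hMat_mul_inv ?_
  ext j k
  have h1 : (fun z => ∑ q, (hMat (W z))⁻¹ j q * hMat (W z) q k)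
      =ᶠ[nhds y] fun _ => (1 : Matrix (Fin n) (Fin n) ℂ) j k := by
    filter_upwards [hy] with z hz
    rw [← Matrix.mul_apply, hz.inv_mul_hMat]
  have h2 := h1.wirt_eq c
  rw [wirt_const, wirt_sum _ fun q _ => (hdi j q).fun_mul (hd q k)] at h2
  simp only [wirt_mul (hdi j _) (hd _ k)] at h2
  rw [Finset.sum_add_distrib] at h2
  rw [Matrix.add_apply, Matrix.mul_apply, Matrix.mul_apply, Matrix.zero_apply, ← h2]
  rfl

/-- `∂ω = i ∑ ∂_p g_{q r̄} dzᵖ ∧ dz^q ∧ dz̄ʳ`. -/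
lemma coordDel_hermitian (hW : ContDiffAt ℝ ∞ W y) (hy : ∀ᶠ z in nhds y, IsHermitianForm (W z)) :
    coordDel W y = ∑ p, ∑ q, ∑ r, (Complex.I * wirt (.inl p) (fun z => hMat (W z) q r) y) •
      extWord 3 ![coframe (.inl p), coframe (.inl q), coframe (.inr r)] := by
  rw [coordDel_eq_sum]
  refine Finset.sum_congr rfl fun p _ => ?_
  have h1 : W =ᶠ[nhds y] fun z => ∑ q, ∑ r, (Complex.I * hMat (W z) q r) •
      extWord 2 ![coframe (.inl q), coframe (.inr r)] := by
    filter_upwards [hy] with z hz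
    conv_lhs => rw [hz.eq_oneOne]
    rfl
  have hd : ∀ q r, DifferentiableAt ℝ (fun z => Complex.I * hMat (W z) q r) y := fun q r =>
    ((hW.hMat q r).differentiableAt (by simp)).const_mul _
  have hds : ∀ q r, DifferentiableAt ℝ (fun z => (Complex.I * hMat (W z) q r) •
      extWord 2 ![coframe (n := n) (.inl q), coframe (.inr r)]) y := fun q r =>
    (hd q r).fun_smul (differentiableAt_const _)
  rw [h1.wirt_eq, wirt_sum _ fun q _ => DifferentiableAt.fun_sum fun r _ => hds q r, map_sum]
  refine Finset.sum_congr rfl fun q _ => ?_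
  rw [wirt_sum _ fun r _ => hds q r, map_sum]
  refine Finset.sum_congr rfl fun r _ => ?_
  rw [wirt_smul (hd q r) (differentiableAt_const _), wirt_const, alt_smul_zero, add_zero, map_smul,
    extMul_extWord_two]
  congr 1
  exact wirt_const_smul Complex.I ((hW.hMat q r).differentiableAt (by simp)) _

/-- `ρ ⟨dzˡ ∧ dzʲ ∧ dz̄ᵏ, ∂ω⟩ = i ρ (g^{p̄ l} ∂_p̄ g^{k̄ j} - g^{p̄ j} ∂_p̄ g^{k̄ l})`. -/
lemma delPairing_coordDel (ρ : Cn n → ℝ) (hW : ContDiffAt ℝ ∞ W y)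
    (hy : ∀ᶠ z in nhds y, IsHermitianForm (W z)) (l j k : Fin n) :
    delPairing ρ W (coordDel W) l (extWord 2 ![coframe (.inl j), coframe (.inr k)]) y
      = Complex.I * laplacianFlux ρ W k l j y := by
  have hyy := hy.self_of_nhds
  rw [delPairing, extMul_extWord_two, coordDel_hermitian hW hy, hyy.hermInner_inl_inl_inr,
    laplacianFlux, mul_left_comm]
  refine congrArg ((ρ y : ℂ) * ·) ?_
  rw [Finset.mul_sum]
  have h1 : ∀ p q r, (starRingEnd ℂ) (Complex.I * wirt (.inl p) (fun z => hMat (W z) q r) y)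
      = -Complex.I * wirt (.inr p) (fun z => hMat (W z) r q) y := by
    intro p q r
    have h2 := wirt_conj ((hW.hMat q r).differentiableAt (by simp)) (.inr p)
    rw [map_mul, Complex.conj_I]
    congr 1
    refine h2.symm.trans (Filter.EventuallyEq.wirt_eq ?_ _)
    filter_upwards [hy] with z hz
    exact hz.isHermitian.apply r q
  have h2 : ∀ p a b, wirt (.inr p) (fun z => (hMat (W z))⁻¹ a b) y
      = -∑ q, ∑ r, (hMat (W y))⁻¹ a r * wirt (.inr p) (fun z => hMat (W z) r q) y
        * (hMat (W y))⁻¹ q b := by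
    intro p a b
    have h3 := congrFun (congrFun (wirt_hMat_inv hW hy (.inr p)) a) b
    rw [Matrix.of_apply] at h3
    rw [h3, Matrix.neg_apply, Matrix.mul_apply]
    simp only [Matrix.mul_apply, Finset.sum_mul, Matrix.of_apply]
  refine Finset.sum_congr rfl fun p _ => ?_
  rw [h2, h2, mul_neg, mul_neg, Finset.mul_sum, Finset.mul_sum, ← Finset.sum_neg_distrib,
    ← Finset.sum_neg_distrib, ← Finset.sum_sub_distrib, Finset.mul_sum]
  refine Finset.sum_congr rfl fun q _ => ?_
  rw [Finset.mul_sum, Finset.mul_sum, ← Finset.sum_neg_distrib,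
    ← Finset.sum_neg_distrib, ← Finset.sum_sub_distrib, Finset.mul_sum]
  refine Finset.sum_congr rfl fun r _ => ?_
  rw [h1]
  ring

end LaplacianCoefficients

section LaplacianForm

variable {n : ℕ} {M : Type*} [TopologicalSpace M] [ChartedSpace (Cn n) M]
  [IsManifold 𝓘(ℂ, Cn n) ∞ M] [MeasurableSpace M] [BorelSpace M] [T2Space M]
  [SecondCountableTopology M] {w : M → Alt n 2} {Θ : M → Alt n n} {x₀ : M} {y : Cn n}

lemma hermInner_rep_delDagger_del (hw : IsHermitianMetric w) (hΘ : IsHolomorphicVolumeForm Θ)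
    (hy : y ∈ (chartAt (Cn n) x₀).target) (A : Alt n 2) :
    (volDensity Θ x₀ y : ℂ) * hermInner (rep x₀ w y) A (rep x₀ (delDagger w Θ (del w)) y)
      = -∑ l, wirt (.inl l) (delPairing (volDensity Θ x₀) (rep x₀ w) (coordDel (rep x₀ w)) l A) y := by
  rw [hermInner_rep_delDagger hw hΘ hw.smooth.del hy]
  refine congrArg Neg.neg (Finset.sum_congr rfl fun l _ => Filter.EventuallyEq.wirt_eq ?_ _)
  filter_upwards [hw.smooth.eventually_rep_del hy] with z hz
  rw [delPairing, delPairing, hz]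

lemma hermInner_inl_inr_delDagger_del (hw : IsHermitianMetric w) (hΘ : IsHolomorphicVolumeForm Θ)
    (hy : y ∈ (chartAt (Cn n) x₀).target) (j k : Fin n) :
    (volDensity Θ x₀ y : ℂ) * hermInner (rep x₀ w y)
        (extWord 2 ![coframe (.inl j), coframe (.inr k)]) (rep x₀ (delDagger w Θ (del w)) y)
      = -(Complex.I * ∑ l, wirt (.inl l) (laplacianFlux (volDensity Θ x₀) (rep x₀ w) k l j) y) := by
  rw [hermInner_rep_delDagger_del hw hΘ hy, Finset.mul_sum]
  refine congrArg Neg.neg (Finset.sum_congr rfl fun l _ => ?_)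
  have hW := hw.smooth.contDiffAt hy
  have h1 : delPairing (volDensity Θ x₀) (rep x₀ w) (coordDel (rep x₀ w)) l
      (extWord 2 ![coframe (.inl j), coframe (.inr k)]) =ᶠ[nhds y]
      fun z => Complex.I • laplacianFlux (volDensity Θ x₀) (rep x₀ w) k l j z := by
    filter_upwards [(chartAt (Cn n) x₀).open_target.mem_nhds hy] with z hz
    exact delPairing_coordDel _ (hw.smooth.contDiffAt hz) (hw.eventually_rep hz) l j k
  rw [h1.wirt_eq, wirt_const_smul _ ((contDiffAt_laplacianFlux (hΘ.contDiffAt_volDensity hy) hW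
    (hw.rep hy) k l j).differentiableAt (by simp)), smul_eq_mul]

lemma hermInner_delDagger_del_eq_zero (hw : IsHermitianMetric w) (hΘ : IsHolomorphicVolumeForm Θ)
    (hy : y ∈ (chartAt (Cn n) x₀).target) {A : Alt n 2}
    (hA : ∀ l, ∀ w : Alt n 2, IsHermitianForm w → ∀ t : Fin n → Fin n → Fin n → ℂ,
      hermInner w (extMul (coframe (.inl l)) A) (∑ p, ∑ q, ∑ r, t p q r •
        extWord 3 ![coframe (.inl p), coframe (.inl q), coframe (.inr r)]) = 0) :
    hermInner (rep x₀ w y) A (rep x₀ (delDagger w Θ (del w)) y) = 0 := by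
  refine (mul_eq_zero.1 ?_).resolve_left
    (Complex.ofReal_ne_zero.2 (hΘ.volDensity_pos (x₀ := x₀) hy).ne')
  rw [hermInner_rep_delDagger_del hw hΘ hy, neg_eq_zero]
  refine Finset.sum_eq_zero fun l _ => ?_
  have h1 : delPairing (volDensity Θ x₀) (rep x₀ w) (coordDel (rep x₀ w)) l A =ᶠ[nhds y]
      fun z => 0 := by
    filter_upwards [(chartAt (Cn n) x₀).open_target.mem_nhds hy] with z hz
    rw [delPairing, coordDel_hermitian (hw.smooth.contDiffAt hz) (hw.eventually_rep hz),
      hA l _ (hw.rep hz), mul_zero]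
  rw [h1.wirt_eq, wirt_const]

lemma hermInner_inl_inl_delDagger_del (hw : IsHermitianMetric w) (hΘ : IsHolomorphicVolumeForm Θ)
    (hy : y ∈ (chartAt (Cn n) x₀).target) (j k : Fin n) : hermInner (rep x₀ w y)
      (extWord 2 ![coframe (.inl j), coframe (.inl k)]) (rep x₀ (delDagger w Θ (del w)) y) = 0 :=
  hermInner_delDagger_del_eq_zero hw hΘ hy fun l w hw t => by
    rw [extMul_extWord_two, hw.hermInner_inl_inl_inl]

lemma hermInner_inr_inr_delDagger_del (hw : IsHermitianMetric w) (hΘ : IsHolomorphicVolumeForm Θ)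
    (hy : y ∈ (chartAt (Cn n) x₀).target) (j k : Fin n) : hermInner (rep x₀ w y)
      (extWord 2 ![coframe (.inr j), coframe (.inr k)]) (rep x₀ (delDagger w Θ (del w)) y) = 0 :=
  hermInner_delDagger_del_eq_zero hw hΘ hy fun l w hw t => by
    rw [extMul_extWord_two, hw.hermInner_inl_inr_inr]

end LaplacianForm

/-! ### The form `∂∂̄(‖Ω‖²_ω ωⁿ⁻²)` -/

section FourMinors

variable {n k : ℕ}

/-- The coefficients of `‖Ω‖²_ω ωⁿ⁻²` as `2 × 2` minors of `g⁻¹`. Relative to those of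
`‖Ω‖²_ω ωⁿ⁻¹` they carry the factor `-i/(n - 1)`, the origin of the constant in the flow. -/
lemma IsHermitianForm.xyOp_xyOp_smul_wedgePow {w : Alt n 2} {r d : ℝ} (hn : 2 ≤ n)
    (hw : IsHermitianForm w) (hd : (volConst n : ℂ) * (r * (hMat w).det) = d) (l m j k : Fin n) :
    xyOp n l m (xyOp n j k (incl n _ (r • wedgePow w (n - 2))))
      = ((-Complex.I * powConst n * ((n : ℂ) - 1)⁻¹) * (d *
        ((hMat w)⁻¹ m l * (hMat w)⁻¹ k j - (hMat w)⁻¹ m j * (hMat w)⁻¹ k l))) • topForm n := by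
  have h1 : (volConst n : ℂ) ≠ 0 := Complex.ofReal_ne_zero.2 volConst_pos.ne'
  obtain ⟨p, rfl⟩ : ∃ p, n = p + 2 := ⟨n - 2, by omega⟩
  have h2 : ((p : ℂ) + 1) ≠ 0 := Nat.cast_add_one_ne_zero p
  have h3 : (((p + 2 : ℕ) : ℂ) - 1) = p + 1 := by push_cast; ring
  have h4 : (((p + 2 - 1).factorial : ℕ) : ℂ) = (p + 1) * p.factorial := by
    rw [show p + 2 - 1 = p + 1 by omega, Nat.factorial_succ]
    push_cast
    ring
  rw [← alt_coe_smul r, map_smul, map_smul, map_smul, hw.incl_wedgePow,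
    xyOp_xyOp_oneOneOp_pow hw.inv_mul, smul_smul, det_I_smul]
  simp only [Matrix.smul_apply, smul_eq_mul]
  rw [← hd, powConst, h3, h4, show p + 2 - 2 = p by omega]
  congr 1
  field_simp

lemma inl_inl_xyOp_smul_wedgePow {w : Alt n 2} {r : ℝ} (hw : IsHermitianForm w) (j k l m : Fin n) :
    extOp (coframe (.inl j)) (extOp (coframe (.inl k)) (xyOp n l m
      (incl n _ (r • wedgePow w (n - 2))))) = 0 := by
  rw [← alt_coe_smul r, map_smul, map_smul, map_smul, map_smul, hw.incl_wedgePow,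
    inl_inl_xyOp_oneOneOp_pow, smul_zero]

lemma inr_inr_xyOp_smul_wedgePow {w : Alt n 2} {r : ℝ} (hw : IsHermitianForm w) (j k l m : Fin n) :
    extOp (coframe (.inr j)) (extOp (coframe (.inr k)) (xyOp n l m
      (incl n _ (r • wedgePow w (n - 2))))) = 0 := by
  rw [← alt_coe_smul r, map_smul, map_smul, map_smul, map_smul, hw.incl_wedgePow,
    inr_inr_xyOp_oneOneOp_pow, smul_zero]

/-- Forms of degree at most `2n - 2` are determined by their products with the forms `dzʲ ∧ dzᵏ`,
`dzʲ ∧ dz̄ᵏ` and `dz̄ʲ ∧ dz̄ᵏ`. -/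
lemma eq_of_extOp_extOp_eq (hk : k + 1 < n + n) {α β : Alt n k}
    (h₁ : ∀ i j, extOp (coframe (.inl i)) (extOp (coframe (.inl j)) (incl n k α))
      = extOp (coframe (.inl i)) (extOp (coframe (.inl j)) (incl n k β)))
    (h₂ : ∀ i j, xyOp n i j (incl n k α) = xyOp n i j (incl n k β))
    (h₃ : ∀ i j, extOp (coframe (.inr i)) (extOp (coframe (.inr j)) (incl n k α))
      = extOp (coframe (.inr i)) (extOp (coframe (.inr j)) (incl n k β))) : α = β := by
  have h : ∀ c d, extOp (coframe c) (extOp (coframe d) (incl n k α))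
      = extOp (coframe c) (extOp (coframe d) (incl n k β)) := by
    intro c d
    rcases c with i | i <;> rcases d with j | j
    · exact h₁ i j
    · exact h₂ i j
    · rw [← Module.End.mul_apply, ← Module.End.mul_apply, extOp_anticomm, LinearMap.neg_apply,
        LinearMap.neg_apply]
      exact congrArg Neg.neg (h₂ j i)
    · exact h₃ i j
  rw [← sub_eq_zero]
  refine eq_zero_of_extMul_coframe_eq_zero (by omega) _ fun d =>
    eq_zero_of_extMul_coframe_eq_zero hk _ fun c => incl_injective ?_
  rw [← extOp_incl, ← extOp_incl, map_sub, map_sub, map_sub, h, sub_self, map_zero]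

end FourMinors

section MixedDerivative

variable {n k : ℕ} {y : Cn n}

lemma map_wirt_wirt_eq_smul {N : Type*} [AddCommGroup N] [Module ℂ N] (L : Alt n k →ₗ[ℂ] N) (τ : N)
    {a : Cn n → Alt n k} {g : Cn n → ℂ} (ha : ContDiffAt ℝ ∞ a y) (hg : ContDiffAt ℝ ∞ g y)
    (h : ∀ᶠ z in nhds y, L (a z) = g z • τ) (c d : Fin n ⊕ Fin n) :
    L (wirt c (wirt d a) y) = wirt c (wirt d g) y • τ := by
  refine map_wirt_eq_smul L τ ((ha.wirt d).differentiableAt (by simp))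
    ((hg.wirt d).differentiableAt (by simp)) ?_ c
  have ha1 := (ha.of_le (m := 1) (by simp)).eventually (by simp)
  have hg1 := (hg.of_le (m := 1) (by simp)).eventually (by simp)
  filter_upwards [h.eventually_nhds, ha1, hg1] with z h1 h2 h3
  exact map_wirt_eq_smul L τ (h2.differentiableAt (by simp)) (h3.differentiableAt (by simp)) h1 d

lemma incl_coordDel_coordDelBar {a : Cn n → Alt n k} (ha : ContDiffAt ℝ ∞ a y) :
    incl n _ (coordDel (coordDelBar a) y)
      = ∑ l, ∑ m, xyOp n l m (incl n k (wirt (.inl l) (wirt (.inr m) a) y)) := by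
  have hd : ∀ m, DifferentiableAt ℝ (wirt (.inr m) a) y := fun m =>
    (ha.wirt _).differentiableAt (by simp)
  have hde : ∀ m, DifferentiableAt ℝ
      (fun z => extMul (coframe (.inr m)) (wirt (.inr m) a z)) y := fun m =>
    ((extMul (coframe (.inr m))).toContinuousLinearMap.restrictScalars ℝ).differentiableAt.comp y
      (hd m)
  rw [coordDel_eq_sum, map_sum]
  refine Finset.sum_congr rfl fun l _ => ?_
  rw [funext fun z => coordDelBar_eq_sum a z, wirt_sum _ fun m _ => hde m, map_sum, map_sum]
  refine Finset.sum_congr rfl fun m _ => ?_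
  rw [wirt_linear _ (hd m), ← extOp_incl, ← extOp_incl]
  rfl

variable {ρ r : Cn n → ℝ} {W : Cn n → Alt n 2} {Ψ : Cn n → Alt n (2 * (n - 2))}

/-- The components of `i∂∂̄(r ωⁿ⁻²)` of type `(n-1,n-1)`, paired with `dzʲ ∧ dz̄ᵏ`. -/
lemma xyOp_coordDel_coordDelBar (hn : 2 ≤ n) (hρ : ContDiffAt ℝ ∞ ρ y) (hW : ContDiffAt ℝ ∞ W y)
    (hy : ∀ᶠ z in nhds y, IsHermitianForm (W z)) (hΨ : ContDiffAt ℝ ∞ Ψ y)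
    (hd : ∀ᶠ z in nhds y, (volConst n : ℂ) * (r z * (hMat (W z)).det) = ρ z)
    (hΨW : ∀ᶠ z in nhds y, Ψ z = r z • wedgePow (W z) (n - 2)) (j k : Fin n) :
    xyOp n j k (incl n _ (Complex.I • coordDel (coordDelBar Ψ) y))
      = (powConst n * (((n : ℂ) - 1)⁻¹ * ∑ l, wirt (.inl l) (typeIIBFlux ρ W k l j) y))
        • topForm n := by
  have hm : ∀ l m, ContDiffAt ℝ ∞ (fun z => (ρ z : ℂ) * ((hMat (W z))⁻¹ m l * (hMat (W z))⁻¹ k j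
      - (hMat (W z))⁻¹ m j * (hMat (W z))⁻¹ k l)) y := fun l m =>
    contDiffAt_minor hρ hW hy.self_of_nhds k l j m
  have h1 : ∀ l m, xyOp n j k (xyOp n l m (incl n _ (wirt (.inl l) (wirt (.inr m) Ψ) y)))
      = ((-Complex.I * powConst n * ((n : ℂ) - 1)⁻¹) * wirt (.inl l) (wirt (.inr m) (fun z => (ρ z : ℂ) *
        ((hMat (W z))⁻¹ m l * (hMat (W z))⁻¹ k j - (hMat (W z))⁻¹ m j * (hMat (W z))⁻¹ k l))) y)
          • topForm n := by
    intro l m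
    have h2 := map_wirt_wirt_eq_smul (xyOp n l m ∘ₗ xyOp n j k ∘ₗ incl n _)
      ((-Complex.I * powConst n * ((n : ℂ) - 1)⁻¹) • topForm n) hΨ (hm l m) (by
        filter_upwards [hy, hd, hΨW] with z h1 h2 h3
        rw [LinearMap.comp_apply, LinearMap.comp_apply, h3, h1.xyOp_xyOp_smul_wedgePow hn h2,
          smul_smul, mul_comm]) (.inl l) (.inr m)
    rw [LinearMap.comp_apply, LinearMap.comp_apply, smul_smul] at h2
    rw [← Module.End.mul_apply, xyOp_comm_xyOp, Module.End.mul_apply, h2, mul_comm]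
  rw [map_smul, map_smul, incl_coordDel_coordDelBar hΨ, map_sum]
  simp only [map_sum, h1]
  have h3 : ∀ l, wirt (.inl l) (typeIIBFlux ρ W k l j) y
      = ∑ m, wirt (.inl l) (wirt (.inr m) (fun z => (ρ z : ℂ) *
        ((hMat (W z))⁻¹ m l * (hMat (W z))⁻¹ k j - (hMat (W z))⁻¹ m j * (hMat (W z))⁻¹ k l))) y :=
    fun l => wirt_sum _ (fun m _ => ((hm l m).wirt _).differentiableAt (by simp)) _
  simp only [h3, ← Finset.sum_smul, ← Finset.mul_sum]
  rw [smul_smul]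
  congr 1
  linear_combination (-(powConst n * ((n : ℂ) - 1)⁻¹ * ∑ l, ∑ m, wirt (.inl l) (wirt (.inr m)
    (fun z => (ρ z : ℂ) * ((hMat (W z))⁻¹ m l * (hMat (W z))⁻¹ k j
      - (hMat (W z))⁻¹ m j * (hMat (W z))⁻¹ k l))) y)) * Complex.I_mul_I

/-- Products with constant covectors commute with `∂∂̄`, up to the factors `dzˡ ∧ dz̄ᵐ`. -/
lemma extOp_coordDel_coordDelBar_eq_zero (hΨ : ContDiffAt ℝ ∞ Ψ y) {φ ψ : CoVec n}
    (h : ∀ l m, ∀ᶠ z in nhds y, extOp φ (extOp ψ (xyOp n l m (incl n _ (Ψ z)))) = 0) :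
    extOp φ (extOp ψ (incl n _ (Complex.I • coordDel (coordDelBar Ψ) y))) = 0 := by
  rw [map_smul, map_smul, map_smul, incl_coordDel_coordDelBar hΨ]
  simp only [map_sum]
  rw [Finset.sum_eq_zero, smul_zero]
  intro l _
  refine Finset.sum_eq_zero fun m _ => ?_
  have h2 := map_wirt_wirt_eq_smul (extOp φ ∘ₗ extOp ψ ∘ₗ xyOp n l m ∘ₗ incl n _)
    0 hΨ (contDiffAt_const (c := (0 : ℂ))) (by
      filter_upwards [h l m] with z hz
      rw [smul_zero]
      exact hz) (.inl l) (.inr m)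
  rw [smul_zero] at h2
  exact h2

end MixedDerivative

/-! ### The time derivative of `‖Ω‖²_ω ωⁿ⁻¹` -/

section TimeDerivativePower

variable {n : ℕ} {J : Set ℝ} {t : ℝ} {w : ℝ → Alt n 2} {r : ℝ → ℝ} {d : ℝ}
  {Φ : ℝ → Alt n (2 * (n - 1))} {Φ' : Alt n (2 * (n - 1))}

lemma xyOp_derivative (hJ : UniqueDiffWithinAt ℝ J t) (ht : t ∈ J)
    (hw : ∀ s ∈ J, IsHermitianForm (w s))
    (hd : ∀ s ∈ J, (volConst n : ℂ) * (r s * (hMat (w s)).det) = d)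
    (hΦw : ∀ s ∈ J, Φ s = r s • wedgePow (w s) (n - 1)) (hΦ : HasDerivWithinAt Φ Φ' J t)
    {H' : ℂ} {j k : Fin n} (hH : HasDerivWithinAt (fun s => (hMat (w s))⁻¹ k j) H' J t) :
    xyOp n j k (incl n _ Φ') = (powConst n * (d * H')) • topForm n :=
  map_hasDerivWithinAt_eq_smul (xyOp n j k ∘ₗ incl n _) (topForm n) hJ ht hΦ
    ((hH.const_mul (d : ℂ)).const_mul (powConst n)) fun s hs => by
      rw [LinearMap.comp_apply, hΦw s hs, (hw s hs).xyOp_smul_wedgePow (hd s hs)]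

lemma extOp_derivative_eq_zero (hJ : UniqueDiffWithinAt ℝ J t) (ht : t ∈ J)
    (hΦ : HasDerivWithinAt Φ Φ' J t) {φ ψ : CoVec n}
    (h : ∀ s ∈ J, extOp φ (extOp ψ (incl n _ (Φ s))) = 0) :
    extOp φ (extOp ψ (incl n _ Φ')) = 0 := by
  have := map_hasDerivWithinAt_eq_smul (extOp φ ∘ₗ extOp ψ ∘ₗ incl n _) 0 hJ ht hΦ
    (hasDerivWithinAt_const t J (0 : ℂ)) fun s hs => by
      rw [smul_zero]
      exact h s hs
  rwa [smul_zero] at this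

end TimeDerivativePower

/-! ### The flows in coordinates -/

section Flows

variable {n k : ℕ} {M : Type*} [TopologicalSpace M] [ChartedSpace (Cn n) M]
  {J : Set ℝ} {w : ℝ → M → Alt n 2} {Θ : M → Alt n n} {x₀ : M} {y : Cn n} {t : ℝ}

lemma SmoothFamily.contDiffWithinAt_time {α : ℝ → M → Alt n k} (h : SmoothFamily J α) (ht : t ∈ J)
    (hy : y ∈ (chartAt (Cn n) x₀).target) :
    ContDiffWithinAt ℝ ∞ (fun s => rep x₀ (α s) y) J t :=
  (h x₀ (t, y) ⟨ht, hy⟩).comp t (contDiffWithinAt_id.prodMk contDiffWithinAt_const)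
    fun _ hs => mk_mem_prod hs hy

/-- If a time-dependent form solves an evolution equation at every point, then so do its
representatives in the charts. -/
lemma hasDerivWithinAt_rep {α : ℝ → M → Alt n k} {β : M → Alt n k}
    (h : HasDerivWithinAt (fun s => α s ((chartAt (Cn n) x₀).symm y))
      (β ((chartAt (Cn n) x₀).symm y)) J t) :
    HasDerivWithinAt (fun s => rep x₀ (α s) y) (rep x₀ β y) J t := by
  let L : Alt n k →L[ℝ] Alt n k := ContinuousAlternatingMap.compContinuousLinearMapCLM
    (fderiv ℝ (transition ((chartAt (Cn n) x₀).symm y) x₀) y)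
  have h1 : HasDerivWithinAt (fun s => L (α s ((chartAt (Cn n) x₀).symm y)))
      (L (β ((chartAt (Cn n) x₀).symm y))) J t := L.hasFDerivAt.comp_hasDerivWithinAt t h
  exact h1

lemma rep_neg_smul_const (c : ℝ) (α : M → Alt n k) (x₀ : M) (y : Cn n) :
    rep x₀ (fun x => -(c • α x)) y = -(c • rep x₀ α y) := rfl

variable [IsManifold 𝓘(ℂ, Cn n) ∞ M]

lemma hasDerivWithinAt_hMat_inv_rep (hw : SmoothFamily J w) (hpos : ∀ s ∈ J, IsHermitianMetric (w s))
    (ht : t ∈ J) (hy : y ∈ (chartAt (Cn n) x₀).target) (k j : Fin n) :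
    HasDerivWithinAt (fun s => (hMat (rep x₀ (w s) y))⁻¹ k j)
      (derivWithin (fun s => (hMat (rep x₀ (w s) y))⁻¹ k j) J t) J t :=
  (((hw.contDiffWithinAt_time ht hy).hMat_inv ((hpos t ht).rep hy) k
    j).differentiableWithinAt (by simp)).hasDerivWithinAt

section Laplacian

variable [MeasurableSpace M] [BorelSpace M] [T2Space M] [SecondCountableTopology M]

/-- The Laplacian flow at one point: two-forms agree if their products with all pairs of elements
of the coframe do. The products with `dzʲ ∧ dzᵏ` and `dz̄ʲ ∧ dz̄ᵏ` vanish on both sides, and the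
product of `dzʲ ∧ dz̄ᵏ` with `∂_t ω` is `∂_t g^{k̄ j}` up to a constant. -/
lemma hasDerivWithinAt_rep_laplacian_iff (hJ : UniqueDiffOn ℝ J) (hw : SmoothFamily J w)
    (hpos : ∀ s ∈ J, IsHermitianMetric (w s)) (hΘ : IsHolomorphicVolumeForm Θ) (c : ℝ) (ht : t ∈ J)
    (hy : y ∈ (chartAt (Cn n) x₀).target) :
    HasDerivWithinAt (fun s => rep x₀ (w s) y)
        (-(c • rep x₀ (delDagger (w t) Θ (del (w t))) y)) J t
      ↔ ∀ k j, (volDensity Θ x₀ y : ℂ) * derivWithin (fun s => (hMat (rep x₀ (w s) y))⁻¹ k j) J t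
        = c * ∑ l, wirt (.inl l) (laplacianFlux (volDensity Θ x₀) (rep x₀ (w t)) k l j) y := by
  have hρ : (volDensity Θ x₀ y : ℂ) ≠ 0 := Complex.ofReal_ne_zero.2 (hΘ.volDensity_pos hy).ne'
  have hwt := hpos t ht
  have hws := hw.contDiffWithinAt_time ht hy
  have hherm : ∀ s ∈ J, IsHermitianForm (rep x₀ (w s) y) := fun s hs => (hpos s hs).rep hy
  have hrhs : ∀ A : Alt n 2, hermInner (rep x₀ (w t) y) A
      (-(c • rep x₀ (delDagger (w t) Θ (del (w t))) y))
      = -(c * hermInner (rep x₀ (w t) y) A (rep x₀ (delDagger (w t) Θ (del (w t))) y)) := by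
    intro A
    rw [hermInner_neg_right, ← alt_coe_smul, hermInner_smul_right, Complex.conj_ofReal]
  have hkey : ∀ {w' : Alt n 2}, HasDerivWithinAt (fun s => rep x₀ (w s) y) w' J t → ∀ k j,
      (volDensity Θ x₀ y : ℂ) * derivWithin (fun s => (hMat (rep x₀ (w s) y))⁻¹ k j) J t
        = -Complex.I * ((volDensity Θ x₀ y : ℂ) *
          hermInner (rep x₀ (w t) y) (extWord 2 ![coframe (.inl j), coframe (.inr k)]) w') := by
    intro w' h k j
    rw [hermInner_inl_inr_derivative (hJ t ht) ht hws h hherm j k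
      (hasDerivWithinAt_hMat_inv_rep hw hpos ht hy k j)]
    linear_combination ((volDensity Θ x₀ y : ℂ) *
      derivWithin (fun s => (hMat (rep x₀ (w s) y))⁻¹ k j) J t) * Complex.I_mul_I
  have hR := hermInner_inl_inr_delDagger_del (x₀ := x₀) hwt hΘ hy
  constructor
  · intro h k j
    rw [hkey h, hrhs, mul_neg, mul_left_comm, hR]
    linear_combination (-(c : ℂ) * ∑ l, wirt (.inl l)
      (laplacianFlux (volDensity Θ x₀) (rep x₀ (w t)) k l j) y) * Complex.I_mul_I
  · intro h
    have hd := (hws.differentiableWithinAt (by simp)).hasDerivWithinAt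
    have hty := derivative_real_type_one_one (hJ t ht) ht hd hherm
    refine hd.congr_deriv ((hherm t ht).two_form_ext (fun j k => ?_) (fun j k => ?_) fun j k => ?_)
    · rw [hrhs, hermInner_inl_inl_delDagger_del hwt hΘ hy, mul_zero, neg_zero]
      exact (congrArg (hermInner _ _) (eq_oneOneForm hty.2)).trans
        ((hherm t ht).hermInner_inl_inl j k _)
    · refine mul_left_cancel₀ hρ (mul_left_cancel₀ (neg_ne_zero.2 Complex.I_ne_zero) ?_)
      rw [← hkey hd, h, hrhs, mul_neg, mul_left_comm, hR]
      linear_combination (c * ∑ l, wirt (.inl l)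
        (laplacianFlux (volDensity Θ x₀) (rep x₀ (w t)) k l j) y) * Complex.I_mul_I
    · rw [hrhs, hermInner_inr_inr_delDagger_del hwt hΘ hy, mul_zero, neg_zero]
      exact (congrArg (hermInner _ _) (eq_oneOneForm hty.2)).trans
        ((hherm t ht).hermInner_inr_inr j k _)

/-- The Laplacian flow as an evolution equation for `ρ g^{k̄ j}`. -/
lemma laplacianFlow_iff (hJ : UniqueDiffOn ℝ J) (hw : SmoothFamily J w)
    (hpos : ∀ s ∈ J, IsHermitianMetric (w s)) (hΘ : IsHolomorphicVolumeForm Θ) (c : ℝ) :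
    LaplacianFlow c J w Θ ↔ ∀ t ∈ J, ∀ x₀ : M, ∀ y ∈ (chartAt (Cn n) x₀).target, ∀ k j,
      (volDensity Θ x₀ y : ℂ) * derivWithin (fun s => (hMat (rep x₀ (w s) y))⁻¹ k j) J t
        = c * ∑ l, wirt (.inl l) (laplacianFlux (volDensity Θ x₀) (rep x₀ (w t)) k l j) y := by
  constructor
  · intro h t ht x₀ y hy
    rw [← hasDerivWithinAt_rep_laplacian_iff hJ hw hpos hΘ c ht hy, ← rep_neg_smul_const]
    exact hasDerivWithinAt_rep (h t ht _)
  · intro h t ht x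
    have h1 := (hasDerivWithinAt_rep_laplacian_iff hJ hw hpos hΘ c ht
      (mem_chart_target (Cn n) x)).2 (h t ht x _ (mem_chart_target _ _))
    simpa only [rep_self] using h1

end Laplacian

/-- The Type IIB flow at one point: forms of degree `2n - 2` agree if their products with all pairs
of elements of the coframe do, and those with `dzʲ ∧ dzᵏ` or `dz̄ʲ ∧ dz̄ᵏ` vanish on both sides. -/
lemma hasDerivWithinAt_rep_typeIIB_iff (hn : 2 ≤ n) (hJ : UniqueDiffOn ℝ J) (hw : SmoothFamily J w)
    (hpos : ∀ s ∈ J, IsHermitianMetric (w s)) (hΘ : IsHolomorphicVolumeForm Θ) (ht : t ∈ J)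
    (hy : y ∈ (chartAt (Cn n) x₀).target) :
    (∀ v : Fin (2 * (n - 1)) → Cn n,
      HasDerivWithinAt (fun s => rep x₀ (weightedPow (w s) Θ (n - 1)) y v)
        (Complex.I * rep x₀ (del (delBar (weightedPow (w t) Θ (n - 2)))) y
          (fun a => v (Fin.cast (by omega) a))) J t)
      ↔ ∀ k j, (volDensity Θ x₀ y : ℂ) * derivWithin (fun s => (hMat (rep x₀ (w s) y))⁻¹ k j) J t
        = ((n : ℂ) - 1)⁻¹ *
          ∑ l, wirt (.inl l) (typeIIBFlux (volDensity Θ x₀) (rep x₀ (w t)) k l j) y := by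
  have hwt := hpos t ht
  have hU := (chartAt (Cn n) x₀).open_target.mem_nhds hy
  have hherm : ∀ s ∈ J, IsHermitianForm (rep x₀ (w s) y) := fun s hs => (hpos s hs).rep hy
  have hdeg : 2 * (n - 2) + 1 + 1 = 2 * (n - 1) := by omega
  set Ψ := rep x₀ (weightedPow (w t) Θ (n - 2)) with hΨdef
  have hΨ : ContDiffAt ℝ ∞ Ψ y := contDiffAt_rep_weightedPow hwt hΘ _ hy
  have hΨs : SmoothForm (weightedPow (w t) Θ (n - 2)) := fun x z hz =>
    (contDiffAt_rep_weightedPow hwt hΘ _ hz).contDiffWithinAt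
  have hΨW : ∀ᶠ z in nhds y, Ψ z
      = normSq (rep x₀ (w t) z) (rep x₀ Θ z) • wedgePow (rep x₀ (w t) z) (n - 2) := by
    filter_upwards [hU] with z hz using rep_weightedPow _ _ _ hz
  have hvol : ∀ᶠ z in nhds y, (volConst n : ℂ) *
      (normSq (rep x₀ (w t) z) (rep x₀ Θ z) * (hMat (rep x₀ (w t) z)).det) = volDensity Θ x₀ z := by
    filter_upwards [hU] with z hz using volConst_mul_normSq_mul_det hwt hΘ hz
  have hE : rep x₀ (del (delBar (weightedPow (w t) Θ (n - 2)))) y = coordDel (coordDelBar Ψ) y := by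
    rw [rep_del hy (hΨs.delBar.smoothFormAt _), (hΨs.eventually_rep_delBar hy).coordDel_eq]
  -- the family is differentiable in time, with derivative `Φ'`
  set Φ : ℝ → Alt n (2 * (n - 1)) := fun s => rep x₀ (weightedPow (w s) Θ (n - 1)) y with hΦdef
  have hΦw : ∀ s, Φ s = normSq (rep x₀ (w s) y) (rep x₀ Θ y) • wedgePow (rep x₀ (w s) y) (n - 1) :=
    fun s => rep_weightedPow _ _ _ hy
  obtain ⟨Φ', hΦ⟩ : ∃ Φ', HasDerivWithinAt Φ Φ' J t := by
    have hws := hw.contDiffWithinAt_time ht hy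
    have h1 : ContDiffWithinAt ℝ ∞ (fun s => ((normSq (rep x₀ (w s) y) (rep x₀ Θ y) : ℝ) : ℂ) •
        wedgePow (rep x₀ (w s) y) (n - 1)) J t :=
      (hws.normSq (hherm t ht) contDiffWithinAt_const).ofReal.alt_smul (hws.wedgePow _)
    have h2 : Φ = fun s => ((normSq (rep x₀ (w s) y) (rep x₀ Θ y) : ℝ) : ℂ) •
        wedgePow (rep x₀ (w s) y) (n - 1) := funext fun s => by rw [hΦw, alt_coe_smul]
    rw [← h2] at h1
    exact ⟨_, (h1.differentiableWithinAt (by simp)).hasDerivWithinAt⟩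
  have hvt : ∀ s ∈ J, (volConst n : ℂ) *
      (normSq (rep x₀ (w s) y) (rep x₀ Θ y) * (hMat (rep x₀ (w s) y)).det) = volDensity Θ x₀ y :=
    fun s hs => volConst_mul_normSq_mul_det (hpos s hs) hΘ hy
  have hincl : (∀ v : Fin (2 * (n - 1)) → Cn n, HasDerivWithinAt (fun s => Φ s v)
      (Complex.I * coordDel (coordDelBar Ψ) y (fun a => v (Fin.cast hdeg a))) J t)
      ↔ incl n _ Φ' = incl n _ (Complex.I • coordDel (coordDelBar Ψ) y) := by
    constructor
    · intro h
      refine (incl_eq_incl hdeg fun v => ?_).symm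
      exact (hJ t ht).eq_deriv J (h v) (hΦ.alt_apply v)
    · intro h v
      refine (hΦ.alt_apply v).congr_deriv ?_
      exact (eq_of_incl_eq_incl hdeg h.symm v).symm
  have hL : ∀ j k, xyOp n j k (incl n _ Φ') = (powConst n * (volDensity Θ x₀ y *
      derivWithin (fun s => (hMat (rep x₀ (w s) y))⁻¹ k j) J t)) • topForm n := fun j k =>
    xyOp_derivative (hJ t ht) ht hherm hvt (fun s _ => hΦw s) hΦ
      (hasDerivWithinAt_hMat_inv_rep hw hpos ht hy k j)
  have hR := xyOp_coordDel_coordDelBar hn (hΘ.contDiffAt_volDensity hy) (hwt.smooth.contDiffAt hy)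
    (hwt.eventually_rep hy) hΨ hvol hΨW
  rw [hE, hincl]
  constructor
  · intro h k j
    have h1 := hL j k
    rw [h, hR] at h1
    exact (mul_left_cancel₀ powConst_ne_zero (smul_left_injective ℂ topForm_ne_zero h1)).symm
  · intro h
    obtain ⟨E, hEE⟩ : ∃ E : Alt n (2 * (n - 1)),
        incl n _ E = incl n _ (Complex.I • coordDel (coordDelBar Ψ) y) := by
      rw [← hdeg]
      exact ⟨_, rfl⟩
    rw [← hEE]
    refine congrArg _ (eq_of_extOp_extOp_eq (by omega) (fun i j => ?_) (fun j k => ?_) fun i j => ?_)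
    · rw [hEE, extOp_coordDel_coordDelBar_eq_zero hΨ fun l m => ?_]
      · refine extOp_derivative_eq_zero (hJ t ht) ht hΦ fun s hs => ?_
        rw [hΦw, (hherm s hs).inl_inl_smul_wedgePow]
      · filter_upwards [hwt.eventually_rep hy, hΨW] with z h1 h2
        rw [h2, inl_inl_xyOp_smul_wedgePow h1]
    · rw [hEE, hL, hR, h]
    · rw [hEE, extOp_coordDel_coordDelBar_eq_zero hΨ fun l m => ?_]
      · refine extOp_derivative_eq_zero (hJ t ht) ht hΦ fun s hs => ?_
        rw [hΦw, (hherm s hs).inr_inr_smul_wedgePow]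
      · filter_upwards [hwt.eventually_rep hy, hΨW] with z h1 h2
        rw [h2, inr_inr_xyOp_smul_wedgePow h1]

/-- The Type IIB flow as an evolution equation for `ρ g^{k̄ j}`. -/
lemma typeIIBFlow_iff (hn : 2 ≤ n) (hJ : UniqueDiffOn ℝ J) (hw : SmoothFamily J w)
    (hpos : ∀ s ∈ J, IsHermitianMetric (w s)) (hΘ : IsHolomorphicVolumeForm Θ) :
    TypeIIBFlow hn J w Θ ↔ ∀ t ∈ J, ∀ x₀ : M, ∀ y ∈ (chartAt (Cn n) x₀).target, ∀ k j,
      (volDensity Θ x₀ y : ℂ) * derivWithin (fun s => (hMat (rep x₀ (w s) y))⁻¹ k j) J t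
        = ((n : ℂ) - 1)⁻¹ *
          ∑ l, wirt (.inl l) (typeIIBFlux (volDensity Θ x₀) (rep x₀ (w t)) k l j) y := by
  constructor
  · intro h t ht x₀ y hy
    rw [← hasDerivWithinAt_rep_typeIIB_iff hn hJ hw hpos hΘ ht hy]
    exact fun v => h t ht ((chartAt (Cn n) x₀).symm y) fun a =>
      fderiv ℝ (transition ((chartAt (Cn n) x₀).symm y) x₀) y (v a)
  · intro h t ht x v
    have h1 := (hasDerivWithinAt_rep_typeIIB_iff hn hJ hw hpos hΘ ht
      (mem_chart_target (Cn n) x)).2 (h t ht x _ (mem_chart_target _ _)) v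
    simpa only [rep_self] using h1

end Flows

/-! ### Equivalence of the flows -/

section Equivalence

variable {n : ℕ} {M : Type*} [TopologicalSpace M] [ChartedSpace (Cn n) M]
  {J : Set ℝ} {w : ℝ → M → Alt n 2} {Θ : M → Alt n n}

/-- Rescaling of time turns the factor `c` into one. -/
lemma laplacianFlow_rescale [MeasurableSpace M] {c : ℝ} (hc : c ≠ 0) :
    LaplacianFlow c⁻¹ J w Θ ↔ LaplacianFlow 1 ((fun s : ℝ => c * s) ⁻¹' J) (fun s => w (c * s)) Θ := by
  constructor
  · intro h s hs x
    have h1 : HasDerivWithinAt (fun s : ℝ => c * s) c ((fun s : ℝ => c * s) ⁻¹' J) s := by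
      simpa using ((hasDerivAt_id s).const_mul c).hasDerivWithinAt
    refine ((h (c * s) hs x).scomp s h1 fun _ hr => hr).congr_deriv ?_
    rw [smul_neg, smul_smul, mul_inv_cancel₀ hc]
  · intro h t ht x
    have ht' : c * (c⁻¹ * t) = t := mul_inv_cancel_left₀ hc t
    have hmem : c⁻¹ * t ∈ (fun s : ℝ => c * s) ⁻¹' J := by
      rw [mem_preimage, ht']
      exact ht
    have h1 : HasDerivWithinAt (fun s : ℝ => c⁻¹ * s) c⁻¹ J t := by
      simpa using ((hasDerivAt_id t).const_mul c⁻¹).hasDerivWithinAt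
    have h2 := (h (c⁻¹ * t) hmem x).scomp t h1 fun r hr => by
      rw [mem_preimage, mul_inv_cancel_left₀ hc]
      exact hr
    have h3 : (fun s => w (c * s) x) ∘ (fun s : ℝ => c⁻¹ * s) = fun s => w s x := by
      funext s
      rw [Function.comp_apply, mul_inv_cancel_left₀ hc]
    rw [h3] at h2
    refine h2.congr_deriv ?_
    simp only [ht', one_smul, smul_neg]

variable [IsManifold 𝓘(ℂ, Cn n) ∞ M]

/-- A family evolving by the divergence of an antisymmetric flux stays balanced. -/
lemma divergence_eq_zero_of_flow (hJ : J.OrdConnected) (hJ' : J.Nontrivial) (hw : SmoothFamily J w)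
    (hpos : ∀ s ∈ J, IsHermitianMetric (w s)) (hΘ : IsHolomorphicVolumeForm Θ) {c : ℂ}
    {S : M → ℝ → Fin n → Fin n → Fin n → Cn n → ℂ}
    (hS : ∀ x₀ : M, ∀ t ∈ J, ∀ z ∈ (chartAt (Cn n) x₀).target, ∀ k l j,
      ContDiffAt ℝ ∞ (S x₀ t k l j) z)
    (hanti : ∀ x₀ : M, ∀ t ∈ J, ∀ z ∈ (chartAt (Cn n) x₀).target, ∀ k l j,
      S x₀ t k l j z = -S x₀ t k j l z)
    (hev : ∀ t ∈ J, ∀ x₀ : M, ∀ y ∈ (chartAt (Cn n) x₀).target, ∀ k j,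
      (volDensity Θ x₀ y : ℂ) * derivWithin (fun s => (hMat (rep x₀ (w s) y))⁻¹ k j) J t
        = c * ∑ l, wirt (.inl l) (S x₀ t k l j) y)
    {t₀ : ℝ} (ht₀ : t₀ ∈ J) (h0 : ∀ x₀ : M, ∀ y ∈ (chartAt (Cn n) x₀).target, ∀ k,
      divergence (volDensity Θ x₀) (rep x₀ (w t₀)) k y = 0) {t : ℝ} (ht : t ∈ J) (x₀ : M) :
    ∀ y ∈ (chartAt (Cn n) x₀).target, ∀ k,
      divergence (volDensity Θ x₀) (rep x₀ (w t)) k y = 0 := fun y hy k =>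
  divergence_eq_zero_of_evolution hJ hJ' (chartAt (Cn n) x₀).open_target
    (fun _ hz => (hΘ.contDiffAt_volDensity hz).contDiffWithinAt) (hw x₀)
    (fun s hs _ hz => (hpos s hs).rep hz) (fun s hs z hz => hS x₀ s hs z hz k)
    (fun s hs z hz => hanti x₀ s hs z hz k) (fun s hs z hz => hev s hs x₀ z hz k) ht₀ hy
    (h0 x₀ y hy k) ht

lemma sum_wirt_typeIIBFlux (hΘ : IsHolomorphicVolumeForm Θ) {w : M → Alt n 2}
    (hw : IsHermitianMetric w) {x₀ : M} {y : Cn n} (hy : y ∈ (chartAt (Cn n) x₀).target)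
    (h : ∀ z ∈ (chartAt (Cn n) x₀).target, ∀ k, divergence (volDensity Θ x₀) (rep x₀ w) k z = 0)
    (k j : Fin n) : ∑ l, wirt (.inl l) (typeIIBFlux (volDensity Θ x₀) (rep x₀ w) k l j) y
      = ∑ l, wirt (.inl l) (laplacianFlux (volDensity Θ x₀) (rep x₀ w) k l j) y := by
  refine Finset.sum_congr rfl fun l _ => Filter.EventuallyEq.wirt_eq ?_ _
  filter_upwards [(chartAt (Cn n) x₀).open_target.mem_nhds hy] with z hz
  exact typeIIBFlux_eq_laplacianFlux (hΘ.contDiffAt_volDensity hz) (hw.smooth.contDiffAt hz)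
    (hw.eventually_rep hz) (h z hz) k l j

variable [MeasurableSpace M] [BorelSpace M] [T2Space M] [SecondCountableTopology M]

/-- Either flow preserves the balanced condition, and for balanced metrics the right-hand sides of
the two evolution equations agree. -/
lemma typeIIBFlow_iff_laplacianFlow (hn : 2 ≤ n) (hJ : J.OrdConnected) (hJ' : J.Nontrivial)
    (hw : SmoothFamily J w) (hpos : ∀ s ∈ J, IsHermitianMetric (w s))
    (hΘ : IsHolomorphicVolumeForm Θ) {t₀ : ℝ} (ht₀ : t₀ ∈ J)
    (hb : ConformallyBalanced (w t₀) Θ) :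
    TypeIIBFlow hn J w Θ ↔ LaplacianFlow ((n : ℝ) - 1)⁻¹ J w Θ := by
  have hJu := uniqueDiffOn_of_ordConnected hJ hJ'
  have h0 := (conformallyBalanced_iff_divergence (by omega) (hpos t₀ ht₀) hΘ).1 hb
  have hc : ((((n : ℝ) - 1)⁻¹ : ℝ) : ℂ) = ((n : ℂ) - 1)⁻¹ := by push_cast; rfl
  rw [typeIIBFlow_iff hn hJu hw hpos hΘ, laplacianFlow_iff hJu hw hpos hΘ, hc]
  constructor
  · intro h t ht x₀ y hy k j
    rw [h t ht x₀ y hy k j, sum_wirt_typeIIBFlux hΘ (hpos t ht) hy]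
    refine divergence_eq_zero_of_flow
      (S := fun x₀ t => typeIIBFlux (volDensity Θ x₀) (rep x₀ (w t)))
      hJ hJ' hw hpos hΘ (fun x₀ t ht z hz k l j => ?_) (fun x₀ t ht z hz k l j => ?_) h ht₀ h0 ht x₀
    · exact contDiffAt_typeIIBFlux (hΘ.contDiffAt_volDensity hz)
        ((hpos t ht).smooth.contDiffAt hz) ((hpos t ht).rep hz) k l j
    · exact typeIIBFlux_antisymm (hΘ.contDiffAt_volDensity hz)
        ((hpos t ht).smooth.contDiffAt hz) ((hpos t ht).rep hz) k l j
  · intro h t ht x₀ y hy k j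
    rw [h t ht x₀ y hy k j, sum_wirt_typeIIBFlux hΘ (hpos t ht) hy]
    refine divergence_eq_zero_of_flow
      (S := fun x₀ t => laplacianFlux (volDensity Θ x₀) (rep x₀ (w t)))
      hJ hJ' hw hpos hΘ (fun x₀ t ht z hz k l j => ?_)
      (fun x₀ t ht z hz k l j => laplacianFlux_antisymm k l j) h ht₀ h0 ht x₀
    exact contDiffAt_laplacianFlux (hΘ.contDiffAt_volDensity hz)
      ((hpos t ht).smooth.contDiffAt hz) ((hpos t ht).rep hz) k l j

end Equivalence

end TypeIIB

end

open TypeIIB in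
theorem theorem4 {n : ℕ} (hn : 1 ≤ n) {M : Type*} [TopologicalSpace M] [T2Space M]
    [SecondCountableTopology M] [ChartedSpace (Cn n) M] [IsManifold 𝓘(ℂ, Cn n) ∞ M]
    [MeasurableSpace M] [BorelSpace M]
    (Θ : M → Alt n n) (hΘ : IsHolomorphicVolumeForm Θ) :
    -- the operator conjugated to `∂` is well defined
    (∀ w : M → Alt n 2, IsHermitianMetric w →
      ∀ (k : ℕ) (β : M → Alt n (k + 1)), SmoothForm β →
        ∀ γ : M → Alt n k, (SmoothForm γ ∧ IsDelAdjoint w Θ β γ) ↔ γ = delDagger w Θ β) ∧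
    -- the conformally balanced condition
    (∀ w : M → Alt n 2, IsHermitianMetric w →
      (ConformallyBalanced w Θ ↔ delDagger w Θ w = 0)) ∧
    -- the Type IIB flow, with conformally balanced initial data
    (∀ (hn2 : 2 ≤ n) (J : Set ℝ), J.OrdConnected → J.Nontrivial →
      ∀ w : ℝ → M → Alt n 2, SmoothFamily J w → (∀ t ∈ J, IsHermitianMetric (w t)) →
        ∀ t₀ ∈ J, ConformallyBalanced (w t₀) Θ →
          (TypeIIBFlow hn2 J w Θ ↔ LaplacianFlow ((n : ℝ) - 1)⁻¹ J w Θ) ∧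
          (TypeIIBFlow hn2 J w Θ ↔
            LaplacianFlow 1 ((fun s : ℝ => ((n : ℝ) - 1) * s) ⁻¹' J)
              (fun s => w (((n : ℝ) - 1) * s)) Θ)) := by
  refine ⟨fun w hw k β hβ γ => isDelAdjoint_iff hw hΘ hβ γ,
    fun w hw => conformallyBalanced_iff_delDagger hn hw hΘ,
    fun hn2 J hJ hJ' w hw hpos t₀ ht₀ hb => ?_⟩
  have h := typeIIBFlow_iff_laplacianFlow hn2 hJ hJ' hw hpos hΘ ht₀ hb
  have hc : (n : ℝ) - 1 ≠ 0 := by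
    have : (2 : ℝ) ≤ n := by exact_mod_cast hn2
    linarith
  exact ⟨h, h.trans (laplacianFlow_rescale hc)⟩
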